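/- All graphs are simple and undirected, and $N(x)$ denotes the set of neighbours of $x$. The triangle graph $\mathcal T(G)$ of a graph $G$ has the triangles ($K_3$ subgraphs) of $G$ as vertices, two of them being adjacent iff the triangles share an edge. $K_5-K_3$ is $K_5$ with the edges of one triangle deleted, $W_4=K_1\vee C_4$ is the wheel with four spokes, and $C_n^2$ is the square of the $n$-cycle (distinct vertices are adjacent iff their distance in $C_n$ is at most $2$). *Elementary types:* $W_4$, and $C_n^2$ for $n\ge 7$. *Supplementary types:* each consists of vertices $v_1,\dots,v_k$ and $u_i$ ($i\in I$), with the edges $v_iv_{i+1}$ ($1\le i\le k$), the edges $u_iv_{i-1},u_iv_i,u_iv_{i+1}$ ($i\in I$), and some chords, where subscripts of the $v$'s are taken modulo $k$: - $S_A$: $k=4$, $I=\{1,2,3,4\}$, no chords; - $S_B$: $k=5$, $I=\{1,2,3\}$, chords $v_3v_5,\ v_4v_1$; - $S_C$: $k=6$, $I=\{1,2\}$, chords $v_2v_4,\ v_3v_5,\ v_4v_6,\ v_5v_1$; - $S_D$: $k=6$, $I=\{1,4\}$, chords $v_1v_3,\ v_2v_4,\ v_4v_6,\ v_5v_1$. *Edge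 splitting:* if the edge $xy$ is contained in exactly one triangle $xyz$, while $xz$ and $zy$ each belong to more than one triangle, replace $xy$ by a path $xwy$ with a new vertex $w$ and add the edge $wz$. *Vertex sticking:* if the vertices $u,v$ are at distance at least $4$, remove $u$ and $v$ and add a new vertex $w$ adjacent to all vertices of $N(u)\cup N(v)$. **Theorem.** Let $G$ be a graph which contains no isolated vertices and whose every edge is contained in at least one triangle. Then $\mathcal T(G)\cong C_n$ for some $n\ge 3$ if and only if 1. $G\cong K_5-K_3$, or 2. $G$ is isomorphic to one of the elementary or supplementary types, or 3. $G$ can be obtained, up to isomorphism, from one of the elementary or supplementary types by a finite sequence of edge splittings and vertex stickings (in any order). Moreover, $\mathcal T(G)$ is an odd hole, i.e. $\mathcal T(G)\cong C_n$ for some odd $n\ge5$, if and only if - $G$ can be obtained, up to isomorphism, from $W_4$, from one of $S_A,S_B,S_C,S_D$, or from $C_m^2$ with $m\ge 8$ even, by a finite sequence consisting of an odd number of edge splittings and any number of vertex stickings (in any order), or - $G$ can be obtained, up to isomorphism, from $C_m^2$ with $m\ge7$ odd by a finite, possibly empty, sequence consisting of an even number of edge splittings and any number of vertex stickings (in any order).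 -/

import Mathlib

universe u v

namespace TriangleGraphs

/-- The triangle graph `T(G)`: its vertices are the triangles (3-cliques) of `G`, and two
distinct triangles are adjacent when they share an edge of `G`. -/
def triangleGraph {V : Type u} (G : SimpleGraph V) : SimpleGraph (G.cliqueSet 3) where
  Adj s t := s ≠ t ∧ ∃ a b : V, G.Adj a b ∧
    a ∈ (s : Finset V) ∧ b ∈ (s : Finset V) ∧ a ∈ (t : Finset V) ∧ b ∈ (t : Finset V)
  symm := ⟨fun _ _ ⟨hne, a, b, hab, h₁, h₂, h₃, h₄⟩ => ⟨hne.symm, a, b, hab, h₃, h₄, h₁, h₂⟩⟩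
  loopless := ⟨fun _ h => h.1 rfl⟩

/-- The join `G ∨ H`: disjoint copies of `G` and `H` together with all edges between them. -/
def joinGraph {V : Type u} {W : Type v} (G : SimpleGraph V) (H : SimpleGraph W) :
    SimpleGraph (V ⊕ W) :=
  (G ⊕g H) ⊔ completeBipartiteGraph V W

/-- The wheel `W_n = K_1 ∨ C_n`. -/
def wheelGraph (n : ℕ) : SimpleGraph (Fin 1 ⊕ Fin n) :=
  joinGraph (⊤ : SimpleGraph (Fin 1)) (SimpleGraph.cycleGraph n)

/-- The power `G^k`: distinct vertices are adjacent when their distance in `G` is at most `k`. -/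
def powerGraph {V : Type u} (G : SimpleGraph V) (k : ℕ) : SimpleGraph V where
  Adj x y := x ≠ y ∧ G.edist x y ≤ (k : ℕ∞)
  symm := ⟨fun x y h => ⟨h.1.symm, by rw [SimpleGraph.edist_comm]; exact h.2⟩⟩
  loopless := ⟨fun _ h => h.1 rfl⟩

/-- The square `C_n^2` of the `n`-cycle. -/
def cycleSquare (n : ℕ) : SimpleGraph (Fin n) := powerGraph (SimpleGraph.cycleGraph n) 2

/-- `K_5 - K_3`: the complete graph on five vertices with the edge set of a triangle deleted. -/
def K5MinusK3 : SimpleGraph (Fin 5) :=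
  (⊤ : SimpleGraph (Fin 5)).deleteEdges {s(0, 1), s(1, 2), s(0, 2)}

/-- The graph on `{v_i | i ∈ ZMod k} ∪ {u_i | i ∈ I}` with edges `v_i v_{i+1}` (all `i`),
`v_i v_j` for `(i, j) ∈ C`, and `u_i v_{i-1}`, `u_i v_i`, `u_i v_{i+1}` for `i ∈ I`.
Here `Sum.inl i` is `v_i` and `Sum.inr i` is `u_i`; `fromRel` symmetrizes. -/
def decoratedCycle (k : ℕ) (C : Finset (ZMod k × ZMod k)) (I : Finset (ZMod k)) :
    SimpleGraph (ZMod k ⊕ {i : ZMod k // i ∈ I}) :=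
  SimpleGraph.fromRel fun a b =>
    match a, b with
    | Sum.inl i, Sum.inl j => j = i + 1 ∨ (i, j) ∈ C
    | Sum.inr i, Sum.inl j => j = (i : ZMod k) - 1 ∨ j = (i : ZMod k) ∨ j = (i : ZMod k) + 1
    | _, _ => False

/-- The supplementary type `S_A`: vertices `v_1,…,v_4,u_1,…,u_4`, no chord. -/
def SA := decoratedCycle 4 ∅ {1, 2, 3, 4}

/-- The supplementary type `S_B`: vertices `v_1,…,v_5,u_1,u_2,u_3`, chords `v_3v_5, v_4v_1`. -/
def SB := decoratedCycle 5 {(3, 5), (4, 1)} {1, 2, 3}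

/-- The supplementary type `S_C`: vertices `v_1,…,v_6,u_1,u_2`,
chords `v_2v_4, v_3v_5, v_4v_6, v_5v_1`. -/
def SC := decoratedCycle 6 {(2, 4), (3, 5), (4, 6), (5, 1)} {1, 2}

/-- The supplementary type `S_D`: vertices `v_1,…,v_6,u_1,u_4`,
chords `v_1v_3, v_2v_4, v_4v_6, v_5v_1`. -/
def SD := decoratedCycle 6 {(1, 3), (2, 4), (4, 6), (5, 1)} {1, 4}

/-- `G` is (isomorphic to) one of the elementary types: `W_4`, or `C_n^2` with `n ≥ 7`. -/
def IsElementary {V : Type u} (G : SimpleGraph V) : Prop :=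
  Nonempty (G ≃g wheelGraph 4) ∨ ∃ n : ℕ, 7 ≤ n ∧ Nonempty (G ≃g cycleSquare n)

/-- `G` is (isomorphic to) one of the supplementary types. -/
def IsSupplementary {V : Type u} (G : SimpleGraph V) : Prop :=
  Nonempty (G ≃g SA) ∨ Nonempty (G ≃g SB) ∨ Nonempty (G ≃g SC) ∨ Nonempty (G ≃g SD)

/-- The edge `xy` can be split at its triangle `xyz`: `xyz` is the only triangle containing `xy`,
while `xz` and `zy` each belong to more than one triangle. (Triangles containing an edge `ab`
correspond to common neighbors of `a` and `b`.) -/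
structure CanSplit {V : Type u} (G : SimpleGraph V) (x y z : V) : Prop where
  adj : G.Adj x y
  unique : G.commonNeighbors x y = {z}
  left : (G.commonNeighbors x z).Nontrivial
  right : (G.commonNeighbors z y).Nontrivial

/-- Splitting the edge `xy` of the triangle `xyz`: the edge `xy` is replaced by the path `x w y`
with a new vertex `w` (here `none`), and the edge `wz` is added. -/
def edgeSplit {V : Type u} (G : SimpleGraph V) (x y z : V) : SimpleGraph (Option V) :=
  SimpleGraph.fromRel fun a b =>
    match a, b with
    | some a, some b => G.Adj a b ∧ s(a, b) ≠ s(x, y)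
    | none, some b => b = x ∨ b = y ∨ b = z
    | _, none => False

/-- Sticking `u` and `v`: both are removed and a new vertex `w` (here `none`), adjacent to
all of `N(u) ∪ N(v)`, is introduced. -/
def vertexStick {V : Type u} (G : SimpleGraph V) (u v : V) :
    SimpleGraph (Option {a : V // a ≠ u ∧ a ≠ v}) :=
  SimpleGraph.fromRel fun a b =>
    match a, b with
    | some a, some b => G.Adj a b
    | none, some b => G.Adj u b ∨ G.Adj v b
    | _, none => False

/-- `ObtainedFrom G₀ k G`: up to isomorphism, `G` can be obtained from `G₀` by a finite (possibly
empty) sequence of edge splittings and vertex stickings in any order, among which there are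
exactly `k` edge splittings. A vertex sticking needs two vertices at distance at least `4`
(the extended distance is `⊤` between different components). -/
inductive ObtainedFrom {V₀ : Type u} (G₀ : SimpleGraph V₀) :
    ℕ → ∀ {V : Type u}, SimpleGraph V → Prop
  | iso {V : Type u} {G : SimpleGraph V} (e : G₀ ≃g G) : ObtainedFrom G₀ 0 G
  | split {k : ℕ} {V V' : Type u} {G : SimpleGraph V} {G' : SimpleGraph V'} {x y z : V}
      (hG : ObtainedFrom G₀ k G) (h : CanSplit G x y z) (e : edgeSplit G x y z ≃g G') :
      ObtainedFrom G₀ (k + 1) G'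
  | stick {k : ℕ} {V V' : Type u} {G : SimpleGraph V} {G' : SimpleGraph V'} {x y : V}
      (hG : ObtainedFrom G₀ k G) (h : 4 ≤ G.edist x y) (e : vertexStick G x y ≃g G') :
      ObtainedFrom G₀ k G'

end TriangleGraphs

/-! Both operations act simply on triangle graphs. Splitting `xy` replaces the triangle `xyz` by two
triangles sharing the edge `wz`, so the old triangle graph arises from the new one by contracting
one edge (`CanSplit.isContraction`), and a cycle grows by exactly one. Sticking identifies vertices
so far apart that no edges merge and no triangle is created, so the triangle graph does not change
(`triangleGraph_vertexStick`). The types have triangle graphs C_4 (wheel), C_8 (supplementary) and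
C_m (the square of C_m). Hence `k` splittings lead from C_m to C_{m+k} (`ObtainedFrom.triCycle`),
which also settles the parity statement.

Conversely, length 3 forces K_5 - K_3 directly (`iso_K5MinusK3`). For n ≥ 4 the triangles form a
cyclic strip `t i`, indexed by ℤ with period n, and exactly one vertex `d i` is lost between `t i`
and `t (i + 1)`. If a vertex is lost twice within a period, its neighbourhood falls into two parts
and a sticking can be undone (`Strip.exists_unstick`). If a vertex lies in all triangles, the graph
is a wheel, which is W_4 or comes from a splitting (`Strip.exists_unsplit_of_hub`). Otherwise `d`
lists every vertex once per period. A vertex of degree three can then be removed by undoing a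
splitting unless its two boundary neighbours have an extra common neighbour.

If there is no vertex of degree three, the graph is the square of C_n with n ≥ 7
(`iso_cycleSquare`). If there are some but none is removable, the strip is determined by n and their
positions, and the extra common neighbour is a short cut around the strip which forces n ≤ 10
(`le_ten`). A finite check (`strip_rigid`) leaves n = 8 and the four supplementary types.
`exists_base` puts this into a double induction: undoing a splitting lowers n, and undoing a
sticking keeps n but adds a vertex, while there are at most 3n vertices. -/

namespace TriangleGraphs

/-! ### Cyclic enumerations and contraction of an edge of a cycle -/

/-- `c` enumerates the vertices of `H` along a cycle of length `n` which is all of `H`. -/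
structure IsCyc {W : Type*} (H : SimpleGraph W) (n : ℕ) (c : ℕ → W) : Prop where
  inj : ∀ i j, i < j → j < n → c i ≠ c j
  surj : ∀ w, ∃ i, i < n ∧ c i = w
  adj : ∀ i j, i < j → j < n → (H.Adj (c i) (c j) ↔ j = i + 1 ∨ (i = 0 ∧ j + 1 = n))

theorem cycleGraph_adj_of_lt {n i j : ℕ} (hij : i < j) (hj : j < n) :
    (SimpleGraph.cycleGraph n).Adj ⟨i, hij.trans hj⟩ ⟨j, hj⟩ ↔ j = i + 1 ∨ (i = 0 ∧ j + 1 = n) := by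
  rw [SimpleGraph.cycleGraph_adj']
  simp only [Fin.sub_def]
  have h1 : (n - j + i) % n = n - j + i := Nat.mod_eq_of_lt (by omega)
  have h2 : (n - i + j) % n = j - i := by
    rw [show n - i + j = j - i + n by omega, Nat.add_mod_right, Nat.mod_eq_of_lt (by omega)]
  rw [h1, h2]
  omega

theorem IsCyc.of_iso {W : Type*} {H : SimpleGraph W} {n : ℕ} (hn : 0 < n)
    (e : H ≃g SimpleGraph.cycleGraph n) : ∃ c, IsCyc H n c := by
  refine ⟨fun i => e.symm ⟨i % n, Nat.mod_lt _ hn⟩, ?_, ?_, ?_⟩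
  · intro i j hij hj h
    have := e.symm.injective h
    rw [Fin.mk.injEq, Nat.mod_eq_of_lt hj, Nat.mod_eq_of_lt (hij.trans hj)] at this
    omega
  · intro w
    refine ⟨e w, (e w).2, ?_⟩
    simp [Nat.mod_eq_of_lt (e w).2]
  · intro i j hij hj
    rw [e.symm.map_adj_iff, ← cycleGraph_adj_of_lt hij hj]
    simp only [Nat.mod_eq_of_lt hj, Nat.mod_eq_of_lt (hij.trans hj)]

theorem IsCyc.iso {W : Type*} {H : SimpleGraph W} {n : ℕ} {c : ℕ → W} (h : IsCyc H n c) :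
    Nonempty (H ≃g SimpleGraph.cycleGraph n) := by
  have hb : Function.Bijective (fun i : Fin n => c i) := by
    constructor
    · intro i j hij
      rcases lt_trichotomy i.1 j.1 with h' | h' | h'
      · exact absurd hij (h.inj _ _ h' j.2)
      · exact Fin.ext h'
      · exact absurd hij.symm (h.inj _ _ h' i.2)
    · intro w
      obtain ⟨i, hi, rfl⟩ := h.surj w
      exact ⟨⟨i, hi⟩, rfl⟩
  refine ⟨SimpleGraph.Iso.symm ⟨Equiv.ofBijective _ hb, ?_⟩⟩
  intro i j
  simp only [Equiv.ofBijective_apply]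
  rcases lt_trichotomy i.1 j.1 with h' | h' | h'
  · rw [h.adj _ _ h' j.2, ← cycleGraph_adj_of_lt h' j.2]
  · obtain rfl := Fin.ext h'
    simp
  · rw [SimpleGraph.adj_comm, h.adj _ _ h' i.2, ← cycleGraph_adj_of_lt h' i.2,
      SimpleGraph.adj_comm]

/-- Rotation of a cyclic enumeration, so that the vertex of index `r` comes last. -/
theorem IsCyc.rotate {W : Type*} {H : SimpleGraph W} {n : ℕ} {c : ℕ → W} (h : IsCyc H n c)
    (hn : 3 ≤ n) {r : ℕ} (hr : r < n) :
    ∃ c', IsCyc H n c' ∧ c' (n - 1) = c r ∧ ∀ i, i + (r + 1) < n → c' i = c (i + (r + 1)) := by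
  set f : ℕ → ℕ := fun i => if i + (r + 1) < n then i + (r + 1) else i + (r + 1) - n with hf
  refine ⟨fun i => c (f i), ⟨?_, ?_, ?_⟩, ?_, fun i hi => by simp only [hf, if_pos hi]⟩
  · intro i j hij hj
    rcases lt_trichotomy (f i) (f j) with h' | h' | h'
    · exact h.inj _ _ h' (by simp only [hf]; split_ifs <;> omega)
    · simp only [hf] at h'; split_ifs at h' <;> omega
    · exact (h.inj _ _ h' (by simp only [hf]; split_ifs <;> omega)).symm
  · intro w
    obtain ⟨i, hi, rfl⟩ := h.surj w
    by_cases h' : r + 1 ≤ i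
    · refine ⟨i - (r + 1), by omega, ?_⟩
      simp only [hf]
      rw [if_pos (by omega)]
      congr 1; omega
    · refine ⟨i + n - (r + 1), by omega, ?_⟩
      simp only [hf]
      rw [if_neg (by omega)]
      congr 1; omega
  · intro i j hij hj
    have hfi : f i = if i + (r + 1) < n then i + (r + 1) else i + (r + 1) - n := rfl
    have hfj : f j = if j + (r + 1) < n then j + (r + 1) else j + (r + 1) - n := rfl
    change H.Adj (c (f i)) (c (f j)) ↔ _
    rcases lt_trichotomy (f i) (f j) with h' | h' | h'
    · rw [h.adj _ _ h' (by split_ifs at hfj <;> omega)]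
      split_ifs at hfi hfj <;> omega
    · split_ifs at hfi hfj <;> omega
    · rw [H.adj_comm, h.adj _ _ h' (by split_ifs at hfi <;> omega)]
      split_ifs at hfi hfj <;> omega
  · simp only [hf]
    congr 1
    split_ifs <;> omega

theorem IsCyc.reverse {W : Type*} {H : SimpleGraph W} {n : ℕ} {c : ℕ → W} (h : IsCyc H n c) :
    IsCyc H n (fun i => c (n - 1 - i)) := by
  refine ⟨fun i j hij hj => (h.inj _ _ (by omega) (by omega)).symm, fun w => ?_, fun i j hij hj => ?_⟩
  · obtain ⟨i, hi, rfl⟩ := h.surj w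
    exact ⟨n - 1 - i, by omega, by congr 1; omega⟩
  · rw [H.adj_comm, h.adj _ _ (by omega) (by omega)]
    omega

theorem IsCyc.rotate_to {W : Type*} {H : SimpleGraph W} {n : ℕ} {c : ℕ → W} (h : IsCyc H n c)
    (hn : 3 ≤ n) (w : W) : ∃ c', IsCyc H n c' ∧ c' (n - 1) = w := by
  obtain ⟨r, hr, rfl⟩ := h.surj w
  obtain ⟨c', h1, h2, -⟩ := h.rotate hn hr
  exact ⟨c', h1, h2⟩

/-- The map `π` contracts the edge `pq` of `H'` to the vertex `r` of `H`. -/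
structure IsContraction {W W' : Type*} (H : SimpleGraph W) (H' : SimpleGraph W') (π : W' → W)
    (p q : W') (r : W) : Prop where
  surj : Function.Surjective π
  map_p : π p = r
  map_q : π q = r
  fiber : ∀ a, π a = r → a = p ∨ a = q
  inj : ∀ a b, π a = π b → π a ≠ r → a = b
  adj : ∀ a b, π a ≠ r → π b ≠ r → (H.Adj (π a) (π b) ↔ H'.Adj a b)
  adj_r : ∀ a, π a ≠ r → (H.Adj (π a) r ↔ H'.Adj a p ∨ H'.Adj a q)
  not_both : ∀ a, ¬ (H'.Adj a p ∧ H'.Adj a q)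
  adj_pq : H'.Adj p q

theorem IsCyc.adj_last {W : Type*} {H : SimpleGraph W} {n : ℕ} {c : ℕ → W} (h : IsCyc H n c)
    (hn : 3 ≤ n) {w : W} (hw : H.Adj (c (n - 1)) w) : w = c 0 ∨ w = c (n - 2) := by
  obtain ⟨k, hk, rfl⟩ := h.surj w
  have hne : k ≠ n - 1 := by
    rintro rfl
    exact hw.ne rfl
  have := (h.adj k (n - 1) (by omega) (by omega)).1 hw.symm
  rcases this with h1 | h1
  · right; congr 1; omega
  · left; rw [h1.1]

/-- Once `q` is last, its neighbour `p` is first or next to last. In the first case reversing puts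
`q` first and `p` last, and a rotation by one step repairs the order. -/
theorem IsCyc.rotate_to_edge {W : Type*} {H : SimpleGraph W} {n : ℕ} {c : ℕ → W}
    (h : IsCyc H n c) (hn : 3 ≤ n) {p q : W} (hpq : H.Adj p q) :
    ∃ c', IsCyc H n c' ∧ c' (n - 1) = q ∧ c' (n - 2) = p := by
  obtain ⟨c', hc, hq⟩ := h.rotate_to hn q
  rcases hc.adj_last hn (hq ▸ hpq.symm) with hp | hp
  · obtain ⟨c'', hc'', h1, h2⟩ := hc.reverse.rotate hn (r := 0) (by omega)
    refine ⟨c'', hc'', by simpa [hq] using h1, ?_⟩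
    rw [h2 (n - 2) (by omega), hp]
    congr 1; omega
  · exact ⟨c', hc, hq, hp.symm⟩

/-- With the edge `pq` in the last two places, composing with `π` and dropping the last entry leaves
`r` in place `n - 1`, where it inherits one neighbour from `p` and one from `q`. -/
theorem IsContraction.isCyc {W W' : Type*} {H : SimpleGraph W} {H' : SimpleGraph W'}
    {π : W' → W} {p q : W'} {r : W} (h : IsContraction H H' π p q r) {n : ℕ} (hn : 3 ≤ n)
    {c' : ℕ → W'} (hc : IsCyc H' (n + 1) c') : ∃ c, IsCyc H n c := by
  obtain ⟨c', hc, hq, hp⟩ := hc.rotate_to_edge (by omega) h.adj_pq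
  simp only [Nat.add_sub_cancel, show n + 1 - 2 = n - 1 by omega] at hq hp
  have hr : ∀ i, i < n - 1 → π (c' i) ≠ r := by
    intro i hi hir
    rcases h.fiber _ hir with h1 | h1
    · exact hc.inj i (n - 1) hi (by omega) (h1.trans hp.symm)
    · exact hc.inj i n (by omega) (by omega) (h1.trans hq.symm)
  have hlast : π (c' (n - 1)) = r := hp ▸ h.map_p
  refine ⟨fun i => π (c' i), ⟨?_, ?_, ?_⟩⟩
  · intro i j hij hj hπ
    exact hc.inj i j hij (by omega) (h.inj _ _ hπ (hr i (by omega)))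
  · intro w
    obtain ⟨w', rfl⟩ := h.surj w
    obtain ⟨i, hi, rfl⟩ := hc.surj w'
    rcases Nat.lt_or_ge i n with h1 | h1
    · exact ⟨i, h1, rfl⟩
    · obtain rfl : i = n := by omega
      exact ⟨i - 1, by omega, by rw [hlast, hq, h.map_q]⟩
  · intro i j hij hj
    rcases Nat.lt_or_ge j (n - 1) with h1 | h1
    · rw [h.adj _ _ (hr i (by omega)) (hr j h1), hc.adj i j hij (by omega)]
      omega
    · obtain rfl : j = n - 1 := by omega
      rw [hlast, h.adj_r _ (hr i hij), ← hp, ← hq, hc.adj i _ hij (by omega),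
        hc.adj i n (by omega) (by omega)]
      omega

/-- The further neighbours `a` of `p` and `b` of `q` are distinct by `not_both`, so their images are
the two neighbours of `r` on the cycle, and `r` opens up into `p`, `q` between them. Without `hp`
and `hq` both neighbours of `r` could attach to the same end of `pq`. -/
theorem IsContraction.isCyc_expand {W W' : Type*} {H : SimpleGraph W} {H' : SimpleGraph W'}
    {π : W' → W} {p q : W'} {r : W} (h : IsContraction H H' π p q r) {n : ℕ} (hn : 3 ≤ n)
    (hp : ∃ a, a ≠ q ∧ H'.Adj a p) (hq : ∃ a, a ≠ p ∧ H'.Adj a q)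
    {c : ℕ → W} (hc : IsCyc H n c) : ∃ c', IsCyc H' (n + 1) c' := by
  classical
  obtain ⟨a, haq, hap⟩ := hp
  obtain ⟨b, hbp, hbq⟩ := hq
  have har : π a ≠ r := fun h' => (h.fiber a h').elim hap.ne haq
  have hbr : π b ≠ r := fun h' => (h.fiber b h').elim hbp hbq.ne
  have hadja : H.Adj (π a) r := (h.adj_r a har).2 (Or.inl hap)
  have hadjb : H.Adj (π b) r := (h.adj_r b hbr).2 (Or.inr hbq)
  have hab : a ≠ b := by
    rintro rfl
    exact h.not_both _ ⟨hap, hbq⟩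
  obtain ⟨c, hc, hcr, hca⟩ := hc.rotate_to_edge hn hadja
  have hcb : π b = c 0 := by
    rcases hc.adj_last hn (hcr ▸ hadjb.symm) with h1 | h1
    · exact h1
    · rw [hca] at h1
      exact absurd (h.inj _ _ h1.symm har) hab
  obtain ⟨σ, hσ⟩ := h.surj.hasRightInverse
  have hcne : ∀ i, i < n - 1 → c i ≠ r := fun i hi h' => hc.inj i _ hi (by omega) (h'.trans hcr.symm)
  have hσne : ∀ i, i < n - 1 → π (σ (c i)) ≠ r := fun i hi => by rw [hσ]; exact hcne i hi
  have hσp : ∀ i, i < n - 1 → σ (c i) ≠ p := fun i hi h' => hσne i hi (h' ▸ h.map_p)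
  have hσq : ∀ i, i < n - 1 → σ (c i) ≠ q := fun i hi h' => hσne i hi (h' ▸ h.map_q)
  have hσa : σ (c (n - 2)) = a := h.inj _ _ (by rw [hσ, hca]) (hσne _ (by omega))
  have hσb : σ (c 0) = b := h.inj _ _ (by rw [hσ, hcb]) (hσne _ (by omega))
  set c' : ℕ → W' := fun i => if i < n - 1 then σ (c i) else if i = n - 1 then p else q with hc'
  have e1 : ∀ i, i < n - 1 → c' i = σ (c i) := fun i hi => by simp only [hc', if_pos hi]
  have e2 : c' (n - 1) = p := by simp [hc']
  have e3 : c' n = q := by simp only [hc']; rw [if_neg (by omega), if_neg (by omega)]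
  have hcp : ∀ i, i < n - 1 → (H'.Adj (σ (c i)) p ↔ i = n - 2) := by
    intro i hi
    constructor
    · intro h1
      have h2 := (h.adj_r _ (hσne i hi)).2 (Or.inl h1)
      rw [hσ, ← hcr, hc.adj i _ hi (by omega)] at h2
      rcases h2 with h2 | h2
      · omega
      · rw [h2.1, hσb] at h1
        exact absurd ⟨h1, hbq⟩ (h.not_both b)
    · rintro rfl
      rwa [hσa]
  have hcq : ∀ i, i < n - 1 → (H'.Adj (σ (c i)) q ↔ i = 0) := by
    intro i hi
    constructor
    · intro h1
      have h2 := (h.adj_r _ (hσne i hi)).2 (Or.inr h1)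
      rw [hσ, ← hcr, hc.adj i _ hi (by omega)] at h2
      rcases h2 with h2 | h2
      · rw [show i = n - 2 by omega, hσa] at h1
        exact absurd ⟨hap, h1⟩ (h.not_both a)
      · omega
    · rintro rfl
      rwa [hσb]
  refine ⟨c', ⟨?_, ?_, ?_⟩⟩
  · intro i j hij hj
    rcases lt_trichotomy j (n - 1) with h1 | h1 | h1
    · rw [e1 i (by omega), e1 j h1]
      exact fun h2 => hc.inj i j hij (by omega) (hσ.injective h2)
    · rw [e1 i (by omega), h1, e2]
      exact hσp i (by omega)
    · obtain rfl : j = n := by omega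
      rw [e3]
      rcases Nat.lt_or_ge i (j - 1) with h2 | h2
      · rw [e1 i h2]
        exact hσq i h2
      · rw [show i = j - 1 by omega, e2]
        exact h.adj_pq.ne
  · intro w
    by_cases hw : π w = r
    · rcases h.fiber w hw with rfl | rfl
      · exact ⟨n - 1, by omega, e2⟩
      · exact ⟨n, by omega, e3⟩
    · obtain ⟨i, hi, hiw⟩ := hc.surj (π w)
      have : i < n - 1 := by
        by_contra h1
        rw [show i = n - 1 by omega, hcr] at hiw
        exact hw hiw.symm
      exact ⟨i, by omega, by rw [e1 i this]; exact h.inj _ _ (by rw [hσ, hiw]) (hσne i this)⟩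
  · intro i j hij hj
    rcases lt_trichotomy j (n - 1) with h1 | h1 | h1
    · rw [e1 i (by omega), e1 j h1, ← h.adj _ _ (hσne i (by omega)) (hσne j h1), hσ, hσ,
        hc.adj i j hij (by omega)]
      omega
    · rw [e1 i (by omega), h1, e2, hcp i (by omega)]
      omega
    · obtain rfl : j = n := by omega
      rw [e3]
      rcases Nat.lt_or_ge i (j - 1) with h2 | h2
      · rw [e1 i h2, hcq i h2]
        omega
      · rw [show i = j - 1 by omega, e2]
        simp only [h.adj_pq, true_iff]
        omega

/-! ### The effect of the two operations on triangle graphs -/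

theorem triangleGraph_adj_iff {V : Type*} {G : SimpleGraph V} {s t : G.cliqueSet 3} :
    (triangleGraph G).Adj s t ↔ s ≠ t ∧ ∃ a b : V, a ≠ b ∧
      a ∈ (s : Finset V) ∧ b ∈ (s : Finset V) ∧ a ∈ (t : Finset V) ∧ b ∈ (t : Finset V) := by
  refine and_congr_right fun _ => exists_congr fun a => exists_congr fun b => ?_
  exact ⟨fun h => ⟨h.1.ne, h.2⟩, fun h => ⟨s.2.isClique h.2.1 h.2.2.1 h.1, h.2⟩⟩

theorem clique_ext {V : Type*} {G : SimpleGraph V} {s t : Finset V} (hs : G.IsNClique 3 s)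
    (ht : G.IsNClique 3 t) (h : s ⊆ t) : s = t :=
  Finset.eq_of_subset_of_card_le h (by rw [hs.card_eq, ht.card_eq])

theorem exists_ne_mem_of_clique {V : Type*} {G : SimpleGraph V} {s : Finset V}
    (hs : G.IsNClique 3 s) (a : V) : ∃ b ∈ s, b ≠ a :=
  Finset.exists_mem_ne (by rw [hs.card_eq]; norm_num) a

/-- A homomorphism which is injective on edges and along which triangles lift induces an
isomorphism of triangle graphs. -/
theorem triangleGraph_iso_of_hom {V V' : Type*} {G : SimpleGraph V} {G' : SimpleGraph V'}
    (f : V → V') (hf : ∀ a b, G.Adj a b → G'.Adj (f a) (f b))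
    (hinj : ∀ a b c d, G.Adj a b → G.Adj c d → f a = f c → f b = f d → a = c)
    (hlift : ∀ a b c, G'.Adj a b → G'.Adj a c → G'.Adj b c →
      ∃ a' b' c', G.Adj a' b' ∧ G.Adj a' c' ∧ G.Adj b' c' ∧ f a' = a ∧ f b' = b ∧ f c' = c) :
    Nonempty (triangleGraph G ≃g triangleGraph G') := by
  classical
  have hcl : ∀ s, G.IsNClique 3 s → G'.IsNClique 3 (s.image f) := by
    intro s hs
    obtain ⟨a, b, c, hab, hac, hbc, rfl⟩ := SimpleGraph.is3Clique_iff.1 hs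
    simp only [Finset.image_insert, Finset.image_singleton]
    exact SimpleGraph.is3Clique_triple_iff.2 ⟨hf _ _ hab, hf _ _ hac, hf _ _ hbc⟩
  -- `f` may identify vertices, so `a` is recognised in `t` only as an end of an edge `ab` of `s`
  -- whose image lies in the image of `t`.
  have key : ∀ s t, G.IsNClique 3 s → G.IsNClique 3 t → ∀ a ∈ s, ∀ b ∈ s, a ≠ b →
      f a ∈ t.image f → f b ∈ t.image f → a ∈ t := by
    intro s t hs ht a ha b hb hab hat hbt
    obtain ⟨a', ha', h1⟩ := Finset.mem_image.1 hat
    obtain ⟨b', hb', h2⟩ := Finset.mem_image.1 hbt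
    have hadj := hs.isClique ha hb hab
    have hne : a' ≠ b' := by
      rintro rfl
      exact (hf _ _ hadj).ne (h1.symm.trans h2)
    rwa [hinj a b a' b' hadj (ht.isClique ha' hb' hne) h1.symm h2.symm]
  let F : G.cliqueSet 3 → G'.cliqueSet 3 := fun s => ⟨s.1.image f, hcl _ s.2⟩
  have hF : Function.Injective F := by
    rintro ⟨s, hs⟩ ⟨t, ht⟩ hst
    have hst : s.image f = t.image f := congrArg Subtype.val hst
    refine Subtype.ext (clique_ext hs ht fun a ha => ?_)
    obtain ⟨b, hb, hba⟩ := exists_ne_mem_of_clique hs a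
    exact key s t hs ht a ha b hb hba.symm (hst ▸ Finset.mem_image_of_mem f ha)
      (hst ▸ Finset.mem_image_of_mem f hb)
  have hF' : Function.Surjective F := by
    rintro ⟨s, hs⟩
    obtain ⟨a, b, c, hab, hac, hbc, rfl⟩ := SimpleGraph.is3Clique_iff.1 hs
    obtain ⟨a', b', c', h1, h2, h3, rfl, rfl, rfl⟩ := hlift a b c hab hac hbc
    refine ⟨⟨{a', b', c'}, SimpleGraph.is3Clique_triple_iff.2 ⟨h1, h2, h3⟩⟩, Subtype.ext ?_⟩
    simp only [F, Finset.image_insert, Finset.image_singleton]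
  refine ⟨⟨Equiv.ofBijective F ⟨hF, hF'⟩, ?_⟩⟩
  intro s t
  change (triangleGraph G').Adj (F s) (F t) ↔ _
  rw [triangleGraph_adj_iff, triangleGraph_adj_iff, hF.ne_iff]
  refine and_congr_right fun _ => ⟨?_, ?_⟩
  · rintro ⟨_, _, hab, has', hbs', hat, hbt⟩
    obtain ⟨a, has, rfl⟩ := Finset.mem_image.1 has'
    obtain ⟨b, hbs, rfl⟩ := Finset.mem_image.1 hbs'
    have hab' : a ≠ b := fun h => hab (by rw [h])
    exact ⟨a, b, hab', has, hbs, key _ _ s.2 t.2 a has b hbs hab' hat hbt,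
      key _ _ s.2 t.2 b hbs a has hab'.symm hbt hat⟩
  · rintro ⟨a, b, hab, has, hbs, hat, hbt⟩
    exact ⟨f a, f b, (hf _ _ (s.2.isClique has hbs hab)).ne, Finset.mem_image_of_mem f has,
      Finset.mem_image_of_mem f hbs, Finset.mem_image_of_mem f hat, Finset.mem_image_of_mem f hbt⟩

theorem triangleGraph_congr {V V' : Type*} {G : SimpleGraph V} {G' : SimpleGraph V'}
    (e : G ≃g G') : Nonempty (triangleGraph G ≃g triangleGraph G') := by
  refine triangleGraph_iso_of_hom e (fun a b h => e.map_adj_iff.2 h)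
    (fun a b c d _ _ h _ => e.injective h) fun a b c hab hac hbc =>
    ⟨e.symm a, e.symm b, e.symm c, e.symm.map_adj_iff.2 hab, e.symm.map_adj_iff.2 hac,
      e.symm.map_adj_iff.2 hbc, by simp, by simp, by simp⟩

/-- Excludes walks of length 0, 1, 2 and 3 one by one. These local conditions are what sticking
needs: no loop, no two edges merging, no new triangle. -/
theorem four_le_edist_iff {V : Type*} {G : SimpleGraph V} {u v : V} :
    4 ≤ G.edist u v ↔ u ≠ v ∧ ¬ G.Adj u v ∧ (∀ a, G.Adj u a → ¬ G.Adj v a) ∧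
      ∀ a b, G.Adj u a → G.Adj v b → ¬ G.Adj a b := by
  constructor
  · intro h
    have hw : ∀ p : G.Walk u v, 4 ≤ p.length := fun p => by
      have := h.trans (SimpleGraph.edist_le p)
      exact_mod_cast this
    refine ⟨?_, fun h1 => ?_, fun a h1 h2 => ?_, fun a b h1 h2 h3 => ?_⟩
    · rintro rfl
      have := hw SimpleGraph.Walk.nil
      simp at this
    · have := hw (.cons h1 .nil)
      simp at this
    · have := hw (.cons h1 (.cons h2.symm .nil))
      simp at this
    · have := hw (.cons h1 (.cons h3 (.cons h2.symm .nil)))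
      simp at this
  · rintro ⟨h0, h1, h2, h3⟩
    by_contra hlt
    rw [not_le] at hlt
    obtain ⟨p, hp⟩ := SimpleGraph.exists_walk_of_edist_ne_top (ne_top_of_lt hlt)
    rw [← hp] at hlt
    have hlt : p.length < 4 := by exact_mod_cast hlt
    match p, hlt with
    | .nil, _ => exact h0 rfl
    | .cons e1 .nil, _ => exact h1 e1
    | .cons e1 (.cons e2 .nil), _ => exact h2 _ e1 e2.symm
    | .cons e1 (.cons e2 (.cons e3 .nil)), _ => exact h3 _ _ e1 e3.symm e2
    | .cons e1 (.cons e2 (.cons e3 (.cons e4 q))), h =>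
      simp only [SimpleGraph.Walk.length_cons] at h
      omega

theorem vertexStick_adj_some {V : Type*} {G : SimpleGraph V} {u v : V}
    {a b : {a : V // a ≠ u ∧ a ≠ v}} :
    (vertexStick G u v).Adj (some a) (some b) ↔ G.Adj a b := by
  simp only [vertexStick, SimpleGraph.fromRel_adj, ne_eq, Option.some.injEq]
  constructor
  · rintro ⟨_, h | h⟩
    exacts [h, h.symm]
  · exact fun h => ⟨fun h' => h.ne (congrArg _ h'), Or.inl h⟩

theorem vertexStick_adj_none {V : Type*} {G : SimpleGraph V} {u v : V}
    {b : {a : V // a ≠ u ∧ a ≠ v}} :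
    (vertexStick G u v).Adj none (some b) ↔ G.Adj u b ∨ G.Adj v b := by
  simp [vertexStick, SimpleGraph.fromRel_adj]

-- The identification map sending `u` and `v` to `none` is injective on edges because `u` and `v`
-- have no common neighbour, and triangles lift along it because no edge joins the neighbourhood of
-- `u` to that of `v`.
open Classical in
theorem triangleGraph_vertexStick {V : Type*} {G : SimpleGraph V} {u v : V}
    (h : 4 ≤ G.edist u v) :
    Nonempty (triangleGraph G ≃g triangleGraph (vertexStick G u v)) := by
  obtain ⟨h0, h1, h2, h3⟩ := four_le_edist_iff.1 h
  set f : V → Option {a : V // a ≠ u ∧ a ≠ v} :=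
    fun a => if ha : a ≠ u ∧ a ≠ v then some ⟨a, ha⟩ else none with hf
  have fsome : ∀ a (ha : a ≠ u ∧ a ≠ v), f a = some ⟨a, ha⟩ := fun a ha => by
    simp only [hf, dif_pos ha]
  have fu : f u = none := by simp [hf]
  have fv : f v = none := by simp [hf]
  have fnone : ∀ a, f a = none → a = u ∨ a = v := by
    intro a ha
    by_contra hne
    rw [fsome a (by tauto)] at ha
    exact absurd ha (by simp)
  have cases : ∀ a, a = u ∨ a = v ∨ (a ≠ u ∧ a ≠ v) := fun a => by tauto
  have finj : ∀ a c, f a = f c → a = c ∨ (a = u ∧ c = v) ∨ (a = v ∧ c = u) := by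
    intro a c hac
    by_cases ha : a ≠ u ∧ a ≠ v
    · by_cases hc : c ≠ u ∧ c ≠ v
      · rw [fsome a ha, fsome c hc] at hac
        left
        simpa using hac
      · rw [fsome a ha] at hac
        simp only [hf, dif_neg hc] at hac
        exact absurd hac (by simp)
    · have hfa : f a = none := by simp only [hf, dif_neg ha]
      have := fnone c (hac ▸ hfa)
      have := fnone a hfa
      grind
  have hne : ∀ a b, G.Adj a b → (a = u ∨ a = v) → b ≠ u ∧ b ≠ v := by
    rintro a b hab (rfl | rfl)
    · exact ⟨hab.ne', fun h' => h1 (h' ▸ hab)⟩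
    · exact ⟨fun h' => h1 (h' ▸ hab.symm), hab.ne'⟩
  refine triangleGraph_iso_of_hom f ?_ ?_ ?_
  · intro a b hab
    by_cases ha : a ≠ u ∧ a ≠ v
    · rw [fsome a ha]
      by_cases hb : b ≠ u ∧ b ≠ v
      · rw [fsome b hb]
        exact vertexStick_adj_some.2 hab
      · have : f b = none := by simp only [hf, dif_neg hb]
        rw [this, SimpleGraph.adj_comm, vertexStick_adj_none]
        rcases fnone b this with rfl | rfl
        exacts [Or.inl hab.symm, Or.inr hab.symm]
    · have : f a = none := by simp only [hf, dif_neg ha]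
      rw [this, fsome b (hne a b hab (fnone a this)), vertexStick_adj_none]
      rcases fnone a this with rfl | rfl
      exacts [Or.inl hab, Or.inr hab]
  · intro a b c d hab hcd hac hbd
    rcases finj a c hac with h' | ⟨rfl, rfl⟩ | ⟨rfl, rfl⟩
    · exact h'
    · have hb := hne _ _ hab (Or.inl rfl)
      rcases finj b d hbd with rfl | h' | h'
      · exact absurd hcd (h2 _ hab)
      · exact absurd h'.1 hb.1
      · exact absurd h'.1 hb.2
    · have hb := hne _ _ hab (Or.inr rfl)
      rcases finj b d hbd with rfl | h' | h'
      · exact absurd hab (h2 _ hcd)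
      · exact absurd h'.1 hb.1
      · exact absurd h'.1 hb.2
  · have hnone : ∀ b c : {a : V // a ≠ u ∧ a ≠ v}, (vertexStick G u v).Adj none (some b) →
        (vertexStick G u v).Adj none (some c) → G.Adj b c →
        ∃ w, f w = none ∧ G.Adj w b ∧ G.Adj w c := by
      intro b c hb hc hbc
      rw [vertexStick_adj_none] at hb hc
      rcases hb with hb | hb <;> rcases hc with hc | hc
      · exact ⟨u, fu, hb, hc⟩
      · exact absurd hbc (h3 _ _ hb hc)
      · exact absurd hbc.symm (h3 _ _ hc hb)
      · exact ⟨v, fv, hb, hc⟩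
    have fs : ∀ a : {a : V // a ≠ u ∧ a ≠ v}, f a = some a := fun a => fsome a a.2
    rintro (_ | a) (_ | b) (_ | c) hab hac hbc
    · exact absurd rfl hab.ne
    · exact absurd rfl hab.ne
    · exact absurd rfl hac.ne
    · obtain ⟨w, hw, hb, hc⟩ := hnone b c hab hac (vertexStick_adj_some.1 hbc)
      exact ⟨w, b, c, hb, hc, vertexStick_adj_some.1 hbc, hw, fs b, fs c⟩
    · exact absurd rfl hbc.ne
    · obtain ⟨w, hw, ha, hc⟩ := hnone a c hab.symm hbc (vertexStick_adj_some.1 hac)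
      exact ⟨a, w, c, ha.symm, vertexStick_adj_some.1 hac, hc, fs a, hw, fs c⟩
    · obtain ⟨w, hw, ha, hb⟩ := hnone a b hac.symm hbc.symm (vertexStick_adj_some.1 hab)
      exact ⟨a, b, w, vertexStick_adj_some.1 hab, ha.symm, hb.symm, fs a, fs b, hw⟩
    · exact ⟨a, b, c, vertexStick_adj_some.1 hab, vertexStick_adj_some.1 hac,
        vertexStick_adj_some.1 hbc, fs a, fs b, fs c⟩

theorem edgeSplit_adj_some {V : Type*} {G : SimpleGraph V} {x y z a b : V} :
    (edgeSplit G x y z).Adj (some a) (some b) ↔ G.Adj a b ∧ s(a, b) ≠ s(x, y) := by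
  simp only [edgeSplit, SimpleGraph.fromRel_adj, ne_eq, Option.some.injEq]
  constructor
  · rintro ⟨_, h | h⟩
    exacts [h, ⟨h.1.symm, by rw [Sym2.eq_swap]; exact h.2⟩]
  · exact fun h => ⟨h.1.ne, Or.inl h⟩

theorem edgeSplit_adj_none {V : Type*} {G : SimpleGraph V} {x y z b : V} :
    (edgeSplit G x y z).Adj none (some b) ↔ b = x ∨ b = y ∨ b = z := by
  simp [edgeSplit, SimpleGraph.fromRel_adj]

theorem CanSplit.adj_left {V : Type*} {G : SimpleGraph V} {x y z : V} (h : CanSplit G x y z) :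
    G.Adj x z ∧ G.Adj y z := by
  have : z ∈ G.commonNeighbors x y := by rw [h.unique]; rfl
  exact (SimpleGraph.mem_commonNeighbors G).1 this

theorem CanSplit.eq_of_adj {V : Type*} {G : SimpleGraph V} {x y z a : V} (h : CanSplit G x y z)
    (hx : G.Adj x a) (hy : G.Adj y a) : a = z := by
  have : a ∈ G.commonNeighbors x y := (SimpleGraph.mem_commonNeighbors G).2 ⟨hx, hy⟩
  rw [h.unique] at this
  exact this

-- The triangles `p`, `q` at the new vertex, which share the edge from it to `z`, go to `r = xyz`;
-- every other triangle is unaffected, since `xyz` is the only one that uses `xy`. The nontriviality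
-- conditions of `CanSplit` give `p` and `q` a further neighbour each.
open Classical in
theorem CanSplit.isContraction {V : Type*} {G : SimpleGraph V} {x y z : V}
    (h : CanSplit G x y z) : ∃ π p q r,
      IsContraction (triangleGraph G) (triangleGraph (edgeSplit G x y z)) π p q r ∧
      (∃ a, a ≠ q ∧ (triangleGraph (edgeSplit G x y z)).Adj a p) ∧
      (∃ a, a ≠ p ∧ (triangleGraph (edgeSplit G x y z)).Adj a q) := by
  obtain ⟨hxz, hyz⟩ := h.adj_left
  have hxy := h.adj
  set G' := edgeSplit G x y z with hG'
  have nx : G'.Adj none (some x) := edgeSplit_adj_none.2 (by simp)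
  have ny : G'.Adj none (some y) := edgeSplit_adj_none.2 (by simp)
  have nz : G'.Adj none (some z) := edgeSplit_adj_none.2 (by simp)
  have nadj : ¬ G'.Adj (some x) (some y) := fun h' => (edgeSplit_adj_some.1 h').2 rfl
  have lift_adj : ∀ a b, G.Adj a b → ¬ (a = x ∧ b = y) → ¬ (a = y ∧ b = x) →
      G'.Adj (some a) (some b) := fun a b hab h1 h2 =>
    edgeSplit_adj_some.2 ⟨hab, by rw [ne_eq, Sym2.eq_iff]; tauto⟩
  have xz' : G'.Adj (some x) (some z) :=
    lift_adj _ _ hxz (fun h' => hyz.ne h'.2.symm) (fun h' => hxy.ne h'.1)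
  have yz' : G'.Adj (some y) (some z) :=
    lift_adj _ _ hyz (fun h' => hxy.ne h'.1.symm) (fun h' => hxz.ne h'.2.symm)
  have hR : G.IsNClique 3 {x, y, z} := SimpleGraph.is3Clique_triple_iff.2 ⟨hxy, hxz, hyz⟩
  have hP : G'.IsNClique 3 {none, some x, some z} :=
    SimpleGraph.is3Clique_triple_iff.2 ⟨nx, nz, xz'⟩
  have hQ : G'.IsNClique 3 {none, some y, some z} :=
    SimpleGraph.is3Clique_triple_iff.2 ⟨ny, nz, yz'⟩
  have uniqR : ∀ s, G.IsNClique 3 s → x ∈ s → y ∈ s → s = {x, y, z} := by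
    intro s hs hx hy
    refine clique_ext hs hR fun a ha => ?_
    by_cases hax : a = x
    · simp [hax]
    by_cases hay : a = y
    · simp [hay]
    have := h.eq_of_adj (hs.isClique hx ha (Ne.symm hax)) (hs.isClique hy ha (Ne.symm hay))
    simp [this]
  have notR : ∀ s, G'.IsNClique 3 s → ¬ (some x ∈ s ∧ some y ∈ s) := fun s hs h' =>
    nadj (hs.isClique h'.1 h'.2 (by simpa using hxy.ne))
  -- The new vertex is adjacent only to `x`, `y`, `z`, and `x`, `y` are no longer adjacent.
  have withNone : ∀ s, G'.IsNClique 3 s → none ∈ s →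
      s = {none, some x, some z} ∨ s = {none, some y, some z} := by
    intro s hs hn
    have hmem : ∀ a ∈ s, a = none ∨ a = some x ∨ a = some y ∨ a = some z := by
      rintro (_ | a) ha
      · exact Or.inl rfl
      · have := edgeSplit_adj_none.1 (hs.isClique hn ha (by simp))
        simp only [Option.some.injEq]
        exact Or.inr this
    by_cases hx : some x ∈ s
    · left
      refine clique_ext hs hP fun a ha => ?_
      have : a ≠ some y := by
        rintro rfl
        exact notR s hs ⟨hx, ha⟩
      have := hmem a ha
      simp only [Finset.mem_insert, Finset.mem_singleton]
      tauto
    · right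
      refine clique_ext hs hQ fun a ha => ?_
      have : a ≠ some x := by
        rintro rfl
        exact hx ha
      have := hmem a ha
      simp only [Finset.mem_insert, Finset.mem_singleton]
      tauto
  have down : ∀ s, G'.IsNClique 3 s → none ∉ s → G.IsNClique 3 s.eraseNone ∧
      ∀ a, a ∈ s ↔ ∃ b ∈ s.eraseNone, some b = a := by
    intro s hs hn
    obtain ⟨a, b, c, hab, hac, hbc, rfl⟩ := SimpleGraph.is3Clique_iff.1 hs
    simp only [Finset.mem_insert, Finset.mem_singleton, not_or] at hn
    obtain ⟨a, rfl⟩ := Option.ne_none_iff_exists'.1 (Ne.symm hn.1)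
    obtain ⟨b, rfl⟩ := Option.ne_none_iff_exists'.1 (Ne.symm hn.2.1)
    obtain ⟨c, rfl⟩ := Option.ne_none_iff_exists'.1 (Ne.symm hn.2.2)
    have he : Finset.eraseNone {some a, some b, some c} = {a, b, c} := by
      ext d
      simp
    rw [he]
    refine ⟨SimpleGraph.is3Clique_triple_iff.2 ⟨(edgeSplit_adj_some.1 hab).1,
      (edgeSplit_adj_some.1 hac).1, (edgeSplit_adj_some.1 hbc).1⟩, fun d => ?_⟩
    simp only [Finset.mem_insert, Finset.mem_singleton]
    grind
  have up : ∀ s, G.IsNClique 3 s → s ≠ {x, y, z} → G'.IsNClique 3 (s.image some) := by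
    intro s hs hne
    have hxy : ¬ (x ∈ s ∧ y ∈ s) := fun h' => hne (uniqR s hs h'.1 h'.2)
    have hadj : ∀ a ∈ s, ∀ b ∈ s, G.Adj a b → G'.Adj (some a) (some b) := fun a ha b hb hab =>
      lift_adj a b hab (fun h' => hxy ⟨h'.1 ▸ ha, h'.2 ▸ hb⟩) (fun h' => hxy ⟨h'.2 ▸ hb, h'.1 ▸ ha⟩)
    obtain ⟨a, b, c, hab, hac, hbc, rfl⟩ := SimpleGraph.is3Clique_iff.1 hs
    simp only [Finset.image_insert, Finset.image_singleton]
    exact SimpleGraph.is3Clique_triple_iff.2 ⟨hadj _ (by simp) _ (by simp) hab,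
      hadj _ (by simp) _ (by simp) hac, hadj _ (by simp) _ (by simp) hbc⟩
  let r : G.cliqueSet 3 := ⟨{x, y, z}, hR⟩
  let p : G'.cliqueSet 3 := ⟨{none, some x, some z}, hP⟩
  let q : G'.cliqueSet 3 := ⟨{none, some y, some z}, hQ⟩
  let π : G'.cliqueSet 3 → G.cliqueSet 3 := fun s =>
    if hn : none ∈ s.1 then r else ⟨s.1.eraseNone, (down s.1 s.2 hn).1⟩
  have π_none : ∀ s : G'.cliqueSet 3, none ∈ s.1 → π s = r := fun s hs => by
    simp only [π, dif_pos hs]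
  have π_some : ∀ s : G'.cliqueSet 3, none ∉ s.1 → (π s).1 = s.1.eraseNone := fun s hs => by
    simp only [π, dif_neg hs]
  have π_ne : ∀ s : G'.cliqueSet 3, none ∉ s.1 → π s ≠ r := by
    intro s hn hs
    have h1 := π_some s hn
    rw [hs] at h1
    have h2 : x ∈ s.1.eraseNone ∧ y ∈ s.1.eraseNone := by
      rw [← h1]
      simp [r]
    rw [Finset.mem_eraseNone, Finset.mem_eraseNone] at h2
    exact notR _ s.2 h2
  have π_ne_iff : ∀ s : G'.cliqueSet 3, π s ≠ r ↔ none ∉ s.1 :=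
    fun s => ⟨fun h1 h2 => h1 (π_none s h2), π_ne s⟩
  have π_inj : ∀ s t, π s = π t → π s ≠ r → s = t := by
    intro s t hst hs
    have ht : none ∉ t.1 := (π_ne_iff t).1 (hst ▸ hs)
    have hs := (π_ne_iff s).1 hs
    have he : s.1.eraseNone = t.1.eraseNone := by rw [← π_some s hs, ← π_some t ht, hst]
    refine Subtype.ext (Finset.ext fun a => ?_)
    rw [(down s.1 s.2 hs).2, (down t.1 t.2 ht).2, he]
  refine ⟨π, p, q, r, ⟨?_, π_none p (by simp [p]), π_none q (by simp [q]), ?_, π_inj, ?_, ?_, ?_, ?_⟩,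
    ?_, ?_⟩
  · intro s
    by_cases hs : s = r
    · exact ⟨p, by rw [π_none p (by simp [p]), hs]⟩
    · have hs' : s.1 ≠ {x, y, z} := fun h' => hs (Subtype.ext h')
      refine ⟨⟨_, up s.1 s.2 hs'⟩, Subtype.ext ?_⟩
      rw [π_some _ (by simp)]
      ext a
      simp
  · intro s hs
    have : none ∈ s.1 := by
      by_contra hn
      exact π_ne s hn hs
    rcases withNone s.1 s.2 this with h1 | h1
    · exact Or.inl (Subtype.ext h1)
    · exact Or.inr (Subtype.ext h1)
  · intro s t hs ht
    rw [triangleGraph_adj_iff, triangleGraph_adj_iff, π_some s ((π_ne_iff s).1 hs),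
      π_some t ((π_ne_iff t).1 ht)]
    refine and_congr (not_congr ⟨fun h1 => π_inj _ _ h1 hs, fun h1 => by rw [h1]⟩) ?_
    simp only [Finset.mem_eraseNone]
    constructor
    · rintro ⟨a, b, hab, h1⟩
      exact ⟨some a, some b, by simpa using hab, h1⟩
    · rintro ⟨a, b, hab, h1, h2, h3⟩
      obtain ⟨a, -, rfl⟩ := ((down s.1 s.2 ((π_ne_iff s).1 hs)).2 a).1 h1
      obtain ⟨b, -, rfl⟩ := ((down s.1 s.2 ((π_ne_iff s).1 hs)).2 b).1 h2
      exact ⟨a, b, by simpa using hab, h1, h2, h3⟩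
  · intro s hs
    have hn := (π_ne_iff s).1 hs
    have hsp : s ≠ p := fun h' => hn (by rw [h']; simp [p])
    have hsq : s ≠ q := fun h' => hn (by rw [h']; simp [q])
    have hnot := notR s.1 s.2
    simp only [triangleGraph_adj_iff, π_some s hn, hs, hsp, hsq, ne_eq, not_false_eq_true,
      true_and, Finset.mem_eraseNone, r, p, q, Finset.mem_insert, Finset.mem_singleton]
    constructor
    · rintro ⟨a, b, hab, ha, hb, rfl | rfl | rfl, rfl | rfl | rfl⟩
      · exact absurd rfl hab
      · exact absurd ⟨ha, hb⟩ hnot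
      · exact Or.inl ⟨_, _, xz'.ne, ha, hb, by simp⟩
      · exact absurd ⟨hb, ha⟩ hnot
      · exact absurd rfl hab
      · exact Or.inr ⟨_, _, yz'.ne, ha, hb, by simp⟩
      · exact Or.inl ⟨_, _, xz'.ne, hb, ha, by simp⟩
      · exact Or.inr ⟨_, _, yz'.ne, hb, ha, by simp⟩
      · exact absurd rfl hab
    · rintro (⟨a, b, hab, ha, hb, rfl | rfl | rfl, rfl | rfl | rfl⟩ |
        ⟨a, b, hab, ha, hb, rfl | rfl | rfl, rfl | rfl | rfl⟩) <;> first
      | exact absurd rfl hab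
      | exact absurd ha hn
      | exact absurd hb hn
      | exact ⟨_, _, fun h' => hab (congrArg some h'), ha, hb, by simp⟩
  -- A triangle avoiding `none` that shares an edge with `p` contains `x`, and one that shares an
  -- edge with `q` contains `y`; no triangle contains both.
  · rintro s ⟨h1, h2⟩
    have hn : none ∉ s.1 := by
      intro hn
      rcases withNone s.1 s.2 hn with h3 | h3
      · exact h1.ne (Subtype.ext h3)
      · exact h2.ne (Subtype.ext h3)
    rw [triangleGraph_adj_iff] at h1 h2
    have hx : some x ∈ s.1 := by
      obtain ⟨_, a, b, hab, ha, hb, ha', hb'⟩ := h1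
      simp only [p, Finset.mem_insert, Finset.mem_singleton] at ha' hb'
      grind
    have hy : some y ∈ s.1 := by
      obtain ⟨_, a, b, hab, ha, hb, ha', hb'⟩ := h2
      simp only [q, Finset.mem_insert, Finset.mem_singleton] at ha' hb'
      grind
    exact notR s.1 s.2 ⟨hx, hy⟩
  · rw [triangleGraph_adj_iff]
    refine ⟨fun h' => ?_, none, some z, by simp, by simp [p], by simp [p], by simp [q], by simp [q]⟩
    have : some x ∈ q.1 := by rw [← h']; simp [p]
    exact notR q.1 q.2 ⟨this, by simp [q]⟩
  -- The second triangle at `xz` survives the splitting and is the required neighbour of `p`; the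
  -- next case is its mirror image at `zy`.
  · obtain ⟨s, hs, hsy⟩ := h.left.exists_ne y
    obtain ⟨hxs, hzs⟩ := (SimpleGraph.mem_commonNeighbors G).1 hs
    have hc : G'.IsNClique 3 {some x, some z, some s} :=
      SimpleGraph.is3Clique_triple_iff.2 ⟨xz', lift_adj _ _ hxs (fun h' => hsy h'.2)
        (fun h' => hxy.ne h'.1), lift_adj _ _ hzs (fun h' => hxz.ne h'.1.symm)
        (fun h' => hyz.ne h'.1.symm)⟩
    have hmem : ∀ t : G'.cliqueSet 3, none ∈ t.1 → (⟨_, hc⟩ : G'.cliqueSet 3) ≠ t := by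
      rintro t ht rfl
      simp at ht
    refine ⟨⟨_, hc⟩, hmem q (by simp [q]), triangleGraph_adj_iff.2 ⟨hmem p (by simp [p]),
      some x, some z, xz'.ne, by simp, by simp, by simp [p], by simp [p]⟩⟩
  · obtain ⟨s, hs, hsx⟩ := h.right.exists_ne x
    obtain ⟨hzs, hys⟩ := (SimpleGraph.mem_commonNeighbors G).1 hs
    have hc : G'.IsNClique 3 {some y, some z, some s} :=
      SimpleGraph.is3Clique_triple_iff.2 ⟨yz', lift_adj _ _ hys (fun h' => hxy.ne h'.1.symm)
        (fun h' => hsx h'.2), lift_adj _ _ hzs (fun h' => hxz.ne h'.1.symm)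
        (fun h' => hyz.ne h'.1.symm)⟩
    have hmem : ∀ t : G'.cliqueSet 3, none ∈ t.1 → (⟨_, hc⟩ : G'.cliqueSet 3) ≠ t := by
      rintro t ht rfl
      simp at ht
    refine ⟨⟨_, hc⟩, hmem p (by simp [p]), triangleGraph_adj_iff.2 ⟨hmem q (by simp [q]),
      some y, some z, yz'.ne, by simp, by simp, by simp [q], by simp [q]⟩⟩

/-- The triangle graph of `G` is a cycle of length `n`. -/
def TriCycle {V : Type*} (G : SimpleGraph V) (n : ℕ) : Prop :=
  Nonempty (triangleGraph G ≃g SimpleGraph.cycleGraph n)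

theorem TriCycle.congr {V V' : Type*} {G : SimpleGraph V} {G' : SimpleGraph V'} {n : ℕ}
    (h : TriCycle G n) (e : G ≃g G') : TriCycle G' n := by
  obtain ⟨f⟩ := h
  obtain ⟨g⟩ := triangleGraph_congr e
  exact ⟨g.symm.trans f⟩

theorem TriCycle.edgeSplit {V : Type*} {G : SimpleGraph V} {x y z : V} {n : ℕ} (hn : 3 ≤ n)
    (hG : TriCycle G n) (h : CanSplit G x y z) : TriCycle (edgeSplit G x y z) (n + 1) := by
  obtain ⟨e⟩ := hG
  obtain ⟨c, hc⟩ := IsCyc.of_iso (by omega) e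
  obtain ⟨π, p, q, r, hπ, hp, hq⟩ := h.isContraction
  obtain ⟨c', hc'⟩ := hπ.isCyc_expand hn hp hq hc
  exact hc'.iso

theorem TriCycle.of_edgeSplit {V : Type*} {G : SimpleGraph V} {x y z : V} {n : ℕ} (hn : 3 ≤ n)
    (hG : TriCycle (TriangleGraphs.edgeSplit G x y z) (n + 1)) (h : CanSplit G x y z) :
    TriCycle G n := by
  obtain ⟨e⟩ := hG
  obtain ⟨c, hc⟩ := IsCyc.of_iso (by omega) e
  obtain ⟨π, p, q, r, hπ, hp, hq⟩ := h.isContraction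
  obtain ⟨c', hc'⟩ := hπ.isCyc hn hc
  exact hc'.iso

theorem triCycle_vertexStick_iff {V : Type*} {G : SimpleGraph V} {u v : V} {n : ℕ}
    (h : 4 ≤ G.edist u v) : TriCycle (vertexStick G u v) n ↔ TriCycle G n := by
  obtain ⟨e⟩ := triangleGraph_vertexStick h
  exact ⟨fun ⟨f⟩ => ⟨e.trans f⟩, fun ⟨f⟩ => ⟨e.symm.trans f⟩⟩

theorem ObtainedFrom.triCycle {V₀ : Type u} {G₀ : SimpleGraph V₀} {k n : ℕ} {V : Type u}
    {G : SimpleGraph V} (h : ObtainedFrom G₀ k G) (hn : 3 ≤ n) (h₀ : TriCycle G₀ n) :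
    TriCycle G (n + k) := by
  induction h with
  | iso e => exact h₀.congr e
  | split _ h e ih => exact (TriCycle.edgeSplit (by omega) ih h).congr e
  | stick _ h e ih => exact ((triCycle_vertexStick_iff h).2 ih).congr e

/-! ### Triangle graphs of the types -/

/-- Reduces the claim to an explicit list of triangles. Sharing an edge becomes having two common
elements, so that for a concrete finite graph every hypothesis can be decided. -/
theorem triCycle_of_triangles {V : Type*} [DecidableEq V] {G : SimpleGraph V} {n : ℕ} (t : ℕ → Finset V)
    (hcl : ∀ i, i < n → G.IsNClique 3 (t i))
    (hsurj : ∀ a b c, G.Adj a b → G.Adj a c → G.Adj b c →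
      ∃ i, i < n ∧ a ∈ t i ∧ b ∈ t i ∧ c ∈ t i)
    (hne : ∀ i j, i < j → j < n → t i ≠ t j)
    (hadj : ∀ i j, i < j → j < n → (1 < (t i ∩ t j).card ↔
      j = i + 1 ∨ (i = 0 ∧ j + 1 = n))) :
    TriCycle G n := by
  rcases Nat.eq_zero_or_pos n with rfl | hn
  · have : IsEmpty (G.cliqueSet 3) := ⟨fun ⟨s, hs⟩ => by
      obtain ⟨a, b, c, hab, hac, hbc, rfl⟩ := SimpleGraph.is3Clique_iff.1 hs
      obtain ⟨i, hi, -⟩ := hsurj a b c hab hac hbc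
      exact absurd hi (Nat.not_lt_zero i)⟩
    exact ⟨⟨Equiv.equivOfIsEmpty _ _, fun {a} => isEmptyElim a⟩⟩
  have hmod : ∀ i, i < n → i % n = i := fun i hi => Nat.mod_eq_of_lt hi
  refine IsCyc.iso (c := fun i => ⟨t (i % n), hcl _ (Nat.mod_lt _ hn)⟩) ⟨?_, ?_, ?_⟩
  · intro i j hij hj h
    have := congrArg Subtype.val h
    simp only [hmod j hj, hmod i (hij.trans hj)] at this
    exact hne i j hij hj this
  · rintro ⟨s, hs⟩
    obtain ⟨a, b, c, hab, hac, hbc, rfl⟩ := SimpleGraph.is3Clique_iff.1 hs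
    obtain ⟨i, hi, ha, hb, hc⟩ := hsurj a b c hab hac hbc
    refine ⟨i, hi, Subtype.ext ?_⟩
    simp only [hmod i hi]
    refine (clique_ext hs (hcl i hi) ?_).symm
    simp [Finset.insert_subset_iff, ha, hb, hc]
  · intro i j hij hj
    rw [triangleGraph_adj_iff, ← hadj i j hij hj]
    simp only [hmod j hj, hmod i (hij.trans hj), ne_eq, Subtype.mk.injEq]
    rw [Finset.one_lt_card, and_iff_right (hne i j hij hj)]
    simp only [Finset.mem_inter]
    grind

instance joinGraphDecidable {V W : Type*} (G : SimpleGraph V) (H : SimpleGraph W)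
    [DecidableRel G.Adj] [DecidableRel H.Adj] : DecidableRel (joinGraph G H).Adj
  | .inl a, .inl b => decidable_of_iff (G.Adj a b) (by simp [joinGraph])
  | .inr a, .inr b => decidable_of_iff (H.Adj a b) (by simp [joinGraph])
  | .inl _, .inr _ => .isTrue (by simp [joinGraph])
  | .inr _, .inl _ => .isTrue (by simp [joinGraph])

instance wheelGraphDecidable (n : ℕ) : DecidableRel (wheelGraph n).Adj :=
  joinGraphDecidable _ _

theorem triCycle_wheelGraph : TriCycle (wheelGraph 4) 4 := by
  refine triCycle_of_triangles
    (fun i => {Sum.inl 0, Sum.inr (Fin.ofNat 4 i), Sum.inr (Fin.ofNat 4 (i + 1))}) ?_ ?_ ?_ ?_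
  · decide
  · decide
  · intro i j hij hj
    revert i
    revert j
    decide
  · intro i j hij hj
    revert i
    revert j
    decide

instance K5MinusK3Decidable : DecidableRel K5MinusK3.Adj := fun a b =>
  decidable_of_iff (a ≠ b ∧ s(a, b) ∉ ({s(0, 1), s(1, 2), s(0, 2)} : Finset (Sym2 (Fin 5))))
    (by simp [K5MinusK3])

theorem triCycle_K5MinusK3 : TriCycle K5MinusK3 3 := by
  refine triCycle_of_triangles (fun i => {3, 4, Fin.ofNat 5 i}) ?_ ?_ ?_ ?_
  · decide
  · decide
  · intro i j hij hj
    revert i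
    revert j
    decide
  · intro i j hij hj
    revert i
    revert j
    decide

/-- The relation defining `decoratedCycle`, as a Boolean function. -/
def decoratedRel (k : ℕ) (C : Finset (ZMod k × ZMod k)) (I : Finset (ZMod k)) :
    ZMod k ⊕ {i : ZMod k // i ∈ I} → ZMod k ⊕ {i : ZMod k // i ∈ I} → Bool
  | .inl i, .inl j => decide (j = i + 1 ∨ (i, j) ∈ C)
  | .inr i, .inl j => decide (j = (i : ZMod k) - 1 ∨ j = (i : ZMod k) ∨ j = (i : ZMod k) + 1)
  | _, .inr _ => false

instance decoratedCycleDecidable (k : ℕ) (C : Finset (ZMod k × ZMod k)) (I : Finset (ZMod k)) :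
    DecidableRel (decoratedCycle k C I).Adj := fun a b =>
  decidable_of_iff (a ≠ b ∧ (decoratedRel k C I a b = true ∨ decoratedRel k C I b a = true)) (by
    rcases a with a | a <;> rcases b with b | b <;>
    simp [decoratedCycle, decoratedRel, SimpleGraph.fromRel_adj])

/-- The three vertices of the `i`-th triangle of the strip with vertices `0, …, n - 1` in which the
vertices of degree three are those selected by `s`. -/
def stripTri (n : ℕ) (s : ℕ → Bool) (i : ℕ) : List ℕ :=
  [i % n, (i + 1) % n, if s ((i + 2) % n) then (i + 3) % n else (i + 2) % n]

def stripAdj (n : ℕ) (s : ℕ → Bool) (a b : ℕ) : Bool :=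
  a != b && (List.range n).any fun i => (stripTri n s i).elem a && (stripTri n s i).elem b

theorem stripAdj_comm (n : ℕ) (s : ℕ → Bool) (a b : ℕ) : stripAdj n s a b = stripAdj n s b a := by
  simp only [stripAdj, Bool.and_comm, bne_comm]

/-- The graph formed by a cyclic strip of triangles. -/
def stripGraph (n : ℕ) (s : ℕ → Bool) : SimpleGraph (Fin n) where
  Adj a b := stripAdj n s a b = true
  symm := ⟨fun a b h => by rwa [stripAdj_comm]⟩
  loopless := ⟨fun a h => by simp [stripAdj] at h⟩

instance (n : ℕ) (s : ℕ → Bool) : DecidableRel (stripGraph n s).Adj := fun a b =>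
  inferInstanceAs (Decidable (stripAdj n s a b = true))

/-- The triangles of `stripTri` for eight vertices; `Fin.ofNat 8` does the reduction mod 8. -/
def stripTriFinset (s : ℕ → Bool) (i : ℕ) : Finset (Fin 8) :=
  {Fin.ofNat 8 i, Fin.ofNat 8 (i + 1), if s ((i + 2) % 8) then Fin.ofNat 8 (i + 3) else Fin.ofNat 8 (i + 2)}

/-- The masks 85, 21, 5, 17 have the bits {0,2,4,6}, {0,2,4}, {0,2}, {0,4}; they encode `SA`, `SB`,
`SC`, `SD`. -/
theorem triCycle_stripGraph (m : ℕ) (hm : m = 85 ∨ m = 21 ∨ m = 5 ∨ m = 17) :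
    TriCycle (stripGraph 8 m.testBit) 8 := by
  refine triCycle_of_triangles (stripTriFinset m.testBit) ?_ ?_ ?_ ?_
  · rcases hm with rfl | rfl | rfl | rfl <;> decide +kernel
  · rcases hm with rfl | rfl | rfl | rfl <;> decide +kernel
  · intro i j hij hj
    revert i
    revert j
    rcases hm with rfl | rfl | rfl | rfl <;> decide +kernel
  · intro i j hij hj
    revert i
    revert j
    rcases hm with rfl | rfl | rfl | rfl <;> decide +kernel

theorem stripGraph_iso {V : Type*} [Fintype V] {G : SimpleGraph V} {n : ℕ} {s : ℕ → Bool}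
    (f : Fin n → V) (hf : Function.Injective f) (hcard : Fintype.card V = n)
    (h : ∀ i j, G.Adj (f i) (f j) ↔ (stripGraph n s).Adj i j) :
    Nonempty (stripGraph n s ≃g G) :=
  ⟨⟨Equiv.ofBijective f ((Fintype.bijective_iff_injective_and_card f).2
    ⟨hf, by rw [hcard, Fintype.card_fin]⟩), fun {i j} => h i j⟩⟩

/-- The list names the vertices in strip order: the `u_i` stand at the set bits of the mask, the
`v_i` at the others. The same holds for the other three types, where `v_k` is written as `.inl 0`.
-/
theorem stripGraph_iso_SA : Nonempty (stripGraph 8 (85 : ℕ).testBit ≃g SA) := by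
  refine stripGraph_iso (V := ZMod 4 ⊕ {i : ZMod 4 // i ∈ ({1, 2, 3, 4} : Finset (ZMod 4))})
    ![.inr ⟨0, by decide⟩, .inl 0, .inr ⟨1, by decide⟩, .inl 1, .inr ⟨2, by decide⟩, .inl 2,
      .inr ⟨3, by decide⟩, .inl 3] (by decide) (by decide) ?_
  unfold SA
  decide +kernel

theorem stripGraph_iso_SB : Nonempty (stripGraph 8 (21 : ℕ).testBit ≃g SB) := by
  refine stripGraph_iso (V := ZMod 5 ⊕ {i : ZMod 5 // i ∈ ({1, 2, 3} : Finset (ZMod 5))})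
    ![.inr ⟨1, by decide⟩, .inl 1, .inr ⟨2, by decide⟩, .inl 2, .inr ⟨3, by decide⟩, .inl 3,
      .inl 4, .inl 0] (by decide) (by decide) ?_
  unfold SB
  decide +kernel

theorem stripGraph_iso_SC : Nonempty (stripGraph 8 (5 : ℕ).testBit ≃g SC) := by
  refine stripGraph_iso (V := ZMod 6 ⊕ {i : ZMod 6 // i ∈ ({1, 2} : Finset (ZMod 6))})
    ![.inr ⟨1, by decide⟩, .inl 1, .inr ⟨2, by decide⟩, .inl 2, .inl 3, .inl 4, .inl 5, .inl 0]
    (by decide) (by decide) ?_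
  unfold SC
  decide +kernel

theorem stripGraph_iso_SD : Nonempty (stripGraph 8 (17 : ℕ).testBit ≃g SD) := by
  refine stripGraph_iso (V := ZMod 6 ⊕ {i : ZMod 6 // i ∈ ({1, 4} : Finset (ZMod 6))})
    ![.inr ⟨1, by decide⟩, .inl 1, .inl 0, .inl 5, .inr ⟨4, by decide⟩, .inl 4, .inl 3, .inl 2]
    (by decide) (by decide) ?_
  unfold SD
  decide +kernel

theorem isSupplementary_iff {V : Type*} {G : SimpleGraph V} : IsSupplementary G ↔
    ∃ m, (m = 85 ∨ m = 21 ∨ m = 5 ∨ m = 17) ∧ Nonempty (stripGraph 8 m.testBit ≃g G) := by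
  obtain ⟨a⟩ := stripGraph_iso_SA
  obtain ⟨b⟩ := stripGraph_iso_SB
  obtain ⟨c⟩ := stripGraph_iso_SC
  obtain ⟨d⟩ := stripGraph_iso_SD
  constructor
  · rintro (⟨⟨e⟩⟩ | ⟨⟨e⟩⟩ | ⟨⟨e⟩⟩ | ⟨⟨e⟩⟩)
    · exact ⟨85, by simp, ⟨a.trans e.symm⟩⟩
    · exact ⟨21, by simp, ⟨b.trans e.symm⟩⟩
    · exact ⟨5, by simp, ⟨c.trans e.symm⟩⟩
    · exact ⟨17, by simp, ⟨d.trans e.symm⟩⟩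
  · rintro ⟨m, rfl | rfl | rfl | rfl, ⟨e⟩⟩
    · exact Or.inl ⟨e.symm.trans a⟩
    · exact Or.inr (Or.inl ⟨e.symm.trans b⟩)
    · exact Or.inr (Or.inr (Or.inl ⟨e.symm.trans c⟩))
    · exact Or.inr (Or.inr (Or.inr ⟨e.symm.trans d⟩))

theorem IsSupplementary.triCycle {V : Type*} {G : SimpleGraph V} (h : IsSupplementary G) :
    TriCycle G 8 := by
  obtain ⟨m, hm, ⟨e⟩⟩ := isSupplementary_iff.1 h
  exact (triCycle_stripGraph m hm).congr e

/-- Distance at most 2 means being adjacent or having a common neighbour. The last two alternatives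
are the steps across the end of the cycle, in a form linear enough for `omega`. -/
theorem cycleSquare_adj_of_lt {n : ℕ} {i j : Fin n} (hij : i.1 < j.1) :
    (cycleSquare n).Adj i j ↔
      j.1 = i + 1 ∨ j.1 = i + 2 ∨ j.1 + 1 = i + n ∨ j.1 + 2 = i + n := by
  have key : (cycleSquare n).Adj i j ↔ (SimpleGraph.cycleGraph n).Adj i j ∨
      ∃ k, (SimpleGraph.cycleGraph n).Adj i k ∧ (SimpleGraph.cycleGraph n).Adj j k := by
    have hne : i ≠ j := fun h => by rw [h] at hij; exact lt_irrefl _ hij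
    simp only [cycleSquare, powerGraph, Nat.cast_ofNat, hne, ne_eq, not_false_eq_true, true_and]
    rw [← not_lt, SimpleGraph.two_lt_edist_iff]
    constructor
    · intro h
      by_contra h'
      push Not at h'
      refine h ⟨hne, h'.1, ?_⟩
      ext k
      simp only [SimpleGraph.mem_commonNeighbors, Set.mem_empty_iff_false, iff_false]
      exact fun hk => h'.2 k hk.1 hk.2
    · rintro (h | ⟨k, h1, h2⟩) ⟨-, h3, h4⟩
      · exact h3 h
      · have : k ∈ (SimpleGraph.cycleGraph n).commonNeighbors i j := ⟨h1, h2⟩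
        rw [h4] at this
        exact this
  have hadj : ∀ a b : Fin n, a.1 < b.1 → ((SimpleGraph.cycleGraph n).Adj a b ↔
      b.1 = a + 1 ∨ (a.1 = 0 ∧ b + 1 = n)) := fun a b hab => cycleGraph_adj_of_lt hab b.2
  rw [key, hadj i j hij]
  obtain ⟨i, hi⟩ := i
  obtain ⟨j, hj⟩ := j
  simp only at hij ⊢
  constructor
  · rintro (h | ⟨⟨k, hk⟩, h1, h2⟩)
    · omega
    · rcases lt_trichotomy i k with h3 | h3 | h3
      · rw [hadj _ _ h3] at h1
        rcases lt_trichotomy j k with h4 | h4 | h4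
        · rw [hadj _ _ h4] at h2
          simp only at h1 h2; omega
        · subst h4; exact absurd rfl h2.ne
        · rw [SimpleGraph.adj_comm, hadj _ _ h4] at h2
          simp only at h1 h2; omega
      · subst h3; exact absurd rfl h1.ne
      · rw [SimpleGraph.adj_comm, hadj _ _ h3] at h1
        rw [SimpleGraph.adj_comm, hadj _ _ (by simp only; omega)] at h2
        simp only at h1 h2; omega
  · rintro (h | h | h | h)
    · exact Or.inl (Or.inl h)
    · refine Or.inr ⟨⟨i + 1, by omega⟩, ?_, ?_⟩
      · rw [hadj _ _ (by simp)]
        simp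
      · rw [SimpleGraph.adj_comm, hadj _ _ (by simp only; omega)]
        simp only; omega
    · left; right; omega
    · by_cases h0 : i = 0
      · refine Or.inr ⟨⟨n - 1, by omega⟩, ?_, ?_⟩
        · rw [hadj _ _ (by simp only; omega)]
          simp only; omega
        · rw [hadj _ _ (by simp only; omega)]
          simp only; omega
      · refine Or.inr ⟨⟨0, by omega⟩, ?_, ?_⟩
        · rw [SimpleGraph.adj_comm, hadj ⟨0, _⟩ ⟨i, hi⟩ (by simp only; omega)]
          simp only; omega
        · rw [SimpleGraph.adj_comm, hadj ⟨0, _⟩ ⟨j, hj⟩ (by simp only; omega)]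
          simp only [true_and]; omega

/-- The triangles are the sets of three consecutive vertices. The bound 7 rules out further ones
such as {0, 2, 4} in the square of C_6. -/
theorem triCycle_cycleSquare {n : ℕ} (hn : 7 ≤ n) : TriCycle (cycleSquare n) n := by
  have hn0 : 0 < n := by omega
  -- On indices below `2 * n`, the only ones used, this is `i` or `i - n`; the remainder in the
  -- second branch only secures the bound.
  let f : ℕ → Fin n := fun i => ⟨if i < n then i else (i - n) % n, by
    split_ifs
    · assumption
    · exact Nat.mod_lt _ hn0⟩
  have f1 : ∀ i, i < n → (f i).1 = i := fun i hi => by simp only [f, if_pos hi]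
  have f2 : ∀ i, n ≤ i → i < n + n → (f i).1 = i - n := fun i hi hi' => by
    simp only [f]
    rw [if_neg (by omega), Nat.mod_eq_of_lt (by omega)]
  have fv : ∀ i, i < n → ((f (i + 1)).1 = i + 1 ∨ (f (i + 1)).1 + n = i + 1) ∧
      ((f (i + 2)).1 = i + 2 ∨ (f (i + 2)).1 + n = i + 2) := by
    intro i hi
    constructor
    · rcases Nat.lt_or_ge (i + 1) n with h | h
      · rw [f1 _ h]; omega
      · rw [f2 _ h (by omega)]; omega
    · rcases Nat.lt_or_ge (i + 2) n with h | h
      · rw [f1 _ h]; omega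
      · rw [f2 _ h (by omega)]; omega
  have hadj : ∀ a b : Fin n, (a.1 + 1 = b ∨ a.1 + 2 = b ∨ a.1 + 1 = b + n ∨ a.1 + 2 = b + n) →
      (cycleSquare n).Adj a b := by
    intro a b h
    rcases lt_trichotomy a.1 b.1 with h1 | h1 | h1
    · rw [cycleSquare_adj_of_lt h1]; omega
    · omega
    · rw [SimpleGraph.adj_comm, cycleSquare_adj_of_lt h1]
      have := a.2
      have := b.2
      omega
  have mem : ∀ i a, a ∈ ({f i, f (i + 1), f (i + 2)} : Finset (Fin n)) ↔
      a.1 = (f i).1 ∨ a.1 = (f (i + 1)).1 ∨ a.1 = (f (i + 2)).1 := by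
    intro i a
    simp only [Finset.mem_insert, Finset.mem_singleton, Fin.ext_iff]
  refine triCycle_of_triangles (fun i => {f i, f (i + 1), f (i + 2)}) ?_ ?_ ?_ ?_
  · intro i hi
    have := f1 i hi
    have := fv i hi
    have := (f (i + 1)).2
    have := (f (i + 2)).2
    exact SimpleGraph.is3Clique_triple_iff.2 ⟨hadj _ _ (by omega), hadj _ _ (by omega),
      hadj _ _ (by omega)⟩
  · have sorted : ∀ a b c : Fin n, a.1 < b.1 → b.1 < c.1 → (cycleSquare n).Adj a b →
        (cycleSquare n).Adj a c → (cycleSquare n).Adj b c →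
        ∃ i, i < n ∧ a ∈ ({f i, f (i + 1), f (i + 2)} : Finset (Fin n)) ∧
          b ∈ ({f i, f (i + 1), f (i + 2)} : Finset (Fin n)) ∧
          c ∈ ({f i, f (i + 1), f (i + 2)} : Finset (Fin n)) := by
      intro a b c h1 h2 hab hac hbc
      rw [cycleSquare_adj_of_lt h1] at hab
      rw [cycleSquare_adj_of_lt (h1.trans h2)] at hac
      rw [cycleSquare_adj_of_lt h2] at hbc
      have ha := a.2
      have hb := b.2
      have hc := c.2
      -- Three consecutive vertices in increasing order: no wrap, or one or two of them after the
      -- wrap.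
      have : (b.1 = a + 1 ∧ c.1 = a + 2) ∨ (a.1 = 0 ∧ b.1 = 1 ∧ c.1 + 1 = n) ∨
          (a.1 = 0 ∧ b.1 + 2 = n ∧ c.1 + 1 = n) := by omega
      simp only [mem]
      rcases this with h | h | h
      · refine ⟨a, ha, ?_⟩
        rw [f1 a ha, f1 _ (by omega), f1 _ (by omega)]
        omega
      · refine ⟨c, hc, ?_⟩
        rw [f1 c hc, f2 _ (by omega) (by omega), f2 _ (by omega) (by omega)]
        omega
      · refine ⟨b, hb, ?_⟩
        rw [f1 b hb, f1 _ (by omega), f2 _ (by omega) (by omega)]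
        omega
    intro a b c hab hac hbc
    have e1 : a.1 ≠ b.1 := fun h => hab.ne (Fin.ext h)
    have e2 : a.1 ≠ c.1 := fun h => hac.ne (Fin.ext h)
    have e3 : b.1 ≠ c.1 := fun h => hbc.ne (Fin.ext h)
    rcases Nat.lt_or_gt_of_ne e1 with h1 | h1 <;> rcases Nat.lt_or_gt_of_ne e2 with h2 | h2 <;>
      rcases Nat.lt_or_gt_of_ne e3 with h3 | h3
    · exact sorted a b c h1 h3 hab hac hbc
    · obtain ⟨i, h⟩ := sorted a c b h2 h3 hac hab hbc.symm
      exact ⟨i, by tauto⟩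
    · omega
    · obtain ⟨i, h⟩ := sorted c a b h2 h1 hac.symm hbc.symm hab
      exact ⟨i, by tauto⟩
    · obtain ⟨i, h⟩ := sorted b a c h1 h2 hab.symm hbc hac
      exact ⟨i, by tauto⟩
    · omega
    · obtain ⟨i, h⟩ := sorted b c a h3 h2 hbc hab.symm hac.symm
      exact ⟨i, by tauto⟩
    · obtain ⟨i, h⟩ := sorted c b a h3 h1 hbc.symm hac.symm hab.symm
      exact ⟨i, by tauto⟩
  · intro i j hij hj h
    have h1 := (mem j (f i)).1 (by rw [← h, mem]; simp)
    have h2 := (mem i (f j)).1 (by rw [h, mem]; simp)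
    rw [f1 j hj, f1 i (by omega)] at h1 h2
    have := fv i (by omega)
    have := fv j hj
    omega
  · intro i j hij hj
    rw [Finset.one_lt_card]
    simp only [Finset.mem_inter, mem]
    have hi := f1 i (by omega)
    have hj' := f1 j hj
    have h1 := fv i (by omega)
    have h2 := fv j hj
    constructor
    · rintro ⟨a, ⟨ha1, ha2⟩, b, ⟨hb1, hb2⟩, hab⟩
      have hab : a.1 ≠ b.1 := fun h => hab (Fin.ext h)
      have := a.2
      have := b.2
      omega
    · rintro (rfl | ⟨rfl, h⟩)
      · refine ⟨f (i + 1), by simp, f (i + 2), by simp, fun h => ?_⟩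
        rw [h] at h1
        omega
      · have h0 := f1 1 (by omega)
        have := (f (j + 1)).2
        have := (f (j + 2)).2
        refine ⟨f 0, ?_, f 1, ?_, fun h' => ?_⟩
        · exact ⟨Or.inl rfl, Or.inr (Or.inl (by omega))⟩
        · exact ⟨Or.inr (Or.inl (by simp)), Or.inr (Or.inr (by omega))⟩
        · rw [h', h0] at hi
          omega

/-! ### Covered graphs and the case of three triangles -/

/-- No vertex is isolated and every edge lies in a triangle. -/
structure TriCovered {V : Type*} (G : SimpleGraph V) : Prop where
  exists_adj : ∀ x, ∃ y, G.Adj x y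
  exists_tri : ∀ x y, G.Adj x y → ∃ z, G.Adj x z ∧ G.Adj y z

theorem mem_iff_of_clique {V : Type*} {G : SimpleGraph V} {s : Finset V} (hs : G.IsNClique 3 s)
    {a b c : V} (ha : a ∈ s) (hb : b ∈ s) (hc : c ∈ s) (hab : a ≠ b) (hac : a ≠ c) (hbc : b ≠ c)
    (v : V) : v ∈ s ↔ v = a ∨ v = b ∨ v = c := by
  classical
  have : ({a, b, c} : Finset V) = s := by
    refine Finset.eq_of_subset_of_card_le ?_ ?_
    · simp [Finset.insert_subset_iff, ha, hb, hc]
    · rw [hs.card_eq, Finset.card_eq_three.2 ⟨a, b, c, hab, hac, hbc, rfl⟩]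
  rw [← this]
  simp

theorem exists_third {V : Type*} {G : SimpleGraph V} {s : Finset V} (hs : G.IsNClique 3 s)
    {a b : V} (ha : a ∈ s) (hb : b ∈ s) (hab : a ≠ b) : ∃ c ∈ s, a ≠ c ∧ b ≠ c := by
  classical
  obtain ⟨c, hc⟩ : ((s.erase a).erase b).Nonempty := by
    rw [← Finset.card_pos, Finset.card_erase_of_mem (by simp [hb, hab.symm]),
      Finset.card_erase_of_mem ha, hs.card_eq]
    norm_num
  simp only [Finset.mem_erase] at hc
  exact ⟨c, hc.2.2, hc.2.1.symm, hc.1.symm⟩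

theorem TriCovered.exists_clique {V : Type*} {G : SimpleGraph V} (hG : TriCovered G) {a b : V}
    (h : G.Adj a b) : ∃ s, G.IsNClique 3 s ∧ a ∈ s ∧ b ∈ s := by
  classical
  obtain ⟨c, h1, h2⟩ := hG.exists_tri a b h
  exact ⟨{a, b, c}, SimpleGraph.is3Clique_triple_iff.2 ⟨h, h1, h2⟩, by simp, by simp⟩

theorem TriCovered.exists_clique_mem {V : Type*} {G : SimpleGraph V} (hG : TriCovered G) (a : V) :
    ∃ s, G.IsNClique 3 s ∧ a ∈ s := by
  obtain ⟨b, hb⟩ := hG.exists_adj a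
  obtain ⟨s, hs, ha, -⟩ := hG.exists_clique hb
  exact ⟨s, hs, ha⟩

theorem iso_K5MinusK3_of_hub {V : Type*} {G : SimpleGraph V} (f : Fin 5 → V)
    (hf : Function.Injective f) (hf' : Function.Surjective f)
    (h : ∀ u v, G.Adj u v ↔ u ≠ v ∧ (u = f 3 ∨ u = f 4 ∨ v = f 3 ∨ v = f 4)) :
    Nonempty (G ≃g K5MinusK3) := by
  have hK : ∀ i j, K5MinusK3.Adj i j ↔ i ≠ j ∧ (i = 3 ∨ i = 4 ∨ j = 3 ∨ j = 4) := by decide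
  refine ⟨SimpleGraph.Iso.symm ⟨Equiv.ofBijective f ⟨hf, hf'⟩, fun {i j} => ?_⟩⟩
  rw [hK]
  change G.Adj (f i) (f j) ↔ _
  simp only [h, ne_eq, hf.eq_iff]

-- Two of the triangles share an edge `ab`; let `p`, `q` be their apexes. The third triangle must
-- share `ab` too, with an apex `r`, and since the triangles cover all vertices and edges nothing
-- else is present.
set_option maxHeartbeats 1000000 in
theorem iso_K5MinusK3 {V : Type*} {G : SimpleGraph V} (hG : TriCovered G) (h : TriCycle G 3) :
    Nonempty (G ≃g K5MinusK3) := by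
  classical
  obtain ⟨e⟩ := h
  obtain ⟨c, hc⟩ := IsCyc.of_iso (by omega) e
  have h01 := (hc.adj 0 1 (by omega) (by omega)).2 (by omega)
  have h02 := (hc.adj 0 2 (by omega) (by omega)).2 (by omega)
  have h12 := (hc.adj 1 2 (by omega) (by omega)).2 (by omega)
  have hall : ∀ s, G.IsNClique 3 s → s = (c 0).1 ∨ s = (c 1).1 ∨ s = (c 2).1 := by
    intro s hs
    obtain ⟨i, hi, h⟩ := hc.surj ⟨s, hs⟩
    have h : (c i).1 = s := congrArg Subtype.val h
    subst h
    interval_cases i <;> simp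
  rw [triangleGraph_adj_iff] at h01 h02 h12
  obtain ⟨hne01, a, b, hab, ha0, hb0, ha1, hb1⟩ := h01
  obtain ⟨p, hp, hap, hbp⟩ := exists_third (c 0).2 ha0 hb0 hab
  obtain ⟨q, hq, haq, hbq⟩ := exists_third (c 1).2 ha1 hb1 hab
  have m0 := mem_iff_of_clique (c 0).2 ha0 hb0 hp hab hap hbp
  have m1 := mem_iff_of_clique (c 1).2 ha1 hb1 hq hab haq hbq
  have hpq : p ≠ q := by
    rintro rfl
    exact hne01 (Subtype.ext (Finset.ext fun v => (m0 v).trans (m1 v).symm))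
  have adj0 : ∀ u ∈ (c 0).1, ∀ v ∈ (c 0).1, u ≠ v → G.Adj u v := fun u hu v hv h =>
    (c 0).2.isClique hu hv h
  have adj1 : ∀ u ∈ (c 1).1, ∀ v ∈ (c 1).1, u ≠ v → G.Adj u v := fun u hu v hv h =>
    (c 1).2.isClique hu hv h
  -- Otherwise `apq` and `bpq` would be two different triangles, both distinct from `c 0` and `c 1`,
  -- while only `c 2` is left.
  have hnpq : ¬ G.Adj p q := by
    intro h
    have h1 := hall {a, p, q} (SimpleGraph.is3Clique_triple_iff.2
      ⟨adj0 a ha0 p hp hap, adj1 a ha1 q hq haq, h⟩)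
    have h2 := hall {b, p, q} (SimpleGraph.is3Clique_triple_iff.2
      ⟨adj0 b hb0 p hp hbp, adj1 b hb1 q hq hbq, h⟩)
    have k0 : q ∉ (c 0).1 := by rw [m0]; tauto
    have k1 : p ∉ (c 1).1 := by rw [m1]; tauto
    have h1 : ({a, p, q} : Finset V) = (c 2).1 := by
      rcases h1 with h1 | h1 | h1
      · exact absurd (h1 ▸ by simp) k0
      · exact absurd (h1 ▸ by simp) k1
      · exact h1
    have h2 : ({b, p, q} : Finset V) = (c 2).1 := by
      rcases h2 with h2 | h2 | h2
      · exact absurd (h2 ▸ by simp) k0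
      · exact absurd (h2 ▸ by simp) k1
      · exact h2
    have : a ∈ ({b, p, q} : Finset V) := by rw [h2, ← h1]; simp
    simp only [Finset.mem_insert, Finset.mem_singleton] at this
    tauto
  -- The third triangle misses `p` or `q`, so the edge it shares with the corresponding one of the
  -- first two triangles can only be `ab`.
  have hab2 : a ∈ (c 2).1 ∧ b ∈ (c 2).1 := by
    obtain ⟨-, a', b', hab', ha', hb', ha'', hb''⟩ := h02
    obtain ⟨-, a₁, b₁, hab₁, ha₁, hb₁, ha₂, hb₂⟩ := h12
    rw [m0] at ha' hb'
    rw [m1] at ha₁ hb₁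
    have : ¬ (p ∈ (c 2).1 ∧ q ∈ (c 2).1) := fun h => hnpq ((c 2).2.isClique h.1 h.2 hpq)
    grind
  obtain ⟨r, hr, har, hbr⟩ := exists_third (c 2).2 hab2.1 hab2.2 hab
  have m2 := mem_iff_of_clique (c 2).2 hab2.1 hab2.2 hr hab har hbr
  have hpr : p ≠ r := by
    rintro rfl
    exact h02.1 (Subtype.ext (Finset.ext fun v => (m0 v).trans (m2 v).symm))
  have hqr : q ≠ r := by
    rintro rfl
    exact h12.1 (Subtype.ext (Finset.ext fun v => (m1 v).trans (m2 v).symm))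
  have adj2 : ∀ u ∈ (c 2).1, ∀ v ∈ (c 2).1, u ≠ v → G.Adj u v := fun u hu v hv h =>
    (c 2).2.isClique hu hv h
  have hmem : ∀ s, G.IsNClique 3 s → (∀ v, v ∈ s ↔ v = a ∨ v = b ∨ v = p) ∨
      (∀ v, v ∈ s ↔ v = a ∨ v = b ∨ v = q) ∨ (∀ v, v ∈ s ↔ v = a ∨ v = b ∨ v = r) := by
    intro s hs
    rcases hall s hs with rfl | rfl | rfl
    exacts [Or.inl m0, Or.inr (Or.inl m1), Or.inr (Or.inr m2)]
  have hadj : ∀ u v, G.Adj u v → u = a ∨ u = b ∨ v = a ∨ v = b := by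
    intro u v huv
    obtain ⟨s, hs, hus, hvs⟩ := hG.exists_clique huv
    have := huv.ne
    rcases hmem s hs with h | h | h <;> rw [h] at hus hvs <;> grind
  have hsurj : ∀ v, v = p ∨ v = q ∨ v = r ∨ v = a ∨ v = b := by
    intro v
    obtain ⟨s, hs, hv⟩ := hG.exists_clique_mem v
    rcases hmem s hs with h | h | h <;> rw [h] at hv <;> rcases hv with h' | h' | h' <;> simp [h']
  have e7 := adj0 a ha0 b hb0 hab
  refine iso_K5MinusK3_of_hub ![p, q, r, a, b] ?_ ?_ ?_
  · simp [Function.Injective, Fin.forall_fin_succ, hpq, hpr, hqr, hab, hap.symm, hbp.symm, haq.symm,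
      hbq.symm, har.symm, hbr.symm, hpq.symm, hpr.symm, hqr.symm, hab.symm, hap, hbp, haq, hbq, har,
      hbr]
  · intro v
    rcases hsurj v with rfl | rfl | rfl | rfl | rfl
    exacts [⟨0, rfl⟩, ⟨1, rfl⟩, ⟨2, rfl⟩, ⟨3, rfl⟩, ⟨4, rfl⟩]
  · intro u v
    refine ⟨fun h => ⟨h.ne, ?_⟩, ?_⟩
    · have := hadj u v h
      simp only [Matrix.cons_val]
      tauto
    · simp only [Matrix.cons_val]
      have hub : ∀ w, w ≠ a → w ≠ b → G.Adj a w ∧ G.Adj b w := by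
        intro w hwa hwb
        rcases hsurj w with h | h | h | h | h
        · rw [h]
          exact ⟨adj0 a ha0 p hp hap, adj0 b hb0 p hp hbp⟩
        · rw [h]
          exact ⟨adj1 a ha1 q hq haq, adj1 b hb1 q hq hbq⟩
        · rw [h]
          exact ⟨adj2 a hab2.1 r hr har, adj2 b hab2.2 r hr hbr⟩
        · exact absurd h hwa
        · exact absurd h hwb
      rintro ⟨huv, h⟩
      by_cases hua : u = a
      · by_cases hvb : v = b
        · rw [hua, hvb]
          exact e7
        · rw [hua] at huv ⊢
          exact (hub v huv.symm hvb).1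
      · by_cases hub' : u = b
        · by_cases hva : v = a
          · rw [hub', hva]
            exact e7.symm
          · rw [hub'] at huv ⊢
            exact (hub v hva huv.symm).2
        · rcases h with h | h | h | h
          · exact absurd h hua
          · exact absurd h hub'
          · rw [h]
            exact (hub u hua hub').1.symm
          · rw [h]
            exact (hub u hua hub').2.symm

/-! ### Cyclic strips of triangles -/

/-- The triangles of `G` are arranged as a cyclic sequence of length `n ≥ 4`, consecutive triangles
sharing an edge and others not; `d i` is the vertex of `t i` which is not in `t (i + 1)`. -/
structure Strip {V : Type*} (G : SimpleGraph V) (n : ℤ) (t : ℤ → Finset V) (d : ℤ → V) : Prop where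
  four_le : 4 ≤ n
  covered : TriCovered G
  clique : ∀ i, G.IsNClique 3 (t i)
  per : ∀ i j, n ∣ i - j → t i = t j
  surj : ∀ s, G.IsNClique 3 s → ∃ i, t i = s
  near : ∀ i, ∃ a b, a ≠ b ∧ a ∈ t i ∧ b ∈ t i ∧ a ∈ t (i + 1) ∧ b ∈ t (i + 1)
  far : ∀ i j a b, i + 1 < j → j + 1 < i + n → a ∈ t i → b ∈ t i → a ∈ t j → b ∈ t j → a = b
  d_mem : ∀ i, d i ∈ t i
  d_notMem : ∀ i, d i ∉ t (i + 1)
  eq_d : ∀ i v, v ∈ t i → v ∉ t (i + 1) → v = d i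

theorem emod_add_eq {n : ℤ} (i : ℤ) {k : ℤ} (hk : 0 ≤ k) (hkn : k < n) :
    (i + k) % n = if i % n + k < n then i % n + k else i % n + k - n := by
  have h1 := Int.emod_nonneg i (show n ≠ 0 by omega)
  have h2 := Int.emod_lt_of_pos i (show 0 < n by omega)
  have h3 : i + k = (i % n + k) + n * (i / n) := by
    have := Int.emod_add_mul_ediv i n
    omega
  rw [h3, Int.add_mul_emod_self_left]
  split_ifs with h
  · exact Int.emod_eq_of_lt (by omega) h
  · rw [← Int.sub_emod_right, Int.emod_eq_of_lt (by omega) (by omega)]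

/-- Indexing by ℤ through residues makes the cyclic order linear. Consecutive triangles are distinct
and share an edge, so exactly one vertex is lost at each step, and this is `d i`. -/
theorem exists_strip {V : Type*} {G : SimpleGraph V} (hG : TriCovered G) {n : ℕ} (hn : 4 ≤ n)
    (h : TriCycle G n) : ∃ t d, Strip G n t d := by
  obtain ⟨e⟩ := h
  obtain ⟨c, hc⟩ := IsCyc.of_iso (by omega) e
  let t : ℤ → Finset V := fun i => (c (i % n).toNat).1
  have hcl : ∀ i, G.IsNClique 3 (t i) := fun i => (c (i % n).toNat).2
  have hnear : ∀ i : ℤ, (triangleGraph G).Adj (c (i % n).toNat) (c ((i + 1) % n).toNat) := by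
    intro i
    have h1 := Int.emod_nonneg i (show (n : ℤ) ≠ 0 by omega)
    have h2 := Int.emod_lt_of_pos i (show 0 < (n : ℤ) by omega)
    rw [emod_add_eq i (by omega : (0 : ℤ) ≤ 1) (by omega)]
    split_ifs with h
    · rw [hc.adj _ _ (by omega) (by omega)]
      omega
    · rw [SimpleGraph.adj_comm, hc.adj _ _ (by omega) (by omega)]
      omega
  have hfar : ∀ (i j : ℤ) a b, i + 1 < j → j + 1 < i + n → a ∈ t i → b ∈ t i → a ∈ t j → b ∈ t j →
      a = b := by
    intro i j a b h1 h2 ha hb ha' hb'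
    by_contra hab
    have h3 := Int.emod_nonneg i (show (n : ℤ) ≠ 0 by omega)
    have h4 := Int.emod_lt_of_pos i (show 0 < (n : ℤ) by omega)
    have h5 := emod_add_eq (n := (n : ℤ)) i (k := j - i) (by omega) (by omega)
    rw [add_sub_cancel] at h5
    have hadj : c (i % n).toNat ≠ c (j % n).toNat →
        (triangleGraph G).Adj (c (i % n).toNat) (c (j % n).toNat) := fun hne =>
      triangleGraph_adj_iff.2 ⟨hne, a, b, hab, ha, hb, ha', hb'⟩
    rcases lt_or_ge (i % n + (j - i)) (n : ℤ) with h | h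
    · rw [if_pos h] at h5
      have := hadj (hc.inj _ _ (by omega) (by omega))
      rw [hc.adj _ _ (by omega) (by omega)] at this
      omega
    · rw [if_neg (by omega)] at h5
      have := hadj (hc.inj _ _ (by omega) (by omega)).symm
      rw [SimpleGraph.adj_comm, hc.adj _ _ (by omega) (by omega)] at this
      omega
  have hd : ∀ i : ℤ, ∃ d, d ∈ t i ∧ d ∉ t (i + 1) ∧ ∀ v ∈ t i, v ∉ t (i + 1) → v = d := by
    intro i
    obtain ⟨hne, a, b, hab, ha, hb, ha', hb'⟩ := triangleGraph_adj_iff.1 (hnear i)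
    obtain ⟨p, hp, hap, hbp⟩ := exists_third (hcl i) ha hb hab
    have m := mem_iff_of_clique (hcl i) ha hb hp hab hap hbp
    refine ⟨p, hp, fun h => hne (Subtype.ext ?_), fun v hv hv' => ?_⟩
    · refine Finset.ext fun v => (m v).trans ?_
      exact (mem_iff_of_clique (hcl (i + 1)) ha' hb' h hab hap hbp v).symm
    · rcases (m v).1 hv with rfl | rfl | rfl
      · exact absurd ha' hv'
      · exact absurd hb' hv'
      · rfl
  choose d hd1 hd2 hd3 using hd
  refine ⟨t, d, ⟨by omega, hG, hcl, ?_, ?_, ?_, hfar, hd1, hd2, hd3⟩⟩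
  · intro i j hij
    have : i % n = j % n := Int.emod_eq_emod_iff_emod_sub_eq_zero.2 (Int.emod_eq_zero_of_dvd hij)
    simp only [t, this]
  · intro s hs
    obtain ⟨i, hi, h⟩ := hc.surj ⟨s, hs⟩
    refine ⟨i, ?_⟩
    have : ((i : ℤ) % n).toNat = i := by
      rw [Int.emod_eq_of_lt (by omega) (by omega)]
      simp
    simp only [t, this, h]
  · intro i
    obtain ⟨-, h⟩ := triangleGraph_adj_iff.1 (hnear i)
    exact h

/-! ### Undoing a vertex sticking and an edge splitting -/

-- If the neighbourhood of `v` splits into `A` and a rest with no edges between, `v` can be torn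
-- apart: `none` takes `A` and `some v` keeps the rest. The absence of edges between the parts gives
-- distance at least 4; `a₀` and `b₀` keep both halves from being isolated.
open Classical in
theorem exists_unstick {V : Type u} {G : SimpleGraph V} (hG : TriCovered G) {v : V} {A : Set V}
    (hA : ∀ a ∈ A, G.Adj v a) {a₀ b₀ : V} (ha₀ : a₀ ∈ A) (hb₀ : G.Adj v b₀) (hb₀A : b₀ ∉ A)
    (hAB : ∀ a ∈ A, ∀ b, G.Adj v b → b ∉ A → ¬ G.Adj a b) :
    ∃ (G' : SimpleGraph (Option V)), TriCovered G' ∧ 4 ≤ G'.edist none (some v) ∧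
      Nonempty (vertexStick G' none (some v) ≃g G) := by
  let G' : SimpleGraph (Option V) := SimpleGraph.fromRel fun a b =>
    match a, b with
    | some a, some b => G.Adj a b ∧ ¬ (a = v ∧ b ∈ A) ∧ ¬ (b = v ∧ a ∈ A)
    | none, some b => b ∈ A
    | _, none => False
  have adj_some : ∀ a b, G'.Adj (some a) (some b) ↔
      G.Adj a b ∧ ¬ (a = v ∧ b ∈ A) ∧ ¬ (b = v ∧ a ∈ A) := by
    intro a b
    simp only [G', SimpleGraph.fromRel_adj, ne_eq, Option.some.injEq, G.adj_comm b a]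
    constructor
    · tauto
    · exact fun h => ⟨h.1.ne, Or.inl h⟩
  have adj_none : ∀ b, G'.Adj none (some b) ↔ b ∈ A := by
    intro b
    simp [G', SimpleGraph.fromRel_adj]
  have adj_none' : ∀ b, G'.Adj (some b) none ↔ b ∈ A := fun b => by
    rw [SimpleGraph.adj_comm, adj_none]
  have hvA : v ∉ A := fun h => (hA v h).ne rfl
  -- Each triangle at `v` lies wholly on one side, so it survives the tearing and edges stay
  -- covered.
  have hsame : ∀ a b, G.Adj v a → G.Adj v b → G.Adj a b → (a ∈ A ↔ b ∈ A) := by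
    intro a b ha hb hab
    constructor
    · intro h
      by_contra h'
      exact hAB a h b hb h' hab
    · intro h
      by_contra h'
      exact hAB b h a ha h' hab.symm
  refine ⟨G', ⟨?_, ?_⟩, four_le_edist_iff.2 ⟨by simp, ?_, ?_, ?_⟩, ?_⟩
  · rintro (_ | x)
    · exact ⟨some a₀, (adj_none _).2 ha₀⟩
    · by_cases hx : x = v
      · refine ⟨some b₀, (adj_some _ _).2 ?_⟩
        subst hx
        exact ⟨hb₀, by tauto, by tauto⟩
      · by_cases hxA : x ∈ A
        · exact ⟨none, (adj_none' _).2 hxA⟩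
        · obtain ⟨y, hy⟩ := hG.exists_adj x
          exact ⟨some y, (adj_some _ _).2 ⟨hy, by tauto, by tauto⟩⟩
  · have key : ∀ a, a ∈ A → ∃ z, G'.Adj none z ∧ G'.Adj (some a) z := by
      intro a ha
      obtain ⟨z, h1, h2⟩ := hG.exists_tri v a (hA a ha)
      have hz := (hsame a z (hA a ha) h1 h2).1 ha
      refine ⟨some z, (adj_none z).2 hz, (adj_some _ _).2 ⟨h2, ?_, ?_⟩⟩
      · rintro ⟨rfl, -⟩
        exact hvA ha
      · rintro ⟨rfl, -⟩
        exact h1.ne rfl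
    rintro (_ | a) (_ | b) hab'
    · exact absurd rfl hab'.ne
    · exact key b ((adj_none b).1 hab')
    · obtain ⟨z, h1, h2⟩ := key a ((adj_none' a).1 hab')
      exact ⟨z, h2, h1⟩
    · obtain ⟨hab, h1, h2⟩ := (adj_some a b).1 hab'
      obtain ⟨z, haz, hbz⟩ := hG.exists_tri a b hab
      by_cases hz : z = v
      · subst hz
        by_cases haA : a ∈ A
        · exact ⟨none, (adj_none' a).2 haA, (adj_none' b).2 ((hsame a b haz.symm hbz.symm hab).1 haA)⟩
        · have hbA : b ∉ A := fun h => haA ((hsame a b haz.symm hbz.symm hab).2 h)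
          exact ⟨some z, (adj_some _ _).2 ⟨haz, by tauto, by tauto⟩,
            (adj_some _ _).2 ⟨hbz, by tauto, by tauto⟩⟩
      · refine ⟨some z, (adj_some _ _).2 ⟨haz, ?_, by tauto⟩, (adj_some _ _).2 ⟨hbz, ?_, by tauto⟩⟩
        · rintro ⟨rfl, hzA⟩
          exact h1 ⟨rfl, (hsame b z hab haz hbz).2 hzA⟩
        · rintro ⟨rfl, hzA⟩
          exact h2 ⟨rfl, (hsame a z hab.symm hbz haz).2 hzA⟩
  · rwa [adj_none]
  · rintro (_ | a) h1 h2
    · exact h1.ne rfl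
    · rw [adj_none] at h1
      rw [adj_some] at h2
      exact h2.2.1 ⟨rfl, h1⟩
  · rintro (_ | a) (_ | b) h1 h2 h3
    · exact h1.ne rfl
    · exact h1.ne rfl
    · rw [adj_none'] at h2
      exact hvA h2
    · rw [adj_none] at h1
      rw [adj_some] at h2 h3
      exact hAB a h1 b h2.1 (fun h => h2.2.1 ⟨rfl, h⟩) h3.1
  · let f : V → Option {a : Option V // a ≠ none ∧ a ≠ some v} := fun a =>
      if h : a = v then none else some ⟨some a, by simp, by simpa using h⟩
    have fv : f v = none := by simp [f]
    have fne : ∀ a (h : a ≠ v), f a = some ⟨some a, by simp, by simpa using h⟩ := fun a h => by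
      simp [f, h]
    have hf : Function.Bijective f := by
      constructor
      · intro a b hab
        by_cases ha : a = v <;> by_cases hb : b = v
        · rw [ha, hb]
        · rw [ha, fv, fne b hb] at hab
          simp at hab
        · rw [hb, fv, fne a ha] at hab
          simp at hab
        · rw [fne a ha, fne b hb] at hab
          simpa using hab
      · rintro (_ | ⟨_ | a, h1, h2⟩)
        · exact ⟨v, fv⟩
        · exact absurd rfl h1
        · exact ⟨a, fne a (by simpa using h2)⟩
    refine ⟨SimpleGraph.Iso.symm ⟨Equiv.ofBijective f hf, ?_⟩⟩
    have main : ∀ b, b ≠ v → ((vertexStick G' none (some v)).Adj (f v) (f b) ↔ G.Adj v b) := by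
      intro b hb
      rw [fv, fne b hb, vertexStick_adj_none]
      simp only [adj_none, adj_some, hvA, and_false, not_false_eq_true, and_true, true_and]
      have := hA b
      tauto
    intro a b
    change (vertexStick G' none (some v)).Adj (f a) (f b) ↔ _
    by_cases ha : a = v
    · by_cases hb : b = v
      · rw [ha, hb]
        simp
      · rw [ha]
        exact main b hb
    · by_cases hb : b = v
      · rw [hb, SimpleGraph.adj_comm, main a ha, SimpleGraph.adj_comm]
      · rw [fne a ha, fne b hb, vertexStick_adj_some]
        simp only [adj_some]
        tauto

-- Deleting `w` and restoring `xy` inverts a splitting. Here `hq` says that `z` is the only common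
-- neighbour of `x` and `y` once `w` is gone, while `hx` and `hy` supply, besides `xyz`, the second
-- triangles at `xz` and `zy`.
open Classical in
theorem exists_unsplit {V : Type u} {G : SimpleGraph V} (hG : TriCovered G) {w x y z : V}
    (hN : ∀ u, G.Adj w u ↔ u = x ∨ u = y ∨ u = z) (hxy : x ≠ y) (hxz : G.Adj x z)
    (hyz : G.Adj y z) (hnadj : ¬ G.Adj x y) (hq : ∀ q, G.Adj x q → G.Adj y q → q = z ∨ q = w)
    (hx : ∃ s, s ≠ w ∧ G.Adj x s ∧ G.Adj z s) (hy : ∃ s, s ≠ w ∧ G.Adj z s ∧ G.Adj y s) :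
    ∃ (G' : SimpleGraph {u : V // u ≠ w}) (x' y' z' : {u : V // u ≠ w}), TriCovered G' ∧
      CanSplit G' x' y' z' ∧ Nonempty (edgeSplit G' x' y' z' ≃g G) := by
  have hwx : G.Adj w x := (hN x).2 (by simp)
  have hwy : G.Adj w y := (hN y).2 (by simp)
  have hwz : G.Adj w z := (hN z).2 (by simp)
  let x' : {u : V // u ≠ w} := ⟨x, hwx.ne'⟩
  let y' : {u : V // u ≠ w} := ⟨y, hwy.ne'⟩
  let z' : {u : V // u ≠ w} := ⟨z, hwz.ne'⟩
  let G' : SimpleGraph {u : V // u ≠ w} := SimpleGraph.fromRel fun a b =>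
    G.Adj a b ∨ (a = x' ∧ b = y')
  have adj : ∀ a b, G'.Adj a b ↔ G.Adj a b ∨ (a = x' ∧ b = y') ∨ (a = y' ∧ b = x') := by
    intro a b
    have hxy' : x' ≠ y' := fun h => hxy (congrArg Subtype.val h)
    have : G.Adj a b → a ≠ b := fun h h' => h.ne (congrArg _ h')
    simp only [G', SimpleGraph.fromRel_adj, G.adj_comm b a]
    grind
  have hxz' : G'.Adj x' z' := (adj _ _).2 (Or.inl hxz)
  have hyz' : G'.Adj y' z' := (adj _ _).2 (Or.inl hyz)
  have hxy' : G'.Adj x' y' := (adj _ _).2 (Or.inr (Or.inl ⟨rfl, rfl⟩))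
  have hzx : z ≠ x := hxz.ne'
  have hzy : z ≠ y := hyz.ne'
  refine ⟨G', x', y', z', ⟨?_, ?_⟩, ⟨hxy', ?_, ?_, ?_⟩, ?_⟩
  · rintro ⟨a, ha⟩
    obtain ⟨b, hb⟩ := hG.exists_adj a
    by_cases hbw : b = w
    · subst hbw
      rcases (hN a).1 hb.symm with rfl | rfl | rfl
      exacts [⟨_, hxz'⟩, ⟨_, hyz'⟩, ⟨_, hxz'.symm⟩]
    · exact ⟨⟨b, hbw⟩, (adj _ _).2 (Or.inl hb)⟩
  · rintro ⟨a, ha⟩ ⟨b, hb⟩ hab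
    rcases (adj _ _).1 hab with h | ⟨h1, h2⟩ | ⟨h1, h2⟩
    · obtain ⟨c, hac, hbc⟩ := hG.exists_tri a b h
      by_cases hcw : c = w
      · subst hcw
        have h1 := (hN a).1 hac.symm
        have h2 := (hN b).1 hbc.symm
        simp only at h
        rcases h1 with rfl | rfl | rfl <;> rcases h2 with rfl | rfl | rfl <;> first
        | exact absurd rfl h.ne
        | exact absurd h hnadj
        | exact absurd h.symm hnadj
        | exact ⟨x', hxy'.symm, hxz'.symm⟩
        | exact ⟨x', hxz'.symm, hxy'.symm⟩
        | exact ⟨y', hxy', hyz'.symm⟩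
        | exact ⟨y', hyz'.symm, hxy'⟩
      · exact ⟨⟨c, hcw⟩, (adj _ _).2 (Or.inl hac), (adj _ _).2 (Or.inl hbc)⟩
    · rw [h1, h2]
      exact ⟨z', hxz', hyz'⟩
    · rw [h1, h2]
      exact ⟨z', hyz', hxz'⟩
  · ext ⟨q, hqw⟩
    rw [SimpleGraph.mem_commonNeighbors, Set.mem_singleton_iff]
    constructor
    · rintro ⟨h1, h2⟩
      have h3 : q ≠ x := fun h => h1.ne (Subtype.ext h.symm)
      have h4 : q ≠ y := fun h => h2.ne (Subtype.ext h.symm)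
      rw [adj] at h1 h2
      have h1 : G.Adj x q := by
        rcases h1 with h1 | h1 | h1
        · exact h1
        · exact absurd (congrArg Subtype.val h1.2) h4
        · exact absurd (congrArg Subtype.val h1.2) h3
      have h2 : G.Adj y q := by
        rcases h2 with h2 | h2 | h2
        · exact h2
        · exact absurd (congrArg Subtype.val h2.2) h4
        · exact absurd (congrArg Subtype.val h2.2) h3
      rcases hq q h1 h2 with rfl | rfl
      · rfl
      · exact absurd rfl hqw
    · intro h
      rw [h]
      exact ⟨hxz', hyz'⟩
  · obtain ⟨s, hsw, hxs, hzs⟩ := hx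
    refine ⟨⟨s, hsw⟩, (SimpleGraph.mem_commonNeighbors _).2 ⟨(adj _ _).2 (Or.inl hxs),
      (adj _ _).2 (Or.inl hzs)⟩, y', (SimpleGraph.mem_commonNeighbors _).2 ⟨hxy', hyz'.symm⟩, ?_⟩
    intro h
    have h : s = y := congrArg Subtype.val h
    exact hnadj (h ▸ hxs)
  · obtain ⟨s, hsw, hzs, hys⟩ := hy
    refine ⟨⟨s, hsw⟩, (SimpleGraph.mem_commonNeighbors _).2 ⟨(adj _ _).2 (Or.inl hzs),
      (adj _ _).2 (Or.inl hys)⟩, x', (SimpleGraph.mem_commonNeighbors _).2 ⟨hxz'.symm, hxy'.symm⟩, ?_⟩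
    intro h
    have h : s = x := congrArg Subtype.val h
    exact hnadj (h ▸ hys).symm
  · let f : V → Option {u : V // u ≠ w} := fun a => if h : a = w then none else some ⟨a, h⟩
    have fw : f w = none := by simp [f]
    have fne : ∀ a (h : a ≠ w), f a = some ⟨a, h⟩ := fun a h => by simp [f, h]
    have hf : Function.Bijective f := by
      constructor
      · intro a b hab
        by_cases ha : a = w <;> by_cases hb : b = w
        · rw [ha, hb]
        · rw [ha, fw, fne b hb] at hab
          simp at hab
        · rw [hb, fw, fne a ha] at hab
          simp at hab
        · rw [fne a ha, fne b hb] at hab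
          simpa using hab
      · rintro (_ | ⟨a, h⟩)
        · exact ⟨w, fw⟩
        · exact ⟨a, fne a h⟩
    refine ⟨SimpleGraph.Iso.symm ⟨Equiv.ofBijective f hf, ?_⟩⟩
    have main : ∀ b, b ≠ w → ((edgeSplit G' x' y' z').Adj (f w) (f b) ↔ G.Adj w b) := by
      intro b hb
      rw [fw, fne b hb, edgeSplit_adj_none, hN]
      simp only [x', y', z', Subtype.mk.injEq]
    intro a b
    change (edgeSplit G' x' y' z').Adj (f a) (f b) ↔ _
    by_cases ha : a = w
    · by_cases hb : b = w
      · rw [ha, hb]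
        simp
      · rw [ha]
        exact main b hb
    · by_cases hb : b = w
      · rw [hb, SimpleGraph.adj_comm, main a ha, SimpleGraph.adj_comm]
      · rw [fne a ha, fne b hb, edgeSplit_adj_some, adj]
        simp only [x', y', Subtype.mk.injEq, ne_eq, Sym2.eq_iff]
        constructor
        · tauto
        · intro h
          refine ⟨Or.inl h, ?_⟩
          rintro (⟨rfl, rfl⟩ | ⟨rfl, rfl⟩)
          exacts [hnadj h, hnadj h.symm]

/-! ### Finite classification of strips without removable vertices -/

/-- No two consecutive vertices are selected. -/
def StripSparse (n : ℕ) (s : ℕ → Bool) : Prop :=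
  ∀ j, j < n → s j = true → s ((j + 1) % n) = false

/-- The two boundary neighbours of a vertex of degree three have a further common neighbour. -/
def StripTerminal (n : ℕ) (s : ℕ → Bool) : Prop :=
  ∀ j, j < n → s j = true → ∃ q, q < n ∧ (q ≠ j ∧ q ≠ (j + 1) % n) ∧
    stripAdj n s ((j + n - 1) % n) q = true ∧
    stripAdj n s (if s ((j + 2) % n) then (j + 3) % n else (j + 2) % n) q = true

/-- The triangles `i` and `j` share an edge. -/
def StripShare (n : ℕ) (s : ℕ → Bool) (i j : ℕ) : Prop :=
  ∃ a, a < n ∧ (a ∈ stripTri n s i ∧ a ∈ stripTri n s j) ∧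
    ∃ b, b < a ∧ (b ∈ stripTri n s i ∧ b ∈ stripTri n s j)

/-- Triangles which are not consecutive do not share an edge. -/
def StripFar (n : ℕ) (s : ℕ → Bool) : Prop :=
  ∀ i, i < n → ∀ j, j < i → (i ≠ j + 1 ∧ i + 1 ≠ j + n) → ¬ StripShare n s i j

/-- Some triangle of the strip contains `a`, `b` and `c`. -/
def StripHas (n : ℕ) (s : ℕ → Bool) (a b c : ℕ) : Prop :=
  ∃ i, i < n ∧ a ∈ stripTri n s i ∧ b ∈ stripTri n s i ∧ c ∈ stripTri n s i

/-- The vertex `c < b` does not form a triangle with `a` and `b` outside the strip. -/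
def StripFullAt (n : ℕ) (s : ℕ → Bool) (a b : ℕ) : Prop :=
  ∀ c, c < b → (stripAdj n s a c = true ∧ stripAdj n s b c = true) → StripHas n s a b c

/-- All triangles are triangles of the strip. -/
def StripFull (n : ℕ) (s : ℕ → Bool) : Prop :=
  ∀ a, a < n → ∀ b, b < a → stripAdj n s a b = true → StripFullAt n s a b

instance (n : ℕ) (s : ℕ → Bool) (i j : ℕ) : Decidable (StripShare n s i j) := by
  unfold StripShare; infer_instance

instance (n : ℕ) (s : ℕ → Bool) (a b c : ℕ) : Decidable (StripHas n s a b c) := by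
  unfold StripHas; infer_instance

instance (n : ℕ) (s : ℕ → Bool) (a b : ℕ) : Decidable (StripFullAt n s a b) := by
  unfold StripFullAt; infer_instance

instance (n : ℕ) (s : ℕ → Bool) : Decidable (StripSparse n s) := by
  unfold StripSparse; infer_instance

instance (n : ℕ) (s : ℕ → Bool) : Decidable (StripTerminal n s) := by
  unfold StripTerminal; infer_instance

instance (n : ℕ) (s : ℕ → Bool) : Decidable (StripFar n s) := by
  unfold StripFar; infer_instance

instance (n : ℕ) (s : ℕ → Bool) : Decidable (StripFull n s) := by
  unfold StripFull; infer_instance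

/-- The selection `m` is a rotation of that of a supplementary type. -/
def StripSupplementary (m : ℕ) : Prop :=
  ∃ r, r < 8 ∧ ∃ c ∈ [85, 21, 5, 17], ∀ i, i < 8 → m.testBit ((i + r) % 8) = Nat.testBit c i

instance (m : ℕ) : Decidable (StripSupplementary m) := by
  unfold StripSupplementary; infer_instance

def StripAdmissible (n m : ℕ) : Prop :=
  (m ≠ 0 ∧ StripSparse n m.testBit) ∧ StripTerminal n m.testBit ∧
    StripFar n m.testBit ∧ StripFull n m.testBit

instance (n m : ℕ) : Decidable (StripAdmissible n m) := by
  unfold StripAdmissible; infer_instance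

/-- A search through all selections, each coded as a bit mask. The range is that of `five_le` and
`le_ten`; only n = 8 survives, up to rotation with the four masks of the supplementary types. -/
theorem strip_rigid (n : ℕ) (hn : 5 ≤ n) (hn' : n ≤ 10) (m : ℕ) (hm : m < 2 ^ n)
    (h : StripAdmissible n m) : n = 8 ∧ StripSupplementary m := by
  revert m
  interval_cases n
  · decide +kernel
  · decide +kernel
  · decide +kernel
  · decide +kernel
  · decide +kernel
  · decide +kernel

/-! ### Local structure of strips -/

theorem eq_of_dvd_of_dvd {n a b : ℤ} (ha : n ∣ a) (hb : n ∣ b) (h1 : a < b + n) (h2 : b < a + n) :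
    a = b := by
  have := Int.eq_zero_of_abs_lt_dvd (dvd_sub ha hb) (by rw [abs_lt]; omega)
  omega

theorem exists_dvd_window {n : ℤ} (hn : 0 < n) (i a : ℤ) : ∃ j, a ≤ j ∧ j < a + n ∧ n ∣ i - j := by
  refine ⟨a + (i - a) % n, ?_, ?_, ?_⟩
  · have := Int.emod_nonneg (i - a) hn.ne'
    omega
  · have := Int.emod_lt_of_pos (i - a) hn
    omega
  · have := Int.dvd_self_sub_emod (x := i - a) (m := n)
    rwa [sub_sub] at this

namespace Strip

variable {V : Type*} {G : SimpleGraph V} {n : ℤ} {t : ℤ → Finset V} {d : ℤ → V}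

theorem adj (h : Strip G n t d) {i : ℤ} {u v : V} (hu : u ∈ t i) (hv : v ∈ t i) (huv : u ≠ v) :
    G.Adj u v :=
  (h.clique i).isClique hu hv huv

theorem pos (h : Strip G n t d) : 0 < n := by
  have := h.four_le
  omega

theorem t_shift (h : Strip G n t d) (i : ℤ) : t (i + n) = t i := h.per _ _ (by simp)

theorem exists_mem (h : Strip G n t d) (v : V) (a : ℤ) : ∃ i, a ≤ i ∧ i < a + n ∧ v ∈ t i := by
  obtain ⟨s, hs, hv⟩ := h.covered.exists_clique_mem v
  obtain ⟨i, rfl⟩ := h.surj s hs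
  obtain ⟨j, h1, h2, h3⟩ := exists_dvd_window h.pos i a
  exact ⟨j, h1, h2, h.per i j h3 ▸ hv⟩

theorem exists_of_adj (h : Strip G n t d) {u v : V} (huv : G.Adj u v) (a : ℤ) :
    ∃ i, a ≤ i ∧ i < a + n ∧ u ∈ t i ∧ v ∈ t i := by
  obtain ⟨s, hs, hu, hv⟩ := h.covered.exists_clique huv
  obtain ⟨i, rfl⟩ := h.surj s hs
  obtain ⟨j, h1, h2, h3⟩ := exists_dvd_window h.pos i a
  exact ⟨j, h1, h2, h.per i j h3 ▸ hu, h.per i j h3 ▸ hv⟩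

theorem exists_of_clique (h : Strip G n t d) {u v w : V} (huv : G.Adj u v) (huw : G.Adj u w)
    (hvw : G.Adj v w) : ∃ i, u ∈ t i ∧ v ∈ t i ∧ w ∈ t i := by
  classical
  obtain ⟨i, hi⟩ := h.surj {u, v, w} (SimpleGraph.is3Clique_triple_iff.2 ⟨huv, huw, hvw⟩)
  exact ⟨i, by simp [hi], by simp [hi], by simp [hi]⟩

/-- An edge shared by `t i` and `t (i + 1)` is in no third triangle: because n ≥ 4, any other
triangle is far from one of these two. -/
theorem dvd_of_edge (h : Strip G n t d) {i j : ℤ} {a b : V} (hab : a ≠ b) (ha : a ∈ t i)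
    (hb : b ∈ t i) (ha' : a ∈ t (i + 1)) (hb' : b ∈ t (i + 1)) (haj : a ∈ t j) (hbj : b ∈ t j) :
    n ∣ j - i ∨ n ∣ j - (i + 1) := by
  have hn := h.four_le
  obtain ⟨k, h1, h2, h3⟩ := exists_dvd_window h.pos j i
  rw [h.per j k h3] at haj hbj
  rcases (by omega : k = i ∨ k = i + 1 ∨ (i + 1 < k ∧ k + 1 < i + n) ∨ k = i + n - 1) with
    rfl | rfl | h4 | h4
  · exact Or.inl h3
  · exact Or.inr h3
  · exact absurd (h.far i k a b h4.1 h4.2 ha hb haj hbj) hab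
  · exact absurd (h.far (i + 1) k a b (by omega) (by omega) ha' hb' haj hbj) hab

theorem d_per (h : Strip G n t d) {i j : ℤ} (hij : n ∣ i - j) : d i = d j := by
  refine h.eq_d j _ (h.per i j hij ▸ h.d_mem i) ?_
  rw [← h.per (i + 1) (j + 1) (by rwa [add_sub_add_right_eq_sub])]
  exact h.d_notMem i

/-- If `v` lay in `t i` alone among the three, both neighbouring triangles would contain the edge of
`t i` opposite `v`, although they are not consecutive. -/
theorem mem_pred_or_succ (h : Strip G n t d) {i : ℤ} {v : V} (hv : v ∈ t i) :
    v ∈ t (i - 1) ∨ v ∈ t (i + 1) := by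
  by_contra hcon
  rw [not_or] at hcon
  have hn := h.four_le
  obtain ⟨a, b, hab, ha, hb, ha', hb'⟩ := h.near (i - 1)
  obtain ⟨a₁, b₁, hab₁, ha₁, hb₁, ha₁', hb₁'⟩ := h.near i
  rw [sub_add_cancel] at ha' hb'
  have hva : a ≠ v := fun h' => hcon.1 (h' ▸ ha)
  have hvb : b ≠ v := fun h' => hcon.1 (h' ▸ hb)
  have m := mem_iff_of_clique (h.clique i) ha' hb' hv hab hva hvb
  have h1 : a₁ = a ∨ a₁ = b := by
    rcases (m a₁).1 ha₁ with h' | h' | h'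
    · exact Or.inl h'
    · exact Or.inr h'
    · exact absurd (h' ▸ ha₁') hcon.2
  have h2 : b₁ = a ∨ b₁ = b := by
    rcases (m b₁).1 hb₁ with h' | h' | h'
    · exact Or.inl h'
    · exact Or.inr h'
    · exact absurd (h' ▸ hb₁') hcon.2
  refine hab₁ (h.far (i - 1) (i + 1) a₁ b₁ (by omega) (by omega) ?_ ?_ ha₁' hb₁')
  · rcases h1 with h' | h' <;> rw [h'] <;> assumption
  · rcases h2 with h' | h' <;> rw [h'] <;> assumption

theorem d_mem_pred (h : Strip G n t d) (i : ℤ) : d i ∈ t (i - 1) :=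
  (h.mem_pred_or_succ (h.d_mem i)).resolve_right (h.d_notMem i)

theorem d_ne_succ (h : Strip G n t d) (i : ℤ) : d i ≠ d (i + 1) := fun h' =>
  h.d_notMem i (h' ▸ h.d_mem (i + 1))

theorem d_succ_mem (h : Strip G n t d) (i : ℤ) : d (i + 1) ∈ t i := by
  have := h.d_mem_pred (i + 1)
  rwa [add_sub_cancel_right] at this

theorem leave (h : Strip G n t d) {i j : ℤ} {v : V} (hij : i ≤ j) (hi : v ∈ t i) (hj : v ∉ t j) :
    ∃ k, i ≤ k ∧ k < j ∧ v = d k := by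
  induction j, hij using Int.leInduction with
  | base => exact absurd hi hj
  | succ j hij ih =>
    by_cases hj' : v ∈ t j
    · exact ⟨j, hij, by omega, h.eq_d j v hj' hj⟩
    · obtain ⟨k, h1, h2, h3⟩ := ih hj'
      exact ⟨k, h1, by omega, h3⟩

/-- A vertex lost at two places of one period lies in at least two separate runs of triangles. The
neighbours met along the run ending at `i` form `A`; no triangle at `v` joins different runs. -/
theorem exists_unstick (h : Strip G n t d) {i j : ℤ} (hij : i < j) (hjn : j < i + n)
    (hd : d i = d j) : ∃ (v : V) (A : Set V), (∀ a ∈ A, G.Adj v a) ∧ (∃ a₀, a₀ ∈ A) ∧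
      (∃ b₀, G.Adj v b₀ ∧ b₀ ∉ A) ∧ ∀ a ∈ A, ∀ b, G.Adj v b → b ∉ A → ¬ G.Adj a b := by
  have hn := h.four_le
  set v := d i with hv
  -- The indices of the run of triangles through `v` that ends at `i`.
  let K : ℤ → Prop := fun k => k ≤ i ∧ ∀ m, k ≤ m → m ≤ i → v ∈ t m
  have hKi : K i := ⟨le_rfl, fun m h1 h2 => by rw [le_antisymm h2 h1]; exact h.d_mem i⟩
  have hstep : ∀ k, K k → ∀ m u, u ≠ v → u ∈ t k → v ∈ t m → u ∈ t m →
      (n ∣ m - k ∨ (n ∣ m - (k + 1)) ∨ n ∣ m - (k - 1)) := by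
    intro k hk m u huv huk hvm hum
    obtain ⟨p, h1, h2, h3⟩ := exists_dvd_window h.pos m k
    rw [h.per m p h3] at hvm hum
    rcases (by omega : p = k ∨ p = k + 1 ∨ (k + 1 < p ∧ p + 1 < k + n) ∨ p = k + n - 1) with
      rfl | rfl | h4 | rfl
    · exact Or.inl h3
    · exact Or.inr (Or.inl h3)
    · exact absurd (h.far k p u v h4.1 h4.2 huk (hk.2 k le_rfl hk.1) hum hvm) huv
    · right; right
      rw [show m - (k - 1) = m - (k + n - 1) + n by ring]
      exact dvd_add h3 (dvd_refl n)
  -- A triangle containing `v` and a neighbour met in the run belongs to the run modulo n: by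
  -- `hstep` it is next to a member of the run, and `v` itself is in it.
  have hKm : ∀ k, K k → ∀ m u, u ≠ v → u ∈ t k → v ∈ t m → u ∈ t m → ∃ m', K m' ∧ n ∣ m - m' := by
    intro k hk m u huv huk hvm hum
    rcases hstep k hk m u huv huk hvm hum with h1 | h1 | h1
    · exact ⟨k, hk, h1⟩
    · rcases eq_or_lt_of_le hk.1 with rfl | h2
      · rw [h.per m _ h1] at hvm
        exact absurd hvm (h.d_notMem k)
      · exact ⟨k + 1, ⟨by omega, fun p hp hp' => hk.2 p (by omega) hp'⟩, h1⟩
    · refine ⟨k - 1, ⟨by have := hk.1; omega, fun p hp hp' => ?_⟩, h1⟩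
      rcases eq_or_lt_of_le hp with rfl | h2
      · rwa [h.per m _ h1] at hvm
      · exact hk.2 p (by omega) hp'
  refine ⟨v, {u | u ≠ v ∧ ∃ k, K k ∧ u ∈ t k}, ?_, ?_, ?_, ?_⟩
  · rintro a ⟨hav, k, hk, hak⟩
    exact h.adj (hk.2 k le_rfl hk.1) hak hav.symm
  · obtain ⟨b, hb, hbv⟩ := exists_ne_mem_of_clique (h.clique i) v
    exact ⟨b, hbv, i, hKi, hb⟩
  · obtain ⟨b, hb, hbv⟩ := exists_ne_mem_of_clique (h.clique j) v
    have hvj : v ∈ t j := hd ▸ h.d_mem j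
    refine ⟨b, h.adj hvj hb hbv.symm, ?_⟩
    rintro ⟨-, k, hk, hbk⟩
    obtain ⟨m, hm, hdvd⟩ := hKm k hk j b hbv hbk hvj hb
    -- Before its end the run continues to `m + 1`, whereas `v` is lost after `j`, which is
    -- congruent to `m`.
    have hmi : m = i := by
      by_contra hne
      have h1 : v ∈ t (m + 1) := hm.2 _ (by omega) (by have := hm.1; omega)
      rw [← h.per (j + 1) (m + 1) (by rwa [add_sub_add_right_eq_sub])] at h1
      exact h.d_notMem j (hd ▸ h1)
    subst hmi
    have := eq_of_dvd_of_dvd hdvd (dvd_zero n) (by omega) (by omega)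
    omega
  · rintro a ⟨hav, k, hk, hak⟩ b hvb hbA hab
    obtain ⟨m, hvm, ham, hbm⟩ := h.exists_of_clique (h.adj (hk.2 k le_rfl hk.1) hak hav.symm) hvb hab
    obtain ⟨m', hm', hdvd⟩ := hKm k hk m a hav hak hvm ham
    exact hbA ⟨hvb.ne', m', hm', h.per m m' hdvd ▸ hbm⟩

/-- The configuration around a vertex of degree three. -/
theorem deg_three (h : Strip G n t d) {j : ℤ} (hw : d j ∉ t (j - 2)) :
    ∃ y z, (∀ v, v ∈ t (j - 1) ↔ v = d (j - 1) ∨ v = d j ∨ v = z) ∧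
      (∀ v, v ∈ t j ↔ v = d j ∨ v = z ∨ v = y) ∧ d (j - 1) ≠ d j ∧ d (j - 1) ≠ z ∧ d j ≠ z ∧
      d j ≠ y ∧ z ≠ y ∧ d (j - 1) ∈ t (j - 2) ∧ z ∈ t (j - 2) ∧ z ∈ t (j + 1) ∧ y ∈ t (j + 1) ∧
      y ∉ t (j - 1) ∧ d (j - 1) ∉ t j ∧ ¬ G.Adj (d (j - 1)) y := by
  have hn := h.four_le
  have hxw : d (j - 1) ≠ d j := by
    have := h.d_ne_succ (j - 1)
    rwa [sub_add_cancel] at this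
  have hxj : d (j - 1) ∉ t j := by
    have := h.d_notMem (j - 1)
    rwa [sub_add_cancel] at this
  obtain ⟨z, hz, hxz, hwz⟩ := exists_third (h.clique (j - 1)) (h.d_mem (j - 1)) (h.d_mem_pred j) hxw
  have m1 := mem_iff_of_clique (h.clique (j - 1)) (h.d_mem (j - 1)) (h.d_mem_pred j) hz hxw hxz hwz
  have hzj : z ∈ t j := by
    by_contra h'
    refine hxz (h.eq_d (j - 1) z hz ?_).symm
    rwa [sub_add_cancel]
  obtain ⟨y, hy, hwy, hzy⟩ := exists_third (h.clique j) (h.d_mem j) hzj hwz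
  have m2 := mem_iff_of_clique (h.clique j) (h.d_mem j) hzj hy hwz hwy hzy
  have hsucc : ∀ v ∈ t j, v ≠ d j → v ∈ t (j + 1) := fun v hv hne => by
    by_contra h'
    exact hne (h.eq_d j v hv h')
  have hyj : y ∉ t (j - 1) := by
    rw [m1]
    rintro (h' | h' | h')
    · exact hxj (h' ▸ hy)
    · exact hwy h'.symm
    · exact hzy h'.symm
  have hpred : d (j - 1) ∈ t (j - 2) ∧ z ∈ t (j - 2) := by
    obtain ⟨a, b, hab, ha, hb, ha', hb'⟩ := h.near (j - 2)
    rw [show j - 2 + 1 = j - 1 by ring, m1] at ha' hb'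
    have haw : a ≠ d j := fun h' => hw (h' ▸ ha)
    have hbw : b ≠ d j := fun h' => hw (h' ▸ hb)
    rcases ha' with h1 | h1 | h1
    · rcases hb' with h2 | h2 | h2
      · exact absurd (h1.trans h2.symm) hab
      · exact absurd h2 hbw
      · exact ⟨h1 ▸ ha, h2 ▸ hb⟩
    · exact absurd h1 haw
    · rcases hb' with h2 | h2 | h2
      · exact ⟨h2 ▸ hb, h1 ▸ ha⟩
      · exact absurd h2 hbw
      · exact absurd (h1.trans h2.symm) hab
  have hzj' := hsucc z hzj hwz.symm
  have hyj' := hsucc y hy hwy.symm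
  refine ⟨y, z, m1, m2, hxw, hxz, hwz, hwy, hzy, hpred.1, hpred.2, hzj', hyj', hyj, hxj,
    fun hadj => ?_⟩
  -- The triangle on `d (j - 1)`, `y`, `z` would have index `j - 2` or `j - 1` because of the one
  -- edge at `z`, and `j` or `j + 1` because of the other; these four are incongruent mod n.
  obtain ⟨m, hxm, hym, hzm⟩ := h.exists_of_clique hadj (h.adj (h.d_mem (j - 1)) hz hxz)
    (h.adj hy hzj hzy.symm)
  have e : j - 2 + 1 = j - 1 := by ring
  have h1 := h.dvd_of_edge (i := j - 2) hxz hpred.1 hpred.2 (by rw [e]; exact h.d_mem _)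
    (by rwa [e]) hxm hzm
  have h2 := h.dvd_of_edge (i := j) hzy hzj hy hzj' hyj' hzm hym
  rcases h1 with h1 | h1 <;> rcases h2 with h2 | h2 <;>
    have := eq_of_dvd_of_dvd h1 h2 (by omega) (by omega) <;> omega

/-- A vertex of degree three arises from an edge splitting unless its two boundary neighbours have
a further common neighbour. -/
theorem exists_unsplit {V : Type u} {G : SimpleGraph V} {t : ℤ → Finset V} {d : ℤ → V}
    (h : Strip G n t d) {j : ℤ} (hw : d j ∉ t (j - 2))
    (hj : ∀ m, d j ∈ t m → n ∣ m - j ∨ n ∣ m - (j - 1))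
    (hq : ∀ y z, y ∈ t j → y ∉ t (j - 1) → z ∈ t (j - 1) → z ∈ t j → z ≠ d j →
      ∀ q, G.Adj (d (j - 1)) q → G.Adj y q → q = z ∨ q = d j) :
    ∃ (G' : SimpleGraph {u : V // u ≠ d j}) (x' y' z' : {u : V // u ≠ d j}), TriCovered G' ∧
      CanSplit G' x' y' z' ∧ Nonempty (edgeSplit G' x' y' z' ≃g G) := by
  obtain ⟨y, z, m1, m2, hxw, hxz, hwz, hwy, hzy, hx2, hz2, hz1, hy1, hyj, hxj, hnadj⟩ :=
    h.deg_three hw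
  have hzj : z ∈ t j := (m2 z).2 (by simp)
  have hyj' : y ∈ t j := (m2 y).2 (by simp)
  have hzj1 : z ∈ t (j - 1) := (m1 z).2 (by simp)
  have hxz' : G.Adj (d (j - 1)) z := h.adj (h.d_mem _) hzj1 hxz
  have hyz' : G.Adj y z := h.adj hyj' hzj hzy.symm
  refine TriangleGraphs.exists_unsplit h.covered (w := d j) (x := d (j - 1)) (y := y) (z := z)
    ?_ ?_ hxz' hyz' hnadj (hq y z hyj' hyj hzj1 hzj hwz.symm) ?_ ?_
  · intro u
    constructor
    · intro hu
      obtain ⟨m, -, -, hwm, hum⟩ := h.exists_of_adj hu 0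
      have hne := hu.ne'
      rcases hj m hwm with h1 | h1
      · rw [h.per m j h1, m2] at hum
        tauto
      · rw [h.per m _ h1, m1] at hum
        tauto
    · rintro (h1 | h1 | h1)
      · rw [h1]
        exact h.adj (h.d_mem_pred j) (h.d_mem _) hxw.symm
      · rw [h1]
        exact h.adj (h.d_mem j) hyj' hwy
      · rw [h1]
        exact h.adj (h.d_mem j) hzj hwz
  · rintro rfl
    exact hyj (h.d_mem _)
  · obtain ⟨s, hs, hxs, hzs⟩ := exists_third (h.clique (j - 2)) hx2 hz2 hxz
    exact ⟨s, fun h' => hw (h' ▸ hs), h.adj hx2 hs hxs, h.adj hz2 hs hzs⟩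
  · obtain ⟨s, hs, hys, hzs⟩ := exists_third (h.clique (j + 1)) hy1 hz1 hzy.symm
    exact ⟨s, fun h' => h.d_notMem j (h' ▸ hs), h.adj hz1 hs hzs, h.adj hy1 hs hys⟩

end Strip

/-! ### Proper strips: every vertex is lost exactly once per period -/

namespace Strip

/-- A strip in which the triangles at each vertex are consecutive, and which is not a wheel. -/
structure Proper {V : Type*} (G : SimpleGraph V) (n : ℤ) (t : ℤ → Finset V) (d : ℤ → V) : Prop
    extends Strip G n t d where
  inj : ∀ i j, i < j → j < i + n → d i ≠ d j
  no_hub : ∀ v, ∃ i, v ∉ t i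

namespace Proper

variable {V : Type*} {G : SimpleGraph V} {n : ℤ} {t : ℤ → Finset V} {d : ℤ → V}

/-- A vertex missing from an intermediate triangle would have been lost before index `j`, hence
twice within a period. -/
theorem convex (h : Proper G n t d) {i j m : ℤ} (hd : d j ∈ t i) (hi : j - n < i) (him : i ≤ m)
    (hmj : m ≤ j) : d j ∈ t m := by
  by_contra hcon
  obtain ⟨k, h1, h2, h3⟩ := h.leave him hd hcon
  exact h.inj k j (by omega) (by omega) h3.symm

/-- No vertex lies in every triangle, so each one is lost somewhere. -/
theorem exists_index (h : Proper G n t d) (v : V) (a : ℤ) : ∃ k, a ≤ k ∧ k < a + n ∧ v = d k := by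
  obtain ⟨i, -, -, hi⟩ := h.exists_mem v 0
  obtain ⟨j, hj⟩ := h.no_hub v
  obtain ⟨j', h1, -, h2⟩ := exists_dvd_window h.pos j i
  rw [h.per j j' h2] at hj
  obtain ⟨k, -, -, rfl⟩ := h.leave h1 hi hj
  obtain ⟨k', h3, h4, h5⟩ := exists_dvd_window h.pos k a
  exact ⟨k', h3, h4, h.d_per h5⟩

theorem d_eq_iff (h : Proper G n t d) (i j : ℤ) : d i = d j ↔ n ∣ i - j := by
  refine ⟨fun hij => ?_, h.d_per⟩
  obtain ⟨k, h1, h2, h3⟩ := exists_dvd_window h.pos i j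
  rw [h.d_per h3] at hij
  rcases eq_or_lt_of_le h1 with rfl | h4
  · exact h3
  · exact absurd hij.symm (h.inj j k h4 h2)

/-- For n = 4 the third vertex of `t 0` is `d 2` or `d 3` and that of `t 2` is `d 0` or `d 1`, so
these opposite triangles would share an edge. -/
theorem five_le (h : Proper G n t d) : 5 ≤ n := by
  have hn := h.four_le
  by_contra hlt
  have hn4 : n = 4 := by omega
  have h0 : d 1 ∈ t 0 := h.d_succ_mem 0
  have h2 : d 3 ∈ t 2 := h.d_succ_mem 2
  obtain ⟨c, hc, hc0, hc1⟩ := exists_third (h.clique 0) (h.d_mem 0) h0 (h.inj 0 1 (by omega) (by omega))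
  obtain ⟨e, he, he2, he3⟩ := exists_third (h.clique 2) (h.d_mem 2) h2 (h.inj 2 3 (by omega) (by omega))
  obtain ⟨k, hk, hk', rfl⟩ := h.exists_index c 0
  obtain ⟨l, hl, hl', rfl⟩ := h.exists_index e 0
  have hk2 : k = 2 ∨ k = 3 := by
    have : k ≠ 0 := fun h' => hc0 (by rw [h'])
    have : k ≠ 1 := fun h' => hc1 (by rw [h'])
    omega
  have hl2 : l = 0 ∨ l = 1 := by
    have : l ≠ 2 := fun h' => he2 (by rw [h'])
    have : l ≠ 3 := fun h' => he3 (by rw [h'])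
    omega
  have := h.far 0 2 (d k) (d l) (by omega) (by omega) hc
    (by rcases hl2 with rfl | rfl; exacts [h.d_mem 0, h0])
    (by rcases hk2 with rfl | rfl; exacts [h.d_mem 2, h2]) he
  exact h.inj l k (by omega) (by omega) this.symm

theorem dvd_of_mem (h : Proper G n t d) {j : ℤ} (hw : d j ∉ t (j - 2)) (m : ℤ) (hm : d j ∈ t m) :
    n ∣ m - j ∨ n ∣ m - (j - 1) := by
  obtain ⟨k, h1, h2, h3⟩ := exists_dvd_window h.pos m (j + 1 - n)
  rw [h.per m k h3] at hm
  rcases (by omega : k = j ∨ k = j - 1 ∨ k ≤ j - 2) with rfl | rfl | h4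
  · exact Or.inl h3
  · exact Or.inr h3
  · exact absurd (h.convex hm (by omega) h4 (by omega)) hw

/-- No vertex of degree three can be removed by inverting an edge splitting. -/
def Terminal (G : SimpleGraph V) (t : ℤ → Finset V) (d : ℤ → V) : Prop :=
  ∀ j, d j ∉ t (j - 2) → ∃ y z q, y ∈ t j ∧ y ∉ t (j - 1) ∧ z ∈ t (j - 1) ∧ z ∈ t j ∧ z ≠ d j ∧
    G.Adj (d (j - 1)) q ∧ G.Adj y q ∧ q ≠ z ∧ q ≠ d j

/-- Write `x = d (j - 1)`. The extra common neighbour `q` of `x` and `y` keeps both alive beyond the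
four triangles `t (j - 2)`, ..., `t (j + 1)` at the centre `z`. This confines `z` to these four, so
that `z = d (j + 1)`. -/
theorem terminal_config (h : Proper G n t d) (hT : Terminal G t d) {j : ℤ}
    (hw : d j ∉ t (j - 2)) : d (j + 1) ∈ t (j - 2) ∧ d (j + 1) ∉ t (j - 3) ∧
      ∃ y q, y ∈ t j ∧ y ∉ t (j - 1) ∧ G.Adj (d (j - 1)) q ∧ G.Adj y q ∧ q ≠ d j ∧
        q ≠ d (j + 1) ∧ q ∉ t (j - 2) ∧ q ∉ t (j - 1) ∧ q ∉ t j ∧ q ∉ t (j + 1) := by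
  have hn := h.five_le
  obtain ⟨y', z', m1, m2, hxw, hxz', hwz', hwy', hzy', hx2, hz2, hz1, hy1, hyj', hxj, hnadj⟩ :=
    h.deg_three hw
  obtain ⟨y, z, q, hy, hyj, hz, hzj, hzw, hxq, hyq, hqz, hqw⟩ := hT j hw
  have hyy : y = y' := by
    rcases (m2 y).1 hy with h1 | h1 | h1
    · exact absurd (h1 ▸ h.d_mem_pred j) hyj
    · exact absurd (h1 ▸ (m1 z').2 (by simp)) hyj
    · exact h1
  have hzz : z = z' := by
    rcases (m2 z).1 hzj with h1 | h1 | h1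
    · exact absurd h1 hzw
    · exact h1
    · exact absurd (h1 ▸ hz) hyj'
  subst hyy hzz
  have hxz : G.Adj (d (j - 1)) z := h.adj (h.d_mem _) hz hxz'
  have hyz : G.Adj y z := h.adj hy hzj hzy'.symm
  have e : j - 2 + 1 = j - 1 := by ring
  have hq1 : q ∉ t (j - 1) := by
    rw [m1]
    rintro (h1 | h1 | h1)
    exacts [hxq.ne' h1, hqw h1, hqz h1]
  have hq0 : q ∉ t j := by
    rw [m2]
    rintro (h1 | h1 | h1)
    exacts [hqw h1, hqz h1, hyq.ne' h1]
  -- Otherwise the triangles `xqz` and `yqz` put `q` and `z` together into `t (j - 2)` and `t (j +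
  -- 1)`, which are not consecutive as n ≥ 5.
  have hqz' : ¬ G.Adj q z := by
    intro hadj
    obtain ⟨m, hm1, hm2, hm3⟩ := h.exists_of_clique hxq hxz hadj
    obtain ⟨p, hp1, hp2, hp3⟩ := h.exists_of_clique hyq hyz hadj
    have hqa : q ∈ t (j - 2) := by
      rcases h.dvd_of_edge (i := j - 2) hxz' hx2 hz2 (by rw [e]; exact h.d_mem _) (by rwa [e])
        hm1 hm3 with h1 | h1
      · exact h.per _ _ h1 ▸ hm2
      · rw [e] at h1
        exact absurd (h.per _ _ h1 ▸ hm2) hq1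
    have hqb : q ∈ t (j + 1) := by
      rcases h.dvd_of_edge hzy' hzj hy hz1 hy1 hp3 hp1 with h1 | h1
      · exact absurd (h.per _ _ h1 ▸ hp2) hq0
      · exact h.per _ _ h1 ▸ hp2
    exact hqz (h.far (j - 2) (j + 1) q z (by omega) (by omega) hqa hz2 hqb hz1)
  have hq2 : q ∉ t (j - 2) := fun h1 => hqz' (h.adj h1 hz2 hqz)
  have hq3 : q ∉ t (j + 1) := fun h1 => hqz' (h.adj h1 hz1 hqz)
  -- The edge `xq` needs a triangle before `t (j - 2)`, so by convexity `x` is in `t (j - 3)`. With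
  -- `z` there as well, `xz` would lie in `t (j - 3)` and `t (j - 1)`.
  have hz3 : z ∉ t (j - 3) := by
    intro hz3
    obtain ⟨i, h1, h2, h3, h4⟩ := h.exists_of_adj hxq (j - n)
    have hi1 : i ≠ j - 1 := by rintro rfl; exact hq1 h4
    have hi2 : i ≠ j - 2 := by rintro rfl; exact hq2 h4
    have hx3 := h.convex h3 (by omega) (show i ≤ j - 3 by omega) (by omega)
    exact hxz' (h.far (j - 3) (j - 1) _ _ (by omega) (by omega) hx3 hz3 (h.d_mem _) hz)
  -- The mirror image, with `yq` forcing `y` into `t (j + 2)`. First the index `m` at which `y` is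
  -- lost has to be found.
  have hz4 : z ∉ t (j + 2) := by
    intro hz4
    obtain ⟨m, hm1, hm2, hm3⟩ := h.leave (show j ≤ j - 1 + n by omega) hy (by rwa [h.t_shift])
    obtain ⟨i, h1, h2, h3, h4⟩ := h.exists_of_adj hyq (m - n + 1)
    have hi1 : j ≤ i := by
      by_contra hlt
      rw [hm3] at h3 hyj
      exact hyj (h.convex h3 (by omega) (by omega) (by omega))
    have hi2 : i ≠ j := by rintro rfl; exact hq0 h4
    have hi3 : i ≠ j + 1 := by rintro rfl; exact hq3 h4
    have hy2 : y ∈ t (j + 2) := by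
      rw [hm3] at hy ⊢
      exact h.convex hy (by omega) (by omega) (by omega)
    exact hzy' (h.far j (j + 2) _ _ (by omega) (by omega) hzj hy hz4 hy2)
  have hzd : z = d (j + 1) := h.eq_d (j + 1) z hz1 (by rwa [show j + 1 + 1 = j + 2 by ring])
  rw [hzd] at hz2 hz3 hqz
  exact ⟨hz2, hz3, y, q, hy, hyj, hxq, hyq, hqw, hqz, hq2, hq1, hq0, hq3⟩

/-- The index of the third vertex of a triangle. -/
noncomputable def third (t : ℤ → Finset V) (d : ℤ → V) (i : ℤ) : ℤ :=
  open Classical in if d (i + 2) ∈ t i then i + 2 else i + 3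

theorem third_eq (t : ℤ → Finset V) (d : ℤ → V) (i : ℤ) :
    third t d i = i + 2 ∨ third t d i = i + 3 := by
  unfold third
  split_ifs
  · exact Or.inl rfl
  · exact Or.inr rfl

/-- If `d (i + 2)` is not in `t i`, it has degree three, and `terminal_config` at `i + 2` places `d
(i + 3)` in `t i`. Thus the strip is determined by n and the positions of its vertices of degree
three. -/
theorem mem_iff (h : Proper G n t d) (hT : Terminal G t d) (i : ℤ) (v : V) :
    v ∈ t i ↔ v = d i ∨ v = d (i + 1) ∨ v = d (third t d i) := by
  have hn := h.five_le
  have := third_eq t d i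
  refine mem_iff_of_clique (h.clique i) (h.d_mem i) (h.d_succ_mem i) ?_
    (h.inj _ _ (by omega) (by omega)) (h.inj _ _ (by omega) (by omega))
    (h.inj _ _ (by omega) (by omega)) v
  unfold third
  split_ifs with hi
  · exact hi
  · have := (h.terminal_config hT (j := i + 2) (by rwa [add_sub_cancel_right])).1
    rwa [add_sub_cancel_right, show i + 2 + 1 = i + 3 by ring] at this

theorem sparse (h : Proper G n t d) (hT : Terminal G t d) {j : ℤ} (hw : d j ∉ t (j - 2)) :
    d (j + 1) ∈ t (j + 1 - 2) := by
  have hn := h.five_le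
  exact h.convex (h.terminal_config hT hw).1 (by omega) (by omega) (by omega)

theorem dvd_of_mem_t (h : Proper G n t d) (hT : Terminal G t d) {a i : ℤ} (ha : d a ∈ t i) :
    ∃ c, 0 ≤ c ∧ c ≤ 3 ∧ n ∣ a - i - c := by
  have := third_eq t d i
  rw [h.mem_iff hT, h.d_eq_iff, h.d_eq_iff, h.d_eq_iff] at ha
  rcases ha with h1 | h1 | h1
  · exact ⟨0, by omega, by omega, by simpa using h1⟩
  · exact ⟨1, by omega, by omega, by rwa [sub_sub]⟩
  · exact ⟨third t d i - i, by omega, by omega, by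
      rwa [sub_sub, add_sub_cancel]⟩

theorem eq_third (h : Proper G n t d) (hT : Terminal G t d) {j : ℤ} (hw : d j ∉ t (j - 2)) {y : V}
    (hy : y ∈ t j) (hyj : y ∉ t (j - 1)) : y = d (third t d j) := by
  have hn := h.five_le
  rcases (h.mem_iff hT j y).1 hy with h1 | h1 | h1
  · exact absurd (h1 ▸ h.d_mem_pred j) hyj
  · refine absurd ?_ hyj
    rw [h1]
    exact h.convex (h.terminal_config hT hw).1 (by omega) (by omega) (by omega)
  · exact h1

/-- A triangle `i` holding `d (j - 1)` and `q` has `i = j - 3` or `i = j - 4`; a triangle `i'`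
holding `y` and `q` has `i' = j + 2` or `i' = j + 3`. The position of `q` exceeds each of `i`, `i'`
by 0 to 3 mod n, so n divides a number between 7 - 5 = 2 and 7 + 3 = 10. -/
theorem le_ten (h : Proper G n t d) (hT : Terminal G t d) {j : ℤ} (hw : d j ∉ t (j - 2)) :
    n ≤ 10 := by
  have hn := h.five_le
  obtain ⟨-, -, y, q, hy, hyj, hxq, hyq, -, -, hq2, hq1, hq0, hq3⟩ := h.terminal_config hT hw
  have hy' := h.eq_third hT hw hy hyj
  subst hy'
  obtain ⟨i, h1, h2, hxi, hqi⟩ := h.exists_of_adj hxq (j - n)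
  obtain ⟨i', h1', h2', hyi, hqi'⟩ := h.exists_of_adj hyq (third t d j - n + 1)
  obtain ⟨k, -, -, rfl⟩ := h.exists_index q 0
  have hi1 : i ≠ j - 1 := by rintro rfl; exact hq1 hqi
  have hi2 : i ≠ j - 2 := by rintro rfl; exact hq2 hqi
  have hi3 : i' ≠ j - 1 := by rintro rfl; exact hq1 hqi'
  have hi4 : i' ≠ j := by rintro rfl; exact hq0 hqi'
  have hi5 : i' ≠ j + 1 := by rintro rfl; exact hq3 hqi'
  have := third_eq t d j
  obtain ⟨c, hc1, hc2, hc3⟩ := h.dvd_of_mem_t hT hxi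
  obtain ⟨c', hc1', hc2', hc3'⟩ := h.dvd_of_mem_t hT hyi
  have e1 := eq_of_dvd_of_dvd hc3 (dvd_zero n) (by omega) (by omega)
  have e2 := eq_of_dvd_of_dvd hc3' (dvd_zero n) (by omega) (by omega)
  obtain ⟨b, hb1, hb2, hb3⟩ := h.dvd_of_mem_t hT hqi
  obtain ⟨b', hb1', hb2', hb3'⟩ := h.dvd_of_mem_t hT hqi'
  have := Int.le_of_dvd (by omega) (dvd_sub hb3 hb3')
  omega

theorem shift (h : Proper G n t d) (r : ℤ) :
    Proper G n (fun i => t (i + r)) (fun i => d (i + r)) where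
  four_le := h.four_le
  covered := h.covered
  clique i := h.clique _
  per i j hij := h.per _ _ (by rwa [add_sub_add_right_eq_sub])
  surj s hs := by
    obtain ⟨i, hi⟩ := h.surj s hs
    exact ⟨i - r, by rwa [sub_add_cancel]⟩
  near i := by
    have := h.near (i + r)
    rwa [show i + r + 1 = i + 1 + r by ring] at this
  far i j a b h1 h2 := h.far _ _ a b (by omega) (by omega)
  d_mem i := h.d_mem _
  d_notMem i := by
    have := h.d_notMem (i + r)
    rwa [show i + r + 1 = i + 1 + r by ring] at this
  eq_d i v h1 h2 := h.eq_d (i + r) v h1 (by rwa [show i + r + 1 = i + 1 + r by ring])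
  inj i j h1 h2 := h.inj _ _ (by omega) (by omega)
  no_hub v := by
    obtain ⟨i, hi⟩ := h.no_hub v
    exact ⟨i - r, by rwa [sub_add_cancel]⟩

theorem Terminal.shift (hT : Terminal G t d) (r : ℤ) :
    Terminal G (fun i => t (i + r)) (fun i => d (i + r)) := by
  intro j
  simp only [show ∀ c : ℤ, j - c + r = j + r - c from fun c => by ring]
  exact hT (j + r)

end Proper

end Strip

/-! ### Identifying the irreducible proper strips -/

namespace Strip.Proper

variable {V : Type*} {G : SimpleGraph V} {n : ℕ} {t : ℤ → Finset V} {d : ℤ → V}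

/-- `s` selects the vertices of degree three. -/
def Selects (n : ℕ) (t : ℤ → Finset V) (d : ℤ → V) (s : ℕ → Bool) : Prop :=
  ∀ k : ℕ, k < n → (s k = true ↔ d k ∉ t (k - 2))

theorem d_mod (h : Proper G n t d) (x : ℕ) : d (x % n : ℕ) = d x :=
  h.d_per (by
    rw [Int.natCast_mod, ← dvd_neg, neg_sub]
    exact Int.dvd_self_sub_emod)

theorem d_natCast_inj (h : Proper G n t d) {a b : ℕ} (ha : a < n) (hb : b < n)
    (hab : d a = d b) : a = b := by
  by_contra hne
  rcases Nat.lt_or_gt_of_ne hne with h1 | h1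
  · exact h.inj a b (by omega) (by omega) hab
  · exact h.inj b a (by omega) (by omega) hab.symm

theorem d_eq_natCast (h : Proper G n t d) {a : ℕ} (ha : a < n) (x : ℕ) :
    d a = d x ↔ a = x % n := by
  rw [← h.d_mod x]
  exact ⟨fun h' => h.d_natCast_inj ha (Nat.mod_lt _ (by omega)) h', fun h' => by rw [h']⟩

theorem Selects.mod {s : ℕ → Bool} (hs : Selects n t d s) (h : Proper G n t d) (k : ℕ) :
    s (k % n) = true ↔ d k ∉ t (k - 2) := by
  have hn := h.four_le
  rw [hs _ (Nat.mod_lt _ (by omega)), h.d_mod, h.per (((k % n : ℕ) : ℤ) - 2) (k - 2)]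
  rw [sub_sub_sub_cancel_right, Int.natCast_mod, ← dvd_neg, neg_sub]
  exact Int.dvd_self_sub_emod

theorem third_of_selects (h : Proper G n t d) {s : ℕ → Bool} (hs : Selects n t d s) (k : ℕ) :
    third t d k = ((if s ((k + 2) % n) then k + 3 else k + 2 : ℕ) : ℤ) := by
  have := hs.mod h (k + 2)
  push_cast at this
  rw [add_sub_cancel_right] at this
  unfold third
  by_cases hk : d (k + 2) ∈ t k
  · rw [if_pos hk, if_neg (by rw [this]; exact fun h' => h' hk)]
    push_cast
    rfl
  · rw [if_neg hk, if_pos (this.2 hk)]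
    push_cast
    rfl

theorem mem_t_iff (h : Proper G n t d) (hT : Terminal G t d) {s : ℕ → Bool}
    (hs : Selects n t d s) {a k : ℕ} (ha : a < n) : d a ∈ t k ↔ a ∈ stripTri n s k := by
  rw [h.mem_iff hT, h.third_of_selects hs, h.d_eq_natCast ha k, h.d_eq_natCast ha,
    show (k : ℤ) + 1 = ((k + 1 : ℕ) : ℤ) by push_cast; rfl, h.d_eq_natCast ha]
  simp only [stripTri, List.mem_cons, List.not_mem_nil, or_false]
  split_ifs <;> rfl

theorem exists_of_adj_nat (h : Proper G n t d) {u v : V} (huv : G.Adj u v) :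
    ∃ k : ℕ, k < n ∧ u ∈ t k ∧ v ∈ t k := by
  obtain ⟨i, h1, h2, h3, h4⟩ := h.exists_of_adj huv 0
  lift i to ℕ using h1
  exact ⟨i, by omega, h3, h4⟩

theorem adj_iff (h : Proper G n t d) (hT : Terminal G t d) {s : ℕ → Bool}
    (hs : Selects n t d s) {a b : ℕ} (ha : a < n) (hb : b < n) :
    G.Adj (d a) (d b) ↔ stripAdj n s a b = true := by
  simp only [stripAdj, Bool.and_eq_true, bne_iff_ne, List.any_eq_true, List.mem_range,
    List.elem_iff]
  constructor
  · intro hab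
    obtain ⟨k, hk, h1, h2⟩ := h.exists_of_adj_nat hab
    exact ⟨fun h' => hab.ne (by rw [h']), k, hk, (h.mem_t_iff hT hs ha).1 h1,
      (h.mem_t_iff hT hs hb).1 h2⟩
  · rintro ⟨hne, k, hk, h1, h2⟩
    exact h.adj ((h.mem_t_iff hT hs ha).2 h1) ((h.mem_t_iff hT hs hb).2 h2)
      fun h' => hne (h.d_natCast_inj ha hb h')

theorem exists_nat_index (h : Proper G n t d) (v : V) : ∃ k : ℕ, k < n ∧ v = d k := by
  obtain ⟨k, h1, h2, h3⟩ := h.exists_index v 0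
  lift k to ℕ using h1
  exact ⟨k, by omega, h3⟩

theorem iso_stripGraph (h : Proper G n t d) (hT : Terminal G t d) {s : ℕ → Bool}
    (hs : Selects n t d s) : Nonempty (stripGraph n s ≃g G) := by
  refine ⟨⟨Equiv.ofBijective (fun i : Fin n => d (i : ℕ)) ⟨fun i j hij => ?_, fun v => ?_⟩, ?_⟩⟩
  · exact Fin.ext (h.d_natCast_inj i.2 j.2 hij)
  · obtain ⟨k, hk, rfl⟩ := h.exists_nat_index v
    exact ⟨⟨k, hk⟩, rfl⟩
  · intro i j
    exact h.adj_iff hT hs i.2 j.2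

/-- Carries the properties of the strip over to the decidable predicates on its mask, which is what
the exhaustive search can use. -/
theorem stripAdmissible (h : Proper G n t d) (hT : Terminal G t d) {m : ℕ}
    (hs : Selects n t d m.testBit) (hm : m ≠ 0) : StripAdmissible n m := by
  have hn := h.five_le
  refine ⟨⟨hm, ?_⟩, ?_, ?_, ?_⟩
  · intro j hj hsj
    rw [← Bool.not_eq_true, hs.mod h, not_not]
    have := h.sparse hT ((hs j hj).1 hsj)
    exact_mod_cast this
  · intro j hj hsj
    have hw := (hs j hj).1 hsj
    obtain ⟨-, -, y, q, hy, hyj, hxq, hyq, hqj, hqj', -⟩ := h.terminal_config hT hw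
    obtain ⟨q, hq, rfl⟩ := h.exists_nat_index q
    rw [h.eq_third hT hw hy hyj, h.third_of_selects hs, ← h.d_mod] at hyq
    have hx : d (j - 1) = d ((j + n - 1) % n : ℕ) := by
      rw [h.d_mod]
      refine h.d_per ?_
      rw [show ((j : ℤ) - 1 - ((j + n - 1 : ℕ) : ℤ)) = -n by omega]
      simp
    rw [hx] at hxq
    refine ⟨q, hq, ⟨fun h' => hqj (by rw [h']), fun h' => hqj' ?_⟩, ?_, ?_⟩
    · rw [h', h.d_mod]
      push_cast
      rfl
    · exact (h.adj_iff hT hs (Nat.mod_lt _ (by omega)) hq).1 hxq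
    · have := (h.adj_iff hT hs (Nat.mod_lt _ (by omega)) hq).1 hyq
      split_ifs at this ⊢ <;> exact this
  · rintro i hi j hji ⟨h1, h2⟩ ⟨a, ha, ⟨ha1, ha2⟩, b, hba, hb1, hb2⟩
    rw [← h.mem_t_iff hT hs ha] at ha1 ha2
    rw [← h.mem_t_iff hT hs (hba.trans ha)] at hb1 hb2
    have := h.far j i _ _ (by omega) (by omega) ha2 hb2 ha1 hb1
    have := h.d_natCast_inj ha (hba.trans ha) this
    omega
  · rintro a ha b hba hab c hcb ⟨hac, hbc⟩
    have hb := hba.trans ha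
    have hc := hcb.trans hb
    rw [← h.adj_iff hT hs ha hb] at hab
    rw [← h.adj_iff hT hs ha hc] at hac
    rw [← h.adj_iff hT hs hb hc] at hbc
    obtain ⟨i, h1, h2, h3⟩ := h.exists_of_clique hab hac hbc
    obtain ⟨k, hk1, hk2, hk3⟩ := exists_dvd_window h.pos i 0
    rw [h.per i k hk3] at h1 h2 h3
    lift k to ℕ using hk1
    exact ⟨k, by omega, (h.mem_t_iff hT hs ha).1 h1, (h.mem_t_iff hT hs hb).1 h2,
      (h.mem_t_iff hT hs hc).1 h3⟩

theorem isSupplementary (h : Proper G n t d) (hT : Terminal G t d)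
    (hw : ∃ j, d j ∉ t (j - 2)) : n = 8 ∧ IsSupplementary G := by
  classical
  have hn := h.five_le
  obtain ⟨j, hj⟩ := hw
  have hn10 := h.le_ten hT hj
  -- The mask of the vertices of degree three in one period.
  set m := Nat.ofBits fun k : Fin n => decide (d (k : ℕ) ∉ t ((k : ℕ) - 2)) with hm
  have hs : Selects n t d m.testBit := by
    intro k hk
    rw [hm, Nat.testBit_ofBits_lt _ k hk, decide_eq_true_eq]
  have hm0 : m ≠ 0 := by
    intro h0
    obtain ⟨k, h1, h2, h3⟩ := exists_dvd_window h.pos j 0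
    lift k to ℕ using h1
    rw [h.d_per h3, h.per (j - 2) (k - 2) (by rwa [sub_sub_sub_cancel_right])] at hj
    have := (hs k (by omega)).2 hj
    rw [h0] at this
    simp at this
  obtain ⟨rfl, r, hr, c, hc, hrc⟩ := strip_rigid n (by omega) (by omega) m (Nat.ofBits_lt_two_pow _)
    (h.stripAdmissible hT hs hm0)
  refine ⟨rfl, isSupplementary_iff.2 ⟨c, by simpa using hc, ?_⟩⟩
  -- Relabelling from index `r` on turns the mask into the standard one.
  refine iso_stripGraph (h.shift r) (hT.shift r) fun k hk => ?_
  rw [← hrc k hk, hs.mod h]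
  push_cast
  rw [show (k : ℤ) - 2 + r = k + r - 2 by ring]

/-- Without vertices of degree three each `t i` consists of `d i`, `d (i + 1)`, `d (i + 2)`. For n =
5 and n = 6 the graph would have a triangle outside the strip, on the indices 0, 1, 3 and 0, 2, 4
respectively. -/
theorem iso_cycleSquare (h : Proper G n t d) (hT : Terminal G t d)
    (hw : ∀ j, d j ∈ t (j - 2)) : 7 ≤ n ∧ Nonempty (G ≃g cycleSquare n) := by
  have hn := h.five_le
  have mem : ∀ a i, d a ∈ t i ↔ (n : ℤ) ∣ a - i ∨ (n : ℤ) ∣ a - (i + 1) ∨ (n : ℤ) ∣ a - (i + 2) := by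
    intro a i
    have h3 : third t d i = i + 2 := by
      have := hw (i + 2)
      rw [add_sub_cancel_right] at this
      unfold third
      rw [if_pos this]
    rw [h.mem_iff hT, h3, h.d_eq_iff, h.d_eq_iff, h.d_eq_iff]
  have hne : ∀ i j : ℤ, i < j → j < i + n → d i ≠ d j := h.inj
  have hn5 : n ≠ 5 := by
    rintro rfl
    obtain ⟨i, h1, h2, h3⟩ := h.exists_of_clique (u := d 0) (v := d 1) (w := d 3)
      (h.adj (i := 0) (by rw [mem]; omega) (by rw [mem]; omega) (hne _ _ (by omega) (by omega)))
      (h.adj (i := 3) (by rw [mem]; omega) (by rw [mem]; omega) (hne _ _ (by omega) (by omega)))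
      (h.adj (i := 1) (by rw [mem]; omega) (by rw [mem]; omega) (hne _ _ (by omega) (by omega)))
    rw [mem] at h1 h2 h3
    omega
  have hn6 : n ≠ 6 := by
    rintro rfl
    obtain ⟨i, h1, h2, h3⟩ := h.exists_of_clique (u := d 0) (v := d 2) (w := d 4)
      (h.adj (i := 0) (by rw [mem]; omega) (by rw [mem]; omega) (hne _ _ (by omega) (by omega)))
      (h.adj (i := 4) (by rw [mem]; omega) (by rw [mem]; omega) (hne _ _ (by omega) (by omega)))
      (h.adj (i := 2) (by rw [mem]; omega) (by rw [mem]; omega) (hne _ _ (by omega) (by omega)))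
    rw [mem] at h1 h2 h3
    omega
  refine ⟨by omega, ⟨SimpleGraph.Iso.symm ⟨Equiv.ofBijective (fun i : Fin n => d (i : ℕ))
    ⟨fun i j hij => Fin.ext (h.d_natCast_inj i.2 j.2 hij), fun v => ?_⟩, ?_⟩⟩⟩
  · obtain ⟨k, hk, rfl⟩ := h.exists_nat_index v
    exact ⟨⟨k, hk⟩, rfl⟩
  · have key : ∀ i j : Fin n, i.1 < j.1 → (G.Adj (d (i : ℕ)) (d (j : ℕ)) ↔ (cycleSquare n).Adj i j) := by
      intro i j hij
      have hj := j.2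
      rw [cycleSquare_adj_of_lt hij]
      constructor
      · intro hadj
        obtain ⟨m, -, h1, h2⟩ := h.exists_of_adj_nat hadj
        have h1 : ∃ c : ℤ, 0 ≤ c ∧ c ≤ 2 ∧ (n : ℤ) ∣ (i : ℕ) - (m + c) := by
          rcases (mem _ _).1 h1 with h1 | h1 | h1
          exacts [⟨0, by omega, by omega, by simpa using h1⟩, ⟨1, by omega, by omega, h1⟩,
            ⟨2, by omega, by omega, h1⟩]
        have h2 : ∃ c : ℤ, 0 ≤ c ∧ c ≤ 2 ∧ (n : ℤ) ∣ (j : ℕ) - (m + c) := by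
          rcases (mem _ _).1 h2 with h2 | h2 | h2
          exacts [⟨0, by omega, by omega, by simpa using h2⟩, ⟨1, by omega, by omega, h2⟩,
            ⟨2, by omega, by omega, h2⟩]
        obtain ⟨c, hc1, hc2, hc3⟩ := h1
        obtain ⟨e, he1, he2, he3⟩ := h2
        have h3 := dvd_sub he3 hc3
        rcases le_or_gt ((j : ℕ) - (m + e) - ((i : ℕ) - (m + c)) : ℤ) 2 with h4 | h4
        · have := eq_of_dvd_of_dvd h3 (dvd_zero (n : ℤ)) (by omega) (by omega)
          omega
        · have := eq_of_dvd_of_dvd h3 (dvd_refl (n : ℤ)) (by omega) (by omega)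
          omega
      · have hadj : ∀ (c : ℤ), 0 ≤ c → c ≤ 2 → ∀ a b : ℤ, (n : ℤ) ∣ b - (a + c) → d a ≠ d b →
            G.Adj (d a) (d b) := by
          intro c hc1 hc2 a b hb hab
          refine h.adj (i := a) (h.d_mem a) ?_ hab
          rw [mem]
          rcases (by omega : c = 0 ∨ c = 1 ∨ c = 2) with rfl | rfl | rfl
          · left; simpa using hb
          · right; left; exact hb
          · right; right; exact hb
        have hij' : d (i : ℕ) ≠ d (j : ℕ) := hne _ _ (by omega) (by omega)
        rintro (h1 | h1 | h1 | h1)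
        · exact hadj 1 (by omega) (by omega) _ _ ⟨0, by omega⟩ hij'
        · exact hadj 2 (by omega) (by omega) _ _ ⟨0, by omega⟩ hij'
        · exact (hadj 1 (by omega) (by omega) _ _ ⟨-1, by omega⟩ hij'.symm).symm
        · exact (hadj 2 (by omega) (by omega) _ _ ⟨-1, by omega⟩ hij'.symm).symm
    intro i j
    change G.Adj (d (i : ℕ)) (d (j : ℕ)) ↔ _
    rcases lt_trichotomy i.1 j.1 with h1 | h1 | h1
    · exact key i j h1
    · rw [Fin.ext h1]
      simp
    · rw [SimpleGraph.adj_comm, key j i h1, SimpleGraph.adj_comm]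

end Strip.Proper

/-! ### Strips with a hub: wheels -/

namespace Strip

variable {V : Type*} {G : SimpleGraph V} {n : ℤ} {t : ℤ → Finset V} {d : ℤ → V}

/-- The spoke from `c` to `d j` lies only in `t (j - 1)` and `t j`, so the rim vertex determines its
index mod n. -/
theorem d_eq_iff_of_hub (h : Strip G n t d) {c : V} (hc : ∀ i, c ∈ t i) (i j : ℤ) :
    d i = d j ↔ n ∣ i - j := by
  refine ⟨fun hij => ?_, h.d_per⟩
  have hn := h.four_le
  have hcd : c ≠ d j := fun h' => h.d_notMem j (h' ▸ hc _)
  have e : ∀ m, d j ∈ t m → n ∣ m - (j - 1) ∨ n ∣ m - j := by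
    intro m hm
    have := h.dvd_of_edge (i := j - 1) hcd (hc _) (h.d_mem_pred j) (hc _)
      (by rw [sub_add_cancel]; exact h.d_mem j) (hc m) hm
    rwa [sub_add_cancel] at this
  rcases e i (hij ▸ h.d_mem i) with h1 | h1
  · rcases e (i - 1) (hij ▸ h.d_mem_pred i) with h2 | h2
    · rwa [sub_sub_sub_cancel_right] at h2
    · have := eq_of_dvd_of_dvd h1 h2 (by omega) (by omega)
      omega
  · exact h1

theorem mem_iff_of_hub (h : Strip G n t d) {c : V} (hc : ∀ i, c ∈ t i) (i : ℤ) (v : V) :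
    v ∈ t i ↔ v = c ∨ v = d i ∨ v = d (i + 1) :=
  mem_iff_of_clique (h.clique i) (hc i) (h.d_mem i) (h.d_succ_mem i)
    (fun h' => h.d_notMem i (h' ▸ hc _)) (fun h' => h.d_notMem (i + 1) (h' ▸ hc _))
    (h.d_ne_succ i) v

theorem d_mem_iff_of_hub (h : Strip G n t d) {c : V} (hc : ∀ i, c ∈ t i) (a i : ℤ) :
    d a ∈ t i ↔ n ∣ a - i ∨ n ∣ a - (i + 1) := by
  rw [h.mem_iff_of_hub hc, h.d_eq_iff_of_hub hc, h.d_eq_iff_of_hub hc]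
  exact or_iff_right fun h' => h.d_notMem a (h' ▸ hc _)

theorem adj_iff_of_hub (h : Strip G n t d) {c : V} (hc : ∀ i, c ∈ t i) (a b : ℤ) :
    G.Adj (d a) (d b) ↔ n ∣ b - (a + 1) ∨ n ∣ b - (a - 1) := by
  have hn := h.four_le
  constructor
  · intro hab
    obtain ⟨m, -, -, h1, h2⟩ := h.exists_of_adj hab 0
    have hne : ¬ n ∣ a - b := fun h' => hab.ne (h.d_per h')
    rw [h.d_mem_iff_of_hub hc] at h1 h2
    rcases h1 with h1 | h1 <;> rcases h2 with h2 | h2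
    · have := dvd_sub h1 h2
      rw [sub_sub_sub_cancel_right] at this
      exact absurd this hne
    · left
      have := dvd_sub h2 h1
      rwa [show b - (m + 1) - (a - m) = b - (a + 1) by ring] at this
    · right
      have := dvd_sub h2 h1
      rwa [show b - m - (a - (m + 1)) = b - (a - 1) by ring] at this
    · have := dvd_sub h1 h2
      rw [sub_sub_sub_cancel_right] at this
      exact absurd this hne
  · rintro (h1 | h1)
    · refine h.adj (h.d_mem a) ((h.d_mem_iff_of_hub hc _ _).2 (Or.inr h1)) fun h' => ?_
      have h2 := (h.d_eq_iff_of_hub hc _ _).1 h'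
      have := eq_of_dvd_of_dvd (dvd_add h1 h2) (dvd_zero n) (by omega) (by omega)
      omega
    · have h2 : d b ∈ t (a - 1) := (h.d_mem_iff_of_hub hc _ _).2 (Or.inl h1)
      refine h.adj (h.d_mem_pred a) h2 fun h' => ?_
      have h2 := (h.d_eq_iff_of_hub hc _ _).1 h'
      have := eq_of_dvd_of_dvd (dvd_add h1 h2) (dvd_zero n) (by omega) (by omega)
      omega

/-- In a wheel with at least five spokes, the rim neighbours of `d 0` have only the hub and `d 0` in
common. For four spokes the opposite rim vertex is a further common neighbour. -/
theorem exists_unsplit_of_hub {V : Type u} {G : SimpleGraph V} {t : ℤ → Finset V} {d : ℤ → V}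
    (h : Strip G n t d) {c : V} (hc : ∀ i, c ∈ t i) (hn : 5 ≤ n) :
    ∃ (G' : SimpleGraph {u : V // u ≠ d 0}) (x' y' z' : {u : V // u ≠ d 0}), TriCovered G' ∧
      CanSplit G' x' y' z' ∧ Nonempty (edgeSplit G' x' y' z' ≃g G) := by
  refine h.exists_unsplit (j := 0) ?_ ?_ ?_
  · rw [h.d_mem_iff_of_hub hc]
    rintro (h1 | h1)
    · have := eq_of_dvd_of_dvd h1 (dvd_zero n) (by omega) (by omega)
      omega
    · have := eq_of_dvd_of_dvd h1 (dvd_zero n) (by omega) (by omega)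
      omega
  · intro m hm
    rcases (h.d_mem_iff_of_hub hc _ _).1 hm with h1 | h1
    · left
      rwa [← dvd_neg, neg_sub]
    · right
      rw [← dvd_neg]
      rwa [show -(m - (0 - 1)) = 0 - (m + 1) by ring]
  · intro y z hy hyj hz hzj hzw q hxq hyq
    have hzc : z = c := by
      rcases (h.mem_iff_of_hub hc _ _).1 hzj with h1 | h1 | h1
      · exact h1
      · exact absurd h1 hzw
      · rcases (h.mem_iff_of_hub hc _ _).1 hz with h2 | h2 | h2
        · exact h2
        · have := eq_of_dvd_of_dvd ((h.d_eq_iff_of_hub hc _ _).1 (h1.symm.trans h2)) (dvd_zero n)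
            (by omega) (by omega)
          omega
        · exact absurd h2 hzw
    have hy1 : y = d 1 := by
      rcases (h.mem_iff_of_hub hc _ _).1 hy with h1 | h1 | h1
      · exact absurd (h1 ▸ hc _) hyj
      · exact absurd (h1 ▸ h.d_mem_pred 0) hyj
      · exact h1
    obtain ⟨m, -, -, hm⟩ := h.exists_mem q 0
    have hq : q = c ∨ ∃ k, q = d k := by
      rcases (h.mem_iff_of_hub hc _ _).1 hm with h1 | h1 | h1
      exacts [Or.inl h1, Or.inr ⟨_, h1⟩, Or.inr ⟨_, h1⟩]
    rcases hq with rfl | ⟨k, rfl⟩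
    · exact Or.inl hzc.symm
    · right
      rw [hy1, h.adj_iff_of_hub hc] at hyq
      rw [h.adj_iff_of_hub hc] at hxq
      refine h.d_per ?_
      rcases hxq with h1 | h1
      · simpa using h1
      · rcases hyq with h2 | h2
        · have := eq_of_dvd_of_dvd h1 h2 (by omega) (by omega)
          omega
        · simpa using h2

theorem iso_wheelGraph {G : SimpleGraph V} (h : Strip G 4 t d) {c : V} (hc : ∀ i, c ∈ t i) :
    Nonempty (G ≃g wheelGraph 4) := by
  have hcd : ∀ i, c ≠ d i := fun i h' => h.d_notMem i (h' ▸ hc _)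
  let f : Fin 1 ⊕ Fin 4 → V := Sum.elim (fun _ => c) fun i => d (i : ℕ)
  have hf : Function.Bijective f := by
    constructor
    · rintro (i | i) (j | j) hij
      · rw [Subsingleton.elim i j]
      · exact absurd hij (hcd _)
      · exact absurd hij.symm (hcd _)
      · have := (h.d_eq_iff_of_hub hc _ _).1 hij
        congr 1
        apply Fin.ext
        omega
    · intro v
      obtain ⟨m, -, -, hm⟩ := h.exists_mem v 0
      have key : ∀ k, ∃ a, f a = d k := by
        intro k
        obtain ⟨k', h1, h2, h3⟩ := exists_dvd_window h.pos k 0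
        lift k' to ℕ using h1
        exact ⟨.inr ⟨k', by omega⟩, (h.d_per h3).symm⟩
      rcases (h.mem_iff_of_hub hc _ _).1 hm with rfl | rfl | rfl
      exacts [⟨.inl 0, rfl⟩, key _, key _]
  have hW : ∀ i j : Fin 4, (wheelGraph 4).Adj (.inr i) (.inr j) ↔
      ((j.1 : ℤ) - (i.1 + 1)) % 4 = 0 ∨ ((j.1 : ℤ) - (i.1 - 1)) % 4 = 0 := by decide
  have hadj : ∀ i, G.Adj c (d i) := fun i => h.adj (hc i) (h.d_mem i) (hcd i)
  refine ⟨SimpleGraph.Iso.symm ⟨Equiv.ofBijective f hf, ?_⟩⟩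
  rintro (i | i) (j | j)
  · rw [Subsingleton.elim i j]
    simp
  · exact iff_of_true (hadj _) (by simp [wheelGraph, joinGraph])
  · exact iff_of_true (hadj _).symm (by simp [wheelGraph, joinGraph])
  · rw [hW]
    change G.Adj (d (i : ℕ)) (d (j : ℕ)) ↔ _
    rw [h.adj_iff_of_hub hc]
    omega

/-- Bounds how often stickings can be undone for a fixed n, since each time the number of vertices
rises. -/
theorem card_le {n : ℕ} (h : Strip G n t d) : Finite V ∧ Nat.card V ≤ 3 * n := by
  classical
  have hmem : ∀ v, v ∈ (Finset.range n).biUnion fun i => t (i : ℕ) := by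
    intro v
    obtain ⟨i, h1, h2, h3⟩ := h.exists_mem v 0
    lift i to ℕ using h1
    exact Finset.mem_biUnion.2 ⟨i, by simpa using h2, h3⟩
  let _ : Fintype V := ⟨_, hmem⟩
  refine ⟨inferInstance, ?_⟩
  rw [Nat.card_eq_fintype_card]
  refine (Finset.card_biUnion_le_card_mul _ _ 3 fun i _ => (h.clique _).card_eq.le).trans ?_
  rw [Finset.card_range, mul_comm]

end Strip

/-! ### Reduction to the types and the main theorem -/

/-- `G` is an elementary or supplementary type, with triangle graph `C_n`. -/
def IsBase {V : Type*} (G : SimpleGraph V) (n : ℕ) : Prop :=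
  (Nonempty (G ≃g wheelGraph 4) ∧ n = 4) ∨ (IsSupplementary G ∧ n = 8) ∨
    (7 ≤ n ∧ Nonempty (G ≃g cycleSquare n))

theorem IsBase.triCycle {V : Type*} {G : SimpleGraph V} {n : ℕ} (h : IsBase G n) :
    4 ≤ n ∧ TriCycle G n := by
  rcases h with ⟨⟨e⟩, rfl⟩ | ⟨h, rfl⟩ | ⟨h, ⟨e⟩⟩
  · exact ⟨le_rfl, triCycle_wheelGraph.congr e.symm⟩
  · exact ⟨by norm_num, h.triCycle⟩
  · exact ⟨by omega, (triCycle_cycleSquare h).congr e.symm⟩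

/-- Every graph whose triangle graph is `C_n`, `n ≥ 4`, arises from a type by edge splittings and
vertex stickings. -/
theorem exists_base {n : ℕ} (hn : 4 ≤ n) {V : Type u} {G : SimpleGraph V} (hG : TriCovered G)
    (h : TriCycle G n) : ∃ (V₀ : Type u) (G₀ : SimpleGraph V₀) (k n₀ : ℕ),
      n = n₀ + k ∧ IsBase G₀ n₀ ∧ ObtainedFrom G₀ k G := by
  induction n using Nat.strong_induction_on generalizing V with
  | _ n ihn =>
  -- The inner measure serves the undoing of stickings, which leaves n unchanged and adds one
  -- vertex; by `Strip.card_le` the subtraction does not truncate.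
  induction hm : 3 * n - Nat.card V using Nat.strong_induction_on generalizing V with
  | _ m ihm =>
  obtain ⟨t, d, hS⟩ := exists_strip hG hn h
  have base : IsBase G n → ∃ (V₀ : Type u) (G₀ : SimpleGraph V₀) (k n₀ : ℕ),
      n = n₀ + k ∧ IsBase G₀ n₀ ∧ ObtainedFrom G₀ k G := fun hb =>
    ⟨V, G, 0, n, rfl, hb, .iso SimpleGraph.Iso.refl⟩
  have unsplit : ∀ j, 5 ≤ n → (∃ (G' : SimpleGraph {u : V // u ≠ d j}) (x' y' z' : {u : V // u ≠ d j}),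
      TriCovered G' ∧ CanSplit G' x' y' z' ∧ Nonempty (edgeSplit G' x' y' z' ≃g G)) →
      ∃ (V₀ : Type u) (G₀ : SimpleGraph V₀) (k n₀ : ℕ),
        n = n₀ + k ∧ IsBase G₀ n₀ ∧ ObtainedFrom G₀ k G := by
    rintro j hn5 ⟨G', x', y', z', hG', hsplit, ⟨e⟩⟩
    obtain ⟨n', rfl⟩ : ∃ n', n = n' + 1 := ⟨n - 1, by omega⟩
    have h' : TriCycle G' n' := (h.congr e.symm).of_edgeSplit (by omega) hsplit
    obtain ⟨V₀, G₀, k, n₀, rfl, hb, hO⟩ := ihn n' (by omega) (by omega) hG' h'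
    exact ⟨V₀, G₀, k + 1, n₀, rfl, hb, hO.split hsplit e⟩
  by_cases hinj : ∀ i j, i < j → j < i + (n : ℤ) → d i ≠ d j
  swap
  · push Not at hinj
    obtain ⟨i, j, hij, hjn, hd⟩ := hinj
    obtain ⟨v, A, hA, ⟨a₀, ha₀⟩, ⟨b₀, hb₀, hb₀A⟩, hAB⟩ := hS.exists_unstick hij hjn hd
    obtain ⟨G', hG', hdist, ⟨e⟩⟩ := exists_unstick hG hA ha₀ hb₀ hb₀A hAB
    have h' : TriCycle G' n := (triCycle_vertexStick_iff hdist).1 (h.congr e.symm)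
    obtain ⟨t', d', hS'⟩ := exists_strip hG' hn h'
    have hcard := hS'.card_le.2
    have := hS.card_le.1
    rw [Finite.card_option] at hcard
    obtain ⟨V₀, G₀, k, n₀, hk, hb, hO⟩ := ihm (3 * n - Nat.card (Option V))
      (by rw [Finite.card_option]; omega) hG' h' rfl
    exact ⟨V₀, G₀, k, n₀, hk, hb, hO.stick hdist e⟩
  by_cases hhub : ∃ c, ∀ i, c ∈ t i
  · obtain ⟨c, hc⟩ := hhub
    rcases eq_or_lt_of_le hn with rfl | hn5
    · exact base (Or.inl ⟨hS.iso_wheelGraph hc, rfl⟩)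
    · exact unsplit 0 hn5 (hS.exists_unsplit_of_hub hc (by omega))
  push Not at hhub
  have hP : Strip.Proper G n t d := ⟨hS, hinj, hhub⟩
  by_cases hT : Strip.Proper.Terminal G t d
  · by_cases hw : ∃ j, d j ∉ t (j - 2)
    · obtain ⟨h8, hs⟩ := hP.isSupplementary hT hw
      exact base (Or.inr (Or.inl ⟨hs, h8⟩))
    · push Not at hw
      exact base (Or.inr (Or.inr (hP.iso_cycleSquare hT hw)))
  · unfold Strip.Proper.Terminal at hT
    push Not at hT
    obtain ⟨j, hj, hq⟩ := hT
    refine unsplit j (by have := hP.five_le; omega)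
      (hS.exists_unsplit hj (hP.dvd_of_mem hj) ?_)
    intro y z h1 h2 h3 h4 h5 q h6 h7
    by_contra hcon
    rw [not_or] at hcon
    exact hcon.2 (hq y z q h1 h2 h3 h4 h5 h6 h7 hcon.1)

theorem isBase_iff {V : Type*} {G : SimpleGraph V} :
    (∃ n, IsBase G n) ↔ IsElementary G ∨ IsSupplementary G := by
  constructor
  · rintro ⟨n, h | h | h⟩
    exacts [Or.inl (Or.inl h.1), Or.inr h.1, Or.inl (Or.inr ⟨n, h⟩)]
  · rintro ((h | ⟨n, h⟩) | h)
    exacts [⟨4, Or.inl ⟨h, rfl⟩⟩, ⟨n, Or.inr (Or.inr h)⟩, ⟨8, Or.inr (Or.inl ⟨h, rfl⟩)⟩]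

end TriangleGraphs

theorem theorem2p2 {V : Type u} (G : SimpleGraph V)
    (hisol : ∀ x : V, ¬ G.IsIsolated x)
    (htri : ∀ x y : V, G.Adj x y → ∃ z : V, G.Adj x z ∧ G.Adj y z) :
    ((∃ n : ℕ, 3 ≤ n ∧
        Nonempty (TriangleGraphs.triangleGraph G ≃g SimpleGraph.cycleGraph n)) ↔
      (Nonempty (G ≃g TriangleGraphs.K5MinusK3) ∨
        (TriangleGraphs.IsElementary G ∨ TriangleGraphs.IsSupplementary G) ∨
        (∃ (V₀ : Type u) (G₀ : SimpleGraph V₀) (k : ℕ),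
          (TriangleGraphs.IsElementary G₀ ∨ TriangleGraphs.IsSupplementary G₀) ∧
          TriangleGraphs.ObtainedFrom G₀ k G))) ∧
    ((∃ n : ℕ, 5 ≤ n ∧ Odd n ∧
        Nonempty (TriangleGraphs.triangleGraph G ≃g SimpleGraph.cycleGraph n)) ↔
      (∃ (V₀ : Type u) (G₀ : SimpleGraph V₀) (k : ℕ),
        TriangleGraphs.ObtainedFrom G₀ k G ∧
        ((Odd k ∧
            (Nonempty (G₀ ≃g TriangleGraphs.wheelGraph 4) ∨
              TriangleGraphs.IsSupplementary G₀ ∨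
              ∃ m : ℕ, 8 ≤ m ∧ Even m ∧ Nonempty (G₀ ≃g TriangleGraphs.cycleSquare m))) ∨
          (Even k ∧
            ∃ m : ℕ, 7 ≤ m ∧ Odd m ∧ Nonempty (G₀ ≃g TriangleGraphs.cycleSquare m))))) := by
  open TriangleGraphs in
  have hG : TriCovered G := by
    refine ⟨fun x => ?_, htri⟩
    have := hisol x
    rw [SimpleGraph.IsIsolated] at this
    push Not at this
    exact this
  refine ⟨⟨?_, ?_⟩, ⟨?_, ?_⟩⟩
  · rintro ⟨n, hn, h⟩
    rcases eq_or_lt_of_le hn with rfl | hn4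
    · exact Or.inl (iso_K5MinusK3 hG h)
    · obtain ⟨V₀, G₀, k, n₀, -, hb, hO⟩ := exists_base hn4 hG h
      exact Or.inr (Or.inr ⟨V₀, G₀, k, isBase_iff.1 ⟨n₀, hb⟩, hO⟩)
  · rintro (⟨⟨e⟩⟩ | h | ⟨V₀, G₀, k, h, hO⟩)
    · exact ⟨3, le_rfl, triCycle_K5MinusK3.congr e.symm⟩
    · obtain ⟨n, hb⟩ := isBase_iff.2 h
      exact ⟨n, (by norm_num : 3 ≤ 4).trans hb.triCycle.1, hb.triCycle.2⟩
    · obtain ⟨n, hb⟩ := isBase_iff.2 h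
      have := hb.triCycle.1
      exact ⟨n + k, by omega, hO.triCycle (by omega) hb.triCycle.2⟩
  · rintro ⟨n, hn, hodd, h⟩
    obtain ⟨V₀, G₀, k, n₀, rfl, hb, hO⟩ := exists_base (by omega) hG h
    refine ⟨V₀, G₀, k, hO, ?_⟩
    rcases hb with ⟨hb, rfl⟩ | ⟨hb, rfl⟩ | hb
    · exact Or.inl ⟨(Nat.odd_add'.1 hodd).2 (by decide), Or.inl hb⟩
    · exact Or.inl ⟨(Nat.odd_add'.1 hodd).2 (by decide), Or.inr (Or.inl hb)⟩
    · rcases Nat.even_or_odd n₀ with h0 | h0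
      -- Being even, an `n₀` of at least 7 is at least 8.
      · refine Or.inl ⟨(Nat.odd_add'.1 hodd).2 h0, Or.inr (Or.inr ⟨n₀, ?_, h0, hb.2⟩)⟩
        have := hb.1
        rcases h0 with ⟨r, rfl⟩
        omega
      · exact Or.inr ⟨(Nat.odd_add.1 hodd).1 h0, n₀, hb.1, h0, hb.2⟩
  · rintro ⟨V₀, G₀, k, hO, h⟩
    have key : ∃ n₀, IsBase G₀ n₀ ∧ Odd (n₀ + k) := by
      rcases h with ⟨hk, h | h | ⟨m, hm, hme, h⟩⟩ | ⟨hk, m, hm, hmo, h⟩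
      · exact ⟨4, Or.inl ⟨h, rfl⟩, Nat.odd_add'.2 (iff_of_true hk (by decide))⟩
      · exact ⟨8, Or.inr (Or.inl ⟨h, rfl⟩), Nat.odd_add'.2 (iff_of_true hk (by decide))⟩
      · exact ⟨m, Or.inr (Or.inr ⟨by omega, h⟩), Nat.odd_add'.2 (iff_of_true hk hme)⟩
      · exact ⟨m, Or.inr (Or.inr ⟨hm, h⟩), Nat.odd_add.2 (iff_of_true hmo hk)⟩
    obtain ⟨n₀, hb, hodd⟩ := key
    have := hb.triCycle.1
    refine ⟨n₀ + k, ?_, hodd, hO.triCycle (by omega) hb.triCycle.2⟩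
    -- The length is odd and at least 4, hence at least 5.
    rcases hodd with ⟨r, hr⟩
    omega
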